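/- Let $k$ be a field and let $H=(H,\Delta,\varepsilon,\Phi,S,\alpha,\beta)$ be a finite-dimensional quasi-Hopf algebra over $k$, with the conventions $(\mathrm{id}\otimes\Delta)\Delta(h)=\Phi\,(\Delta\otimes\mathrm{id})\Delta(h)\,\Phi^{-1}$, $S(h_1)\alpha h_2=\varepsilon(h)\alpha$, $h_1\beta S(h_2)=\varepsilon(h)\beta$, $X^1\beta S(X^2)\alpha X^3=1$, $S(x^1)\alpha x^2\beta S(x^3)=1$, where $\Phi=X^1\otimes X^2\otimes X^3$ and $\Phi^{-1}=x^1\otimes x^2\otimes x^3$ (summation understood); bijectivity of $S$ is not part of the definition. For $\varphi\in H^*$ and $a\in H$ write $(\varphi\leftharpoonup a)(x)=\varphi(ax)$ and $(a\rightharpoonup\varphi)(x)=\varphi(xa)$. Then $S$ is bijective, the space $\int_l^H=\{t\in H: ht=\varepsilon(h)t\ \forall h\in H\}$ of left integrals is one-dimensional, and there is an algebra map $\mu:H\to k$ (necessarily unique) with $th=\mu(h)t$ for all $t\in\int_l^H$, $h\in H$. With these, let $$\gamma=S(x^1X^2)\alpha x^2X^3_1\otimes S(X^1)\alpha x^3X^3_2,\qquad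 \delta=x^1\beta S(x^3_2X^3)\otimes x^2X^1\beta S(x^3_1X^2),$$ $$f=(S\otimes S)(\Delta^{\mathrm{cop}}(x^1))\,\gamma\,\Delta(x^2\beta S(x^3)),\qquad f^{-1}=\Delta(S(x^1)\alpha x^2)\,\delta\,(S\otimes S)(\Delta^{\mathrm{cop}}(x^3))$$ be the Drinfeld twist and its inverse, $p_R=p^1\otimes p^2=x^1\otimes x^2\beta S(x^3)$, $q_R=q^1\otimes q^2=X^1\otimes S^{-1}(\alpha X^3)X^2$, and, writing $f=f^1\otimes f^2$, $f^{-1}=g^1\otimes g^2$, $$U=g^1S(q^2)\otimes g^2S(q^1),\qquad V=V^1\otimes V^2=S^{-1}(f^2p^2)\otimes S^{-1}(f^1p^1).$$ View $H^*$ as a right quasi-Hopf $H$-bimodule with $h\cdot\varphi\cdot h'=S(h')\rightharpoonup\varphi\leftharpoonup S^{-1}(h)$ and coaction $\rho(\varphi)=\varphi_{0}\otimes\varphi_{1}=\sum_i\varphi(V^2(e_i)_2U^2)\,e^i\otimes V^1(e_i)_1U^1$ for dual bases $(e_i)$, $(e^i)$. The space $\mathcal L\subseteq H^*$ of left cointegrals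 is its space of coinvariants, i.e. the set of $\lambda\in H^*$ with $q^1\cdot\lambda_{0}\cdot\beta S(q^2\lambda_{1})=\lambda$. The space $\mathcal R\subseteq H^*$ of right cointegrals on $H$ is the space of left cointegrals on $H^{\mathrm{cop}}$, the quasi-Hopf algebra with the same algebra and counit, with $\Delta^{\mathrm{cop}}$, $\Phi_{\mathrm{cop}}=(\Phi^{-1})^{321}$, $S_{\mathrm{cop}}=S^{-1}$, $\alpha_{\mathrm{cop}}=S^{-1}(\alpha)$, $\beta_{\mathrm{cop}}=S^{-1}(\beta)$. Put $u=\mu(V^1)S^2(V^2)$. Then: 1. $u$ is invertible in $H$. 2. If $t$ is a non-zero left integral in $H$ and $\lambda\in\mathcal L$, $\Lambda\in\mathcal R$ satisfy $\lambda(S^{-1}(t))=1$ and $\Lambda(S(t))=1$, then $\lambda\circ S^{-1}=\Lambda\leftharpoonup u$. 3. The map $\lambda\mapsto(\lambda\circ S^{-1})\leftharpoonup u^{-1}$ is a well-defined bijection $\mathcal L\to\mathcal R$. 4. If $H$ is unimodular (some non-zero left integral is also a right integral), then $\overline S^{-1}(\mathcal L)=\mathcal R$, where $\overline S^{-1}:H^*\to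 H^*$, $\varphi\mapsto\varphi\circ S^{-1}$, is the inverse of the antipode of $H^*$. -/

import Mathlib

open scoped TensorProduct

noncomputable section

universe v w

/-- The canonical algebra isomorphism `(H ⊗ H) ⊗ H ≃ H ⊗ (H ⊗ H)`. -/
abbrev tensorAssoc (k : Type v) (A B C : Type w) [Field k] [Ring A] [Algebra k A]
    [Ring B] [Algebra k B] [Ring C] [Algebra k C] :
    (A ⊗[k] B) ⊗[k] C ≃ₐ[k] A ⊗[k] (B ⊗[k] C) :=
  Algebra.TensorProduct.assoc k k k A B C

/-- The flip `a ⊗ b ↦ b ⊗ a` of `H ⊗ H`. -/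
abbrev tensorFlip (k : Type v) (H : Type w) [Field k] [Ring H] [Algebra k H] :
    H ⊗[k] H ≃ₐ[k] H ⊗[k] H :=
  Algebra.TensorProduct.comm k H H

/-- The reversal `a ⊗ (b ⊗ c) ↦ c ⊗ (b ⊗ a)` of `H ⊗ (H ⊗ H)`. -/
def tensorReverse (k : Type v) (H : Type w) [Field k] [Ring H] [Algebra k H] :
    H ⊗[k] (H ⊗[k] H) ≃ₐ[k] H ⊗[k] (H ⊗[k] H) :=
  (Algebra.TensorProduct.comm k H (H ⊗[k] H)).trans
    ((Algebra.TensorProduct.congr (tensorFlip k H) AlgEquiv.refl).trans (tensorAssoc k H H H))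

/-- `a ⊗ b ↦ S a * c * b`. -/
def sandwichLeft {k : Type v} {H : Type w} [Field k] [Ring H] [Algebra k H]
    (S : H →ₗ[k] H) (c : H) : H ⊗[k] H →ₗ[k] H :=
  LinearMap.mul' k H ∘ₗ TensorProduct.map (LinearMap.mulRight k c ∘ₗ S) LinearMap.id

/-- `a ⊗ b ↦ a * c * S b`. -/
def sandwichRight {k : Type v} {H : Type w} [Field k] [Ring H] [Algebra k H]
    (S : H →ₗ[k] H) (c : H) : H ⊗[k] H →ₗ[k] H :=
  LinearMap.mul' k H ∘ₗ TensorProduct.map (LinearMap.mulRight k c) S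

/-- A quasi-Hopf algebra structure on the `k`-algebra `H`. The antipode is not required to be
bijective, and `α`, `β` are not normalized. Triple tensors live in `H ⊗ (H ⊗ H)` and quadruple
tensors in `H ⊗ (H ⊗ (H ⊗ H))`. -/
structure QuasiHopfAlgebra (k : Type v) (H : Type w) [Field k] [Ring H] [Algebra k H] where
  /-- The comultiplication `Δ`. -/
  comul : H →ₐ[k] H ⊗[k] H
  /-- The counit `ε`. -/
  counit : H →ₐ[k] k
  /-- The reassociator `Φ`. -/
  reassoc : (H ⊗[k] (H ⊗[k] H))ˣ
  /-- The antipode `S`. -/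
  antipode : H →ₗ[k] H
  alpha : H
  beta : H
  /-- `(id ⊗ Δ)(Δ h) = Φ (Δ ⊗ id)(Δ h) Φ⁻¹`. -/
  quasi_coassoc : ∀ h : H,
    Algebra.TensorProduct.map (AlgHom.id k H) comul (comul h) =
      (reassoc : H ⊗[k] (H ⊗[k] H)) *
        tensorAssoc k H H H (Algebra.TensorProduct.map comul (AlgHom.id k H) (comul h)) *
          ((reassoc⁻¹ : (H ⊗[k] (H ⊗[k] H))ˣ) : H ⊗[k] (H ⊗[k] H))
  /-- `(id ⊗ ε)(Δ h) = h`. -/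
  counit_right : ∀ h : H,
    Algebra.TensorProduct.map (AlgHom.id k H) counit (comul h) = h ⊗ₜ[k] (1 : k)
  /-- `(ε ⊗ id)(Δ h) = h`. -/
  counit_left : ∀ h : H,
    Algebra.TensorProduct.map counit (AlgHom.id k H) (comul h) = (1 : k) ⊗ₜ[k] h
  /-- `(1 ⊗ Φ) (id ⊗ Δ ⊗ id)(Φ) (Φ ⊗ 1) = (id ⊗ id ⊗ Δ)(Φ) (Δ ⊗ id ⊗ id)(Φ)`. -/
  pentagon :
    ((1 : H) ⊗ₜ[k] (reassoc : H ⊗[k] (H ⊗[k] H))) *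
        Algebra.TensorProduct.map (AlgHom.id k H)
          ((tensorAssoc k H H H : (H ⊗[k] H) ⊗[k] H →ₐ[k] H ⊗[k] (H ⊗[k] H)).comp
            (Algebra.TensorProduct.map comul (AlgHom.id k H)))
          (reassoc : H ⊗[k] (H ⊗[k] H)) *
        Algebra.TensorProduct.map (AlgHom.id k H)
          (Algebra.TensorProduct.map (AlgHom.id k H)
            (Algebra.TensorProduct.includeLeft : H →ₐ[k] H ⊗[k] H))
          (reassoc : H ⊗[k] (H ⊗[k] H)) =
      Algebra.TensorProduct.map (AlgHom.id k H)
          (Algebra.TensorProduct.map (AlgHom.id k H) comul)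
          (reassoc : H ⊗[k] (H ⊗[k] H)) *
        tensorAssoc k H H (H ⊗[k] H)
          (Algebra.TensorProduct.map comul (AlgHom.id k (H ⊗[k] H))
            (reassoc : H ⊗[k] (H ⊗[k] H)))
  /-- `(id ⊗ ε ⊗ id)(Φ) = 1 ⊗ 1`. -/
  counit_reassoc :
    Algebra.TensorProduct.map (AlgHom.id k H)
        ((Algebra.TensorProduct.lid k H : k ⊗[k] H →ₐ[k] H).comp
          (Algebra.TensorProduct.map counit (AlgHom.id k H)))
        (reassoc : H ⊗[k] (H ⊗[k] H)) = 1
  antipode_one : antipode 1 = 1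
  antipode_mul : ∀ a b : H, antipode (a * b) = antipode b * antipode a
  /-- `S(h₁) α h₂ = ε(h) α`. -/
  antipode_alpha : ∀ h : H, sandwichLeft antipode alpha (comul h) = counit h • alpha
  /-- `h₁ β S(h₂) = ε(h) β`. -/
  antipode_beta : ∀ h : H, sandwichRight antipode beta (comul h) = counit h • beta
  /-- `X¹ β S(X²) α X³ = 1`, where `Φ = X¹ ⊗ X² ⊗ X³`. -/
  antipode_reassoc :
    sandwichRight LinearMap.id beta
      (TensorProduct.map LinearMap.id (sandwichLeft antipode alpha)
        (reassoc : H ⊗[k] (H ⊗[k] H))) = 1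
  /-- `S(x¹) α x² β S(x³) = 1`, where `Φ⁻¹ = x¹ ⊗ x² ⊗ x³`. -/
  antipode_reassoc_inv :
    sandwichLeft antipode alpha
      (TensorProduct.map LinearMap.id (sandwichRight antipode beta)
        ((reassoc⁻¹ : (H ⊗[k] (H ⊗[k] H))ˣ) : H ⊗[k] (H ⊗[k] H))) = 1

namespace QuasiHopfAlgebra

variable {k : Type v} {H : Type w} [Field k] [Ring H] [Algebra k H]

/-- The inverse `S⁻¹` of a bijective antipode. -/
def antipodeInv (Q : QuasiHopfAlgebra k H) (hS : Function.Bijective Q.antipode) : H →ₗ[k] H :=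
  (LinearEquiv.ofBijective Q.antipode hS).symm

theorem antipodeInv_antipode (Q : QuasiHopfAlgebra k H) (hS : Function.Bijective Q.antipode)
    (h : H) : Q.antipodeInv hS (Q.antipode h) = h :=
  (LinearEquiv.ofBijective Q.antipode hS).symm_apply_apply h

theorem antipode_antipodeInv (Q : QuasiHopfAlgebra k H) (hS : Function.Bijective Q.antipode)
    (h : H) : Q.antipode (Q.antipodeInv hS h) = h :=
  (LinearEquiv.ofBijective Q.antipode hS).apply_symm_apply h

theorem antipodeInv_bijective (Q : QuasiHopfAlgebra k H)
    (hS : Function.Bijective Q.antipode) : Function.Bijective (Q.antipodeInv hS) :=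
  (LinearEquiv.ofBijective Q.antipode hS).symm.bijective

theorem antipodeInv_mul (Q : QuasiHopfAlgebra k H) (hS : Function.Bijective Q.antipode)
    (a b : H) : Q.antipodeInv hS (a * b) = Q.antipodeInv hS b * Q.antipodeInv hS a := by
  apply hS.1
  simp only [antipode_mul, antipode_antipodeInv]

theorem antipodeInv_one (Q : QuasiHopfAlgebra k H) (hS : Function.Bijective Q.antipode) :
    Q.antipodeInv hS 1 = 1 := by
  apply hS.1
  simp only [antipode_one, antipode_antipodeInv]

theorem map_comulCop_flip (Δ : H →ₐ[k] H ⊗[k] H) (y : H ⊗[k] H) :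
    Algebra.TensorProduct.map (AlgHom.id k H)
        ((tensorFlip k H : H ⊗[k] H →ₐ[k] H ⊗[k] H).comp Δ) (tensorFlip k H y) =
      tensorReverse k H (tensorAssoc k H H H
        (Algebra.TensorProduct.map Δ (AlgHom.id k H) y)) := by
  induction y with
  | zero => simp
  | add y z hy hz => simp only [map_add, hy, hz]
  | tmul a b =>
    simp only [Algebra.TensorProduct.comm_tmul, Algebra.TensorProduct.map_tmul, AlgHom.id_apply,
      AlgHom.comp_apply]
    induction Δ a with
    | zero => simp
    | add y z hy hz => simp only [map_add, TensorProduct.add_tmul, TensorProduct.tmul_add, hy, hz]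
    | tmul c d => simp [tensorReverse]

theorem assoc_comulCop_flip (Δ : H →ₐ[k] H ⊗[k] H) (y : H ⊗[k] H) :
    tensorAssoc k H H H (Algebra.TensorProduct.map
        ((tensorFlip k H : H ⊗[k] H →ₐ[k] H ⊗[k] H).comp Δ) (AlgHom.id k H)
          (tensorFlip k H y)) =
      tensorReverse k H (Algebra.TensorProduct.map (AlgHom.id k H) Δ y) := by
  induction y with
  | zero => simp
  | add y z hy hz => simp only [map_add, hy, hz]
  | tmul a b =>
    simp only [Algebra.TensorProduct.comm_tmul, Algebra.TensorProduct.map_tmul, AlgHom.id_apply,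
      AlgHom.comp_apply]
    induction Δ b with
    | zero => simp
    | add y z hy hz => simp only [map_add, TensorProduct.add_tmul, TensorProduct.tmul_add, hy, hz]
    | tmul c d => simp [tensorReverse]

/-- The reversal `a ⊗ (b ⊗ (c ⊗ d)) ↦ d ⊗ (c ⊗ (b ⊗ a))`. -/
def tensorReverseFour (k : Type v) (H : Type w) [Field k] [Ring H] [Algebra k H] :
    H ⊗[k] (H ⊗[k] (H ⊗[k] H)) ≃ₐ[k] H ⊗[k] (H ⊗[k] (H ⊗[k] H)) :=
  (Algebra.TensorProduct.comm k H (H ⊗[k] (H ⊗[k] H))).trans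
    ((Algebra.TensorProduct.congr (tensorReverse k H) AlgEquiv.refl).trans
      ((tensorAssoc k H (H ⊗[k] H) H).trans
        (Algebra.TensorProduct.congr AlgEquiv.refl (tensorAssoc k H H H))))

theorem tensorReverse_tmul (a b c : H) :
    tensorReverse k H (a ⊗ₜ (b ⊗ₜ c)) = c ⊗ₜ (b ⊗ₜ a) := by
  simp [tensorReverse]

theorem tensorReverseFour_tmul (a b c d : H) :
    tensorReverseFour k H (a ⊗ₜ (b ⊗ₜ (c ⊗ₜ d))) = d ⊗ₜ (c ⊗ₜ (b ⊗ₜ a)) := by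
  simp [tensorReverseFour, tensorReverse]

/-- Induction on pure tensors of `H ⊗ (H ⊗ H)`. -/
theorem tensor_three_induction {p : H ⊗[k] (H ⊗[k] H) → Prop}
    (x : H ⊗[k] (H ⊗[k] H)) (zero : p 0) (add : ∀ y z, p y → p z → p (y + z))
    (tmul : ∀ a b c, p (a ⊗ₜ (b ⊗ₜ c))) : p x := by
  induction x with
  | zero => exact zero
  | add y z hy hz => exact add y z hy hz
  | tmul a y =>
    induction y with
    | zero => simpa using zero
    | add y z hy hz => rw [TensorProduct.tmul_add]; exact add _ _ hy hz
    | tmul b c => exact tmul a b c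

theorem reverse_one_tmul (x : H ⊗[k] (H ⊗[k] H)) :
    (1 : H) ⊗ₜ[k] tensorReverse k H x =
      tensorReverseFour k H (Algebra.TensorProduct.map (AlgHom.id k H)
        (Algebra.TensorProduct.map (AlgHom.id k H)
          (Algebra.TensorProduct.includeLeft : H →ₐ[k] H ⊗[k] H)) x) := by
  induction x using tensor_three_induction with
  | zero => simp
  | add y z hy hz => simp only [map_add, TensorProduct.tmul_add, hy, hz]
  | tmul a b c => simp [tensorReverse_tmul, tensorReverseFour_tmul]

theorem reverse_tmul_one (x : H ⊗[k] (H ⊗[k] H)) :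
    Algebra.TensorProduct.map (AlgHom.id k H)
        (Algebra.TensorProduct.map (AlgHom.id k H)
          (Algebra.TensorProduct.includeLeft : H →ₐ[k] H ⊗[k] H)) (tensorReverse k H x) =
      tensorReverseFour k H ((1 : H) ⊗ₜ[k] x) := by
  induction x using tensor_three_induction with
  | zero => simp
  | add y z hy hz => simp only [map_add, TensorProduct.tmul_add, hy, hz]
  | tmul a b c => simp [tensorReverse_tmul, tensorReverseFour_tmul]

theorem reverse_comul_middle (Δ : H →ₐ[k] H ⊗[k] H) (x : H ⊗[k] (H ⊗[k] H)) :
    Algebra.TensorProduct.map (AlgHom.id k H)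
        ((tensorAssoc k H H H : (H ⊗[k] H) ⊗[k] H →ₐ[k] H ⊗[k] (H ⊗[k] H)).comp
          (Algebra.TensorProduct.map ((tensorFlip k H : H ⊗[k] H →ₐ[k] H ⊗[k] H).comp Δ)
            (AlgHom.id k H))) (tensorReverse k H x) =
      tensorReverseFour k H (Algebra.TensorProduct.map (AlgHom.id k H)
        ((tensorAssoc k H H H : (H ⊗[k] H) ⊗[k] H →ₐ[k] H ⊗[k] (H ⊗[k] H)).comp
          (Algebra.TensorProduct.map Δ (AlgHom.id k H))) x) := by
  induction x using tensor_three_induction with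
  | zero => simp
  | add y z hy hz => simp only [map_add, hy, hz]
  | tmul a b c =>
    simp only [tensorReverse_tmul, Algebra.TensorProduct.map_tmul, AlgHom.id_apply,
      AlgHom.comp_apply]
    induction Δ b with
    | zero => simp
    | add y z hy hz => simp only [map_add, TensorProduct.add_tmul, TensorProduct.tmul_add, hy, hz]
    | tmul d e => simp [tensorReverseFour_tmul]

theorem reverse_comul_right (Δ : H →ₐ[k] H ⊗[k] H) (x : H ⊗[k] (H ⊗[k] H)) :
    Algebra.TensorProduct.map (AlgHom.id k H)
        (Algebra.TensorProduct.map (AlgHom.id k H)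
          ((tensorFlip k H : H ⊗[k] H →ₐ[k] H ⊗[k] H).comp Δ)) (tensorReverse k H x) =
      tensorReverseFour k H (tensorAssoc k H H (H ⊗[k] H)
        (Algebra.TensorProduct.map Δ (AlgHom.id k (H ⊗[k] H)) x)) := by
  induction x using tensor_three_induction with
  | zero => simp
  | add y z hy hz => simp only [map_add, hy, hz]
  | tmul a b c =>
    simp only [tensorReverse_tmul, Algebra.TensorProduct.map_tmul, AlgHom.id_apply,
      AlgHom.comp_apply]
    induction Δ a with
    | zero => simp
    | add y z hy hz => simp only [map_add, TensorProduct.add_tmul, TensorProduct.tmul_add, hy, hz]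
    | tmul d e => simp [tensorReverseFour_tmul]

theorem reverse_comul_left (Δ : H →ₐ[k] H ⊗[k] H) (x : H ⊗[k] (H ⊗[k] H)) :
    tensorAssoc k H H (H ⊗[k] H) (Algebra.TensorProduct.map
        ((tensorFlip k H : H ⊗[k] H →ₐ[k] H ⊗[k] H).comp Δ) (AlgHom.id k (H ⊗[k] H))
          (tensorReverse k H x)) =
      tensorReverseFour k H (Algebra.TensorProduct.map (AlgHom.id k H)
        (Algebra.TensorProduct.map (AlgHom.id k H) Δ) x) := by
  induction x using tensor_three_induction with
  | zero => simp
  | add y z hy hz => simp only [map_add, hy, hz]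
  | tmul a b c =>
    simp only [tensorReverse_tmul, Algebra.TensorProduct.map_tmul, AlgHom.id_apply,
      AlgHom.comp_apply]
    induction Δ c with
    | zero => simp
    | add y z hy hz => simp only [map_add, TensorProduct.add_tmul, TensorProduct.tmul_add, hy, hz]
    | tmul d e => simp [tensorReverseFour_tmul]

theorem reverse_counit (ε : H →ₐ[k] k) (x : H ⊗[k] (H ⊗[k] H)) :
    Algebra.TensorProduct.map (AlgHom.id k H)
        ((Algebra.TensorProduct.lid k H : k ⊗[k] H →ₐ[k] H).comp
          (Algebra.TensorProduct.map ε (AlgHom.id k H))) (tensorReverse k H x) =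
      tensorFlip k H (Algebra.TensorProduct.map (AlgHom.id k H)
        ((Algebra.TensorProduct.lid k H : k ⊗[k] H →ₐ[k] H).comp
          (Algebra.TensorProduct.map ε (AlgHom.id k H))) x) := by
  induction x using tensor_three_induction with
  | zero => simp
  | add y z hy hz => simp only [map_add, hy, hz]
  | tmul a b c => simp [tensorReverse_tmul]

theorem pentagon_inv (Q : QuasiHopfAlgebra k H) :
    Algebra.TensorProduct.map (AlgHom.id k H)
          (Algebra.TensorProduct.map (AlgHom.id k H)
            (Algebra.TensorProduct.includeLeft : H →ₐ[k] H ⊗[k] H))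
          ((Q.reassoc⁻¹ : (H ⊗[k] (H ⊗[k] H))ˣ) : H ⊗[k] (H ⊗[k] H)) *
        Algebra.TensorProduct.map (AlgHom.id k H)
          ((tensorAssoc k H H H : (H ⊗[k] H) ⊗[k] H →ₐ[k] H ⊗[k] (H ⊗[k] H)).comp
            (Algebra.TensorProduct.map Q.comul (AlgHom.id k H)))
          ((Q.reassoc⁻¹ : (H ⊗[k] (H ⊗[k] H))ˣ) : H ⊗[k] (H ⊗[k] H)) *
        ((1 : H) ⊗ₜ[k] ((Q.reassoc⁻¹ : (H ⊗[k] (H ⊗[k] H))ˣ) : H ⊗[k] (H ⊗[k] H))) =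
      tensorAssoc k H H (H ⊗[k] H)
          (Algebra.TensorProduct.map Q.comul (AlgHom.id k (H ⊗[k] H))
            ((Q.reassoc⁻¹ : (H ⊗[k] (H ⊗[k] H))ˣ) : H ⊗[k] (H ⊗[k] H))) *
        Algebra.TensorProduct.map (AlgHom.id k H)
          (Algebra.TensorProduct.map (AlgHom.id k H) Q.comul)
          ((Q.reassoc⁻¹ : (H ⊗[k] (H ⊗[k] H))ˣ) : H ⊗[k] (H ⊗[k] H)) := by
  have h := Q.pentagon
  let i₁ : H ⊗[k] (H ⊗[k] H) →ₐ[k] H ⊗[k] (H ⊗[k] (H ⊗[k] H)) :=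
    Algebra.TensorProduct.includeRight
  let i₂ := Algebra.TensorProduct.map (AlgHom.id k H)
    ((tensorAssoc k H H H : (H ⊗[k] H) ⊗[k] H →ₐ[k] H ⊗[k] (H ⊗[k] H)).comp
      (Algebra.TensorProduct.map Q.comul (AlgHom.id k H)))
  let i₃ := Algebra.TensorProduct.map (AlgHom.id k H) (Algebra.TensorProduct.map (AlgHom.id k H)
    (Algebra.TensorProduct.includeLeft : H →ₐ[k] H ⊗[k] H))
  let i₄ := Algebra.TensorProduct.map (AlgHom.id k H)
    (Algebra.TensorProduct.map (AlgHom.id k H) Q.comul)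
  let i₅ := (tensorAssoc k H H (H ⊗[k] H) :
      (H ⊗[k] H) ⊗[k] (H ⊗[k] H) →ₐ[k] H ⊗[k] (H ⊗[k] (H ⊗[k] H))).comp
    (Algebra.TensorProduct.map Q.comul (AlgHom.id k (H ⊗[k] H)))
  let m (i : H ⊗[k] (H ⊗[k] H) →ₐ[k] H ⊗[k] (H ⊗[k] (H ⊗[k] H))) :=
    Units.map (i : H ⊗[k] (H ⊗[k] H) →* H ⊗[k] (H ⊗[k] (H ⊗[k] H))) Q.reassoc
  have hu : m i₁ * m i₂ * m i₃ = m i₄ * m i₅ := Units.ext h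
  have hv := congrArg (fun y => ((y⁻¹ : (H ⊗[k] (H ⊗[k] (H ⊗[k] H)))ˣ) :
    H ⊗[k] (H ⊗[k] (H ⊗[k] H)))) hu
  simp only [mul_inv_rev, Units.val_mul, ← mul_assoc] at hv
  exact hv

theorem antipodeInv_sandwichLeft (Q : QuasiHopfAlgebra k H)
    (hS : Function.Bijective Q.antipode) (c : H) (y : H ⊗[k] H) :
    sandwichLeft (Q.antipodeInv hS) (Q.antipodeInv hS c) (tensorFlip k H y) =
      Q.antipodeInv hS (sandwichLeft Q.antipode c y) := by
  induction y with
  | zero => simp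
  | add y z hy hz => simp only [map_add, hy, hz]
  | tmul a b =>
    simp [sandwichLeft, antipodeInv_mul, antipodeInv_antipode, mul_assoc]

theorem antipodeInv_sandwichRight (Q : QuasiHopfAlgebra k H)
    (hS : Function.Bijective Q.antipode) (c : H) (y : H ⊗[k] H) :
    sandwichRight (Q.antipodeInv hS) (Q.antipodeInv hS c) (tensorFlip k H y) =
      Q.antipodeInv hS (sandwichRight Q.antipode c y) := by
  induction y with
  | zero => simp
  | add y z hy hz => simp only [map_add, hy, hz]
  | tmul a b =>
    simp [sandwichRight, antipodeInv_mul, antipodeInv_antipode, mul_assoc]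

theorem antipodeInv_sandwich_reverse (Q : QuasiHopfAlgebra k H)
    (hS : Function.Bijective Q.antipode) (x : H ⊗[k] (H ⊗[k] H)) :
    sandwichRight LinearMap.id (Q.antipodeInv hS Q.beta)
      (TensorProduct.map LinearMap.id
        (sandwichLeft (Q.antipodeInv hS) (Q.antipodeInv hS Q.alpha))
          (tensorReverse k H x)) =
      Q.antipodeInv hS (sandwichLeft Q.antipode Q.alpha
        (TensorProduct.map LinearMap.id (sandwichRight Q.antipode Q.beta) x)) := by
  induction x using tensor_three_induction with
  | zero => simp
  | add y z hy hz => simp only [map_add, hy, hz]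
  | tmul a b c =>
    simp [tensorReverse_tmul, sandwichLeft, sandwichRight, antipodeInv_mul,
      antipodeInv_antipode, mul_assoc]

theorem antipodeInv_sandwich_reverse_inv (Q : QuasiHopfAlgebra k H)
    (hS : Function.Bijective Q.antipode) (x : H ⊗[k] (H ⊗[k] H)) :
    sandwichLeft (Q.antipodeInv hS) (Q.antipodeInv hS Q.alpha)
      (TensorProduct.map LinearMap.id
        (sandwichRight (Q.antipodeInv hS) (Q.antipodeInv hS Q.beta))
          (tensorReverse k H x)) =
      Q.antipodeInv hS (sandwichRight LinearMap.id Q.beta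
        (TensorProduct.map LinearMap.id (sandwichLeft Q.antipode Q.alpha) x)) := by
  induction x using tensor_three_induction with
  | zero => simp
  | add y z hy hz => simp only [map_add, hy, hz]
  | tmul a b c =>
    simp [tensorReverse_tmul, sandwichLeft, sandwichRight, antipodeInv_mul,
      antipodeInv_antipode, mul_assoc]

/-- The coopposite quasi-Hopf algebra `H^cop`: same algebra and counit, `Δ_cop = Δ` flipped,
`Φ_cop = (Φ⁻¹)³²¹`, `S_cop = S⁻¹`, `α_cop = S⁻¹(α)`, `β_cop = S⁻¹(β)`. -/
def cop (Q : QuasiHopfAlgebra k H) (hS : Function.Bijective Q.antipode) :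
    QuasiHopfAlgebra k H where
  comul := (tensorFlip k H : H ⊗[k] H →ₐ[k] H ⊗[k] H).comp Q.comul
  counit := Q.counit
  reassoc := Units.map (tensorReverse k H : H ⊗[k] (H ⊗[k] H) →* H ⊗[k] (H ⊗[k] H)) Q.reassoc⁻¹
  antipode := Q.antipodeInv hS
  alpha := Q.antipodeInv hS Q.alpha
  beta := Q.antipodeInv hS Q.beta
  quasi_coassoc := by
    intro h
    have key : tensorAssoc k H H H
        (Algebra.TensorProduct.map Q.comul (AlgHom.id k H) (Q.comul h)) =
        ((Q.reassoc⁻¹ : (H ⊗[k] (H ⊗[k] H))ˣ) : H ⊗[k] (H ⊗[k] H)) *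
          Algebra.TensorProduct.map (AlgHom.id k H) Q.comul (Q.comul h) *
            (Q.reassoc : H ⊗[k] (H ⊗[k] H)) := by
      rw [Q.quasi_coassoc h]
      simp [mul_assoc]
    have h₁ := map_comulCop_flip Q.comul (Q.comul h)
    have h₂ := assoc_comulCop_flip Q.comul (Q.comul h)
    refine h₁.trans ?_
    refine Eq.trans ?_ (congrArg (fun y =>
      tensorReverse k H ((Q.reassoc⁻¹ : (H ⊗[k] (H ⊗[k] H))ˣ) : H ⊗[k] (H ⊗[k] H)) * y *
        tensorReverse k H (Q.reassoc : H ⊗[k] (H ⊗[k] H))) h₂.symm)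
    rw [key, map_mul, map_mul]
  counit_right := by
    intro h
    have h₁ : ∀ y : H ⊗[k] H,
        Algebra.TensorProduct.map (AlgHom.id k H) Q.counit (tensorFlip k H y) =
          Algebra.TensorProduct.comm k k H
            (Algebra.TensorProduct.map Q.counit (AlgHom.id k H) y) := by
      intro y
      induction y with
      | zero => simp
      | add y z hy hz => simp only [map_add, hy, hz]
      | tmul a b => simp
    refine (h₁ (Q.comul h)).trans ?_
    rw [Q.counit_left h, Algebra.TensorProduct.comm_tmul]
  counit_left := by
    intro h
    have h₁ : ∀ y : H ⊗[k] H,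
        Algebra.TensorProduct.map Q.counit (AlgHom.id k H) (tensorFlip k H y) =
          Algebra.TensorProduct.comm k H k
            (Algebra.TensorProduct.map (AlgHom.id k H) Q.counit y) := by
      intro y
      induction y with
      | zero => simp
      | add y z hy hz => simp only [map_add, hy, hz]
      | tmul a b => simp
    refine (h₁ (Q.comul h)).trans ?_
    rw [Q.counit_right h, Algebra.TensorProduct.comm_tmul]
  pentagon := by
    simp only [Units.coe_map, MonoidHom.coe_coe]
    rw [reverse_one_tmul, reverse_comul_middle, reverse_tmul_one, reverse_comul_right,
      reverse_comul_left, ← map_mul, ← map_mul, ← map_mul, Q.pentagon_inv]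
  counit_reassoc := by
    have h₁ : Algebra.TensorProduct.map (AlgHom.id k H)
        ((Algebra.TensorProduct.lid k H : k ⊗[k] H →ₐ[k] H).comp
          (Algebra.TensorProduct.map Q.counit (AlgHom.id k H)))
        ((Q.reassoc⁻¹ : (H ⊗[k] (H ⊗[k] H))ˣ) : H ⊗[k] (H ⊗[k] H)) = 1 := by
      have h₂ := Q.counit_reassoc
      set i := Algebra.TensorProduct.map (AlgHom.id k H)
        ((Algebra.TensorProduct.lid k H : k ⊗[k] H →ₐ[k] H).comp
          (Algebra.TensorProduct.map Q.counit (AlgHom.id k H)))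
      have h₃ : i (Q.reassoc : H ⊗[k] (H ⊗[k] H)) *
          i ((Q.reassoc⁻¹ : (H ⊗[k] (H ⊗[k] H))ˣ) : H ⊗[k] (H ⊗[k] H)) = 1 := by
        rw [← map_mul, Units.mul_inv, map_one]
      rwa [h₂, one_mul] at h₃
    simp only [Units.coe_map, MonoidHom.coe_coe]
    rw [reverse_counit, h₁, map_one]
  antipode_one := Q.antipodeInv_one hS
  antipode_mul := Q.antipodeInv_mul hS
  antipode_alpha := by
    intro h
    refine (Q.antipodeInv_sandwichLeft hS _ (Q.comul h)).trans ?_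
    rw [Q.antipode_alpha, map_smul]
  antipode_beta := by
    intro h
    refine (Q.antipodeInv_sandwichRight hS _ (Q.comul h)).trans ?_
    rw [Q.antipode_beta, map_smul]
  antipode_reassoc := by
    simp only [Units.coe_map, MonoidHom.coe_coe]
    rw [antipodeInv_sandwich_reverse, Q.antipode_reassoc_inv, antipodeInv_one]
  antipode_reassoc_inv := by
    rw [← map_inv, inv_inv]
    simp only [Units.coe_map, MonoidHom.coe_coe]
    rw [antipodeInv_sandwich_reverse_inv, Q.antipode_reassoc, antipodeInv_one]

/-- The space of left integrals, `h t = ε(h) t` for all `h`. -/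
def leftIntegrals (Q : QuasiHopfAlgebra k H) : Submodule k H where
  carrier := {t | ∀ h : H, h * t = Q.counit h • t}
  zero_mem' := by intro h; simp
  add_mem' := by
    intro a b ha hb h
    simp only [Set.mem_ofPred_eq] at ha hb
    rw [mul_add, ha, hb, smul_add]
  smul_mem' := by
    intro c a ha h
    simp only [Set.mem_ofPred_eq] at ha
    rw [mul_smul_comm, ha, smul_comm]

/-- The space of right integrals, `r h = ε(h) r` for all `h`. -/
def rightIntegrals (Q : QuasiHopfAlgebra k H) : Submodule k H where
  carrier := {r | ∀ h : H, r * h = Q.counit h • r}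
  zero_mem' := by intro h; simp
  add_mem' := by
    intro a b ha hb h
    simp only [Set.mem_ofPred_eq] at ha hb
    rw [add_mul, ha, hb, smul_add]
  smul_mem' := by
    intro c a ha h
    simp only [Set.mem_ofPred_eq] at ha
    rw [smul_mul_assoc, ha, smul_comm]

/-- There is a non-zero left integral which is also a right integral. -/
def IsUnimodular (Q : QuasiHopfAlgebra k H) : Prop :=
  ∃ t : H, t ≠ 0 ∧ t ∈ Q.leftIntegrals ∧ t ∈ Q.rightIntegrals

/-- `Φ⁻¹ = x¹ ⊗ x² ⊗ x³`. -/
def reassocInv (Q : QuasiHopfAlgebra k H) : H ⊗[k] (H ⊗[k] H) :=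
  ((Q.reassoc⁻¹ : (H ⊗[k] (H ⊗[k] H))ˣ) : H ⊗[k] (H ⊗[k] H))

/-- `γ = S(x¹X²) α x²X³₁ ⊗ S(X¹) α x³X³₂`, obtained from
`(1 ⊗ Φ⁻¹) (id ⊗ id ⊗ Δ)(Φ) = X¹ ⊗ x¹X² ⊗ x²X³₁ ⊗ x³X³₂`
by `a ⊗ b ⊗ c ⊗ d ↦ S(b) α c ⊗ S(a) α d`. -/
def gamma (Q : QuasiHopfAlgebra k H) : H ⊗[k] H :=
  TensorProduct.map (sandwichLeft Q.antipode Q.alpha) (sandwichLeft Q.antipode Q.alpha)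
    ((TensorProduct.assoc k H H (H ⊗[k] H)).symm
      (TensorProduct.map LinearMap.id (TensorProduct.leftComm k H H H).toLinearMap
        (TensorProduct.leftComm k H H (H ⊗[k] H)
          (((1 : H) ⊗ₜ[k] Q.reassocInv) *
            Algebra.TensorProduct.map (AlgHom.id k H)
              (Algebra.TensorProduct.map (AlgHom.id k H) Q.comul)
              (Q.reassoc : H ⊗[k] (H ⊗[k] H))))))

/-- `δ = x¹ β S(x³₂X³) ⊗ x²X¹ β S(x³₁X²)`, obtained from
`(id ⊗ id ⊗ Δ)(Φ⁻¹) (1 ⊗ Φ) = x¹ ⊗ x²X¹ ⊗ x³₁X² ⊗ x³₂X³`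
by `a ⊗ b ⊗ c ⊗ d ↦ a β S(d) ⊗ b β S(c)`. -/
def delta (Q : QuasiHopfAlgebra k H) : H ⊗[k] H :=
  TensorProduct.map (sandwichRight Q.antipode Q.beta) (sandwichRight Q.antipode Q.beta)
    ((TensorProduct.assoc k H H (H ⊗[k] H)).symm
      (TensorProduct.map LinearMap.id
        ((TensorProduct.comm k (H ⊗[k] H) H).toLinearMap ∘ₗ
          (TensorProduct.assoc k H H H).symm.toLinearMap)
        (Algebra.TensorProduct.map (AlgHom.id k H)
            (Algebra.TensorProduct.map (AlgHom.id k H) Q.comul) Q.reassocInv *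
          ((1 : H) ⊗ₜ[k] (Q.reassoc : H ⊗[k] (H ⊗[k] H))))))

/-- `h ↦ (S ⊗ S)(Δ^cop(h))`. -/
def antipodeComulCop (Q : QuasiHopfAlgebra k H) : H →ₗ[k] H ⊗[k] H :=
  TensorProduct.map Q.antipode Q.antipode ∘ₗ (TensorProduct.comm k H H).toLinearMap ∘ₗ
    Q.comul.toLinearMap

/-- The Drinfeld twist `f = (S ⊗ S)(Δ^cop(x¹)) γ Δ(x² β S(x³))`. -/
def twist (Q : QuasiHopfAlgebra k H) : H ⊗[k] H :=
  LinearMap.mul' k (H ⊗[k] H)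
    (TensorProduct.map (LinearMap.mulRight k Q.gamma ∘ₗ Q.antipodeComulCop)
      (Q.comul.toLinearMap ∘ₗ sandwichRight Q.antipode Q.beta) Q.reassocInv)

/-- The inverse `f⁻¹ = Δ(S(x¹) α x²) δ (S ⊗ S)(Δ^cop(x³))` of the Drinfeld twist. -/
def twistInv (Q : QuasiHopfAlgebra k H) : H ⊗[k] H :=
  LinearMap.mul' k (H ⊗[k] H)
    (TensorProduct.map
      (LinearMap.mulRight k Q.delta ∘ₗ Q.comul.toLinearMap ∘ₗ
        sandwichLeft Q.antipode Q.alpha)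
      Q.antipodeComulCop ((TensorProduct.assoc k H H H).symm Q.reassocInv))

/-- `p_R = x¹ ⊗ x² β S(x³)`. -/
def pR (Q : QuasiHopfAlgebra k H) : H ⊗[k] H :=
  TensorProduct.map LinearMap.id (sandwichRight Q.antipode Q.beta) Q.reassocInv

/-- `q_R = X¹ ⊗ S⁻¹(α X³) X²`. -/
def qR (Q : QuasiHopfAlgebra k H) (hS : Function.Bijective Q.antipode) : H ⊗[k] H :=
  TensorProduct.map LinearMap.id
    (LinearMap.mul' k H ∘ₗ
      TensorProduct.map (Q.antipodeInv hS ∘ₗ LinearMap.mulLeft k Q.alpha) LinearMap.id ∘ₗ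
        (TensorProduct.comm k H H).toLinearMap)
    (Q.reassoc : H ⊗[k] (H ⊗[k] H))

/-- `U = g¹ S(q²) ⊗ g² S(q¹)`, where `f⁻¹ = g¹ ⊗ g²` and `q_R = q¹ ⊗ q²`. -/
def elemU (Q : QuasiHopfAlgebra k H) (hS : Function.Bijective Q.antipode) : H ⊗[k] H :=
  Q.twistInv *
    TensorProduct.map Q.antipode Q.antipode (TensorProduct.comm k H H (Q.qR hS))

/-- `V = S⁻¹(f² p²) ⊗ S⁻¹(f¹ p¹)`, where `f = f¹ ⊗ f²` and `p_R = p¹ ⊗ p²`. -/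
def elemV (Q : QuasiHopfAlgebra k H) (hS : Function.Bijective Q.antipode) : H ⊗[k] H :=
  TensorProduct.map (Q.antipodeInv hS) (Q.antipodeInv hS)
    (TensorProduct.comm k H H (Q.twist * Q.pR))

/-- The right action of `H` on its dual, `(φ ↼ a)(x) = φ(a x)`. -/
def dualHitRight (φ : Module.Dual k H) (a : H) : Module.Dual k H :=
  φ ∘ₗ LinearMap.mulLeft k a

/-- The left `H`-action `h · φ = φ ↼ S⁻¹(h)` on the dual. -/
def dualLeftAction (Q : QuasiHopfAlgebra k H) (hS : Function.Bijective Q.antipode) :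
    H →ₗ[k] Module.End k (Module.Dual k H) :=
  LinearMap.mk₂ k (fun h φ => φ ∘ₗ LinearMap.mulLeft k (Q.antipodeInv hS h))
    (by intro a b φ; ext x; simp [add_mul])
    (by intro c a φ; ext x; simp)
    (by intro a φ ψ; ext x; simp)
    (by intro c a φ; ext x; simp)

/-- The right `H`-action `φ · h = S(h) ⇀ φ` on the dual, where `(a ⇀ φ)(x) = φ(x a)`. -/
def dualRightAction (Q : QuasiHopfAlgebra k H) : H →ₗ[k] Module.End k (Module.Dual k H) :=
  LinearMap.mk₂ k (fun h φ => φ ∘ₗ LinearMap.mulRight k (Q.antipode h))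
    (by intro a b φ; ext x; simp [mul_add])
    (by intro c a φ; ext x; simp)
    (by intro a φ ψ; ext x; simp)
    (by intro c a φ; ext x; simp)

/-- The right `H`-coaction `ρ(φ) = ∑ᵢ φ(V² (eᵢ)₂ U²) eⁱ ⊗ V¹ (eᵢ)₁ U¹` on the dual of `H`, where
`(eᵢ)` is a basis of `H` with dual basis `(eⁱ)`. -/
def dualCoaction [FiniteDimensional k H] (Q : QuasiHopfAlgebra k H)
    (hS : Function.Bijective Q.antipode) :
    Module.Dual k H →ₗ[k] Module.Dual k H ⊗[k] H where
  toFun φ := ∑ i, (Module.finBasis k H).coord i ⊗ₜ[k]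
    TensorProduct.rid k H
      (TensorProduct.map LinearMap.id φ
        (Q.elemV hS * Q.comul (Module.finBasis k H i) * Q.elemU hS))
  map_add' φ ψ := by
    simp only [TensorProduct.map_add_right, LinearMap.add_apply, map_add, TensorProduct.tmul_add,
      Finset.sum_add_distrib]
  map_smul' c φ := by
    simp only [TensorProduct.map_smul_right, LinearMap.smul_apply, map_smul,
      TensorProduct.tmul_smul, Finset.smul_sum, RingHom.id_apply]

/-- For a right quasi-Hopf `H`-bimodule `M` with left action `l`, right action `r` and right
coaction `ρ(m) = m₀ ⊗ m₁`, the projection `E(m) = q¹ · m₀ · β S(q² m₁)` onto the coinvariants,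
where `q_R = q¹ ⊗ q²`. -/
def coinvariantProjection {M : Type*} [AddCommGroup M] [Module k M] (Q : QuasiHopfAlgebra k H)
    (hS : Function.Bijective Q.antipode) (l r : H →ₗ[k] Module.End k M)
    (ρ : M →ₗ[k] M ⊗[k] H) : M →ₗ[k] M :=
  TensorProduct.lift (r ∘ₗ LinearMap.mulLeft k Q.beta ∘ₗ Q.antipode).flip ∘ₗ
    TensorProduct.homTensorHomMap (RingHom.id k) M H M H
      (TensorProduct.map l (LinearMap.mul k H) (Q.qR hS)) ∘ₗ ρ

/-- The space `𝓛` of left cointegrals: the coinvariants `E(lam) = lam` of the right quasi-Hopf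
`H`-bimodule given by the dual of `H`. -/
def leftCointegrals [FiniteDimensional k H] (Q : QuasiHopfAlgebra k H)
    (hS : Function.Bijective Q.antipode) : Submodule k (Module.Dual k H) :=
  LinearMap.eqLocus
    (Q.coinvariantProjection hS (Q.dualLeftAction hS) Q.dualRightAction (Q.dualCoaction hS))
    LinearMap.id

/-- The space `𝓡` of right cointegrals: the left cointegrals of `H^cop`. -/
def rightCointegrals [FiniteDimensional k H] (Q : QuasiHopfAlgebra k H)
    (hS : Function.Bijective Q.antipode) : Submodule k (Module.Dual k H) :=
  (Q.cop hS).leftCointegrals (Q.antipodeInv_bijective hS)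

/-- The element `u = μ(V¹) S²(V²)`. -/
def elemu (Q : QuasiHopfAlgebra k H) (hS : Function.Bijective Q.antipode) (μ : H →ₐ[k] k) : H :=
  TensorProduct.lid k H
    (TensorProduct.map μ.toLinearMap (Q.antipode ∘ₗ Q.antipode) (Q.elemV hS))

end QuasiHopfAlgebra

end

/-!
Let `H` be a finite-dimensional quasi-Hopf algebra, with `S` not assumed bijective.

*Integrals.* Identify `H ⊗ H*` with `End(H)`. The map `h ⊗ φ ↦ h₁p¹ ⊗ (φ ↼ S(h₂p²))` is bijective,
its inverse being given by `q_R` (`mulQR_mulPR`), and carries left multiplication on the first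
factor to the diagonal action. So `(left integrals) ⊗ H*` corresponds to the endomorphisms
invariant under that action, and these are the maps `w ↦ βwy` with `y ∈ H`
(`IsInvariantEnd.apply_eq`). The endomorphism `w ↦ βw` yields a non-zero integral; sending `t ⊗ φ`
to its `y` gives, for a fixed integral `t ≠ 0`, an injective and hence bijective map
`integralMap t : H* → H`, from which the uniqueness of integrals follows. Moreover
`q_LΔ(t) = q_RΔ(t)`, after applying `S` to the second leg (`qL_integral_eq_qR_integral`), so that
`integralMap t φ = φ(S(Γ²))Γ¹` for the Frobenius element `Γ = q_LΔ(t)p_R` (`integralMap_eq_sw`). A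
functional vanishing on the image of `S` is therefore zero, and `S` is bijective.
One-dimensionality also gives the modular function `μ`.

*Cointegrals.* Let `λ` be the form with `λ(hΓ²)Γ¹ = S(h)` (`exists_frobeniusForm`). The projection
of `H*` onto its coinvariants turns out to be `φ ↦ φ(S⁻¹(t))λ` (`coinvariantProjection_eq`), so
`𝓛 = kλ`. The computation removes the element `U`, by means of the trilinear maps of
`IsBalanced.sw_elemU`, and evaluates the Drinfeld twist on `Γ` in `kappa_twist_frobeniusElement`.
The same result for `H^cop` gives `𝓡 = kΛ`, where `Λ` is dual to the Frobenius element of `H^cop`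
with respect to the same integral `t`.

*Comparison.* The Frobenius elements of `H` and of `H^cop` differ in that `p_R` is replaced by
`p_L = X²S⁻¹(X¹β) ⊗ X³`. Both are multiplied from the left by `Δ(t)`, and `Δ(t)Δ(h) = μ(h)Δ(t)`.
On bilinear maps with this semi-invariance `p_L` agrees with `p_R(1 ⊗ w)`, where
`w = (id ⊗ μ ∘ S⁻¹)(f p_R)` (`IsSemiInvariant.sw_pR_mul_characterTwist`), and `w = S⁻¹(u)`
(`antipode_characterTwist`). Since `integralMap t` is injective, this comparison gives
`λ ∘ S⁻¹ = Λ ↼ u` (`frobeniusForm_comp_antipodeInv`), and non-degeneracy of `λ` makes `u`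
invertible. If `H` is unimodular then `μ = ε`, and `p_L` and `p_R` agree without a twist
(`IsSemiInvariant.sw_pR_eq_sw_pL`); then `λ ∘ S⁻¹ = Λ`.

*Sweedler sums.* Computations are done with `sw z F` and `sw3 z F`, which stand for `∑ F(z¹, z²)`
and `∑ F(z¹, z², z³)`; the multilinearity of `F` is an automatic argument solved by `fun_prop`.
The pentagon identity enters through functions `θ` of four variables which absorb a coproduct in
two adjacent variables, as `θ(a, b, c, d) = aβS(b)αcd` does: such a `θ` kills a face of the
pentagon, and what is left is an identity between fewer copies of `Φ`.
-/

set_option linter.unusedSectionVars false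

noncomputable section

/-! ### Linear functions -/

-- Linearity of the terms occurring below is left to `fun_prop`.
attribute [fun_prop] IsLinearMap

namespace Sweedler

section Linear

variable {k A B C M : Type*} [Field k] [AddCommGroup A] [Module k A] [AddCommGroup B] [Module k B]
  [AddCommGroup C] [Module k C] [AddCommGroup M] [Module k M]

@[fun_prop]
theorem isLinearMap_id : IsLinearMap k (fun x : A => x) := ⟨fun _ _ => rfl, fun _ _ => rfl⟩

@[fun_prop]
theorem isLinearMap_comp {f : B → C} {g : A → B} (hf : IsLinearMap k f) (hg : IsLinearMap k g) :
    IsLinearMap k (fun x => f (g x)) :=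
  ⟨fun x y => by rw [hg.map_add, hf.map_add], fun c x => by rw [hg.map_smul, hf.map_smul]⟩

@[fun_prop]
theorem isLinearMap_map {F : Type*} [FunLike F B C] [LinearMapClass F k B C] (f : F) {g : A → B}
    (hg : IsLinearMap k g) : IsLinearMap k (fun x => f (g x)) :=
  ⟨fun x y => by rw [hg.map_add, map_add], fun c x => by rw [hg.map_smul, map_smul]⟩

@[fun_prop]
theorem isLinearMap_tmul_left {g : A → B} (c : C) (hg : IsLinearMap k g) :
    IsLinearMap k (fun x => g x ⊗ₜ[k] c) :=
  ⟨fun x y => by rw [hg.map_add, TensorProduct.add_tmul],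
    fun c x => by rw [hg.map_smul, TensorProduct.smul_tmul']⟩

@[fun_prop]
theorem isLinearMap_tmul_right {g : A → B} (c : C) (hg : IsLinearMap k g) :
    IsLinearMap k (fun x => c ⊗ₜ[k] g x) :=
  ⟨fun x y => by rw [hg.map_add, TensorProduct.tmul_add],
    fun c x => by rw [hg.map_smul, TensorProduct.tmul_smul]⟩

@[fun_prop]
theorem isLinearMap_smul_left {g : A → k} (c : C) (hg : IsLinearMap k g) :
    IsLinearMap k (fun x => g x • c) :=
  ⟨fun x y => by rw [hg.map_add, add_smul], fun c x => by rw [hg.map_smul, smul_assoc]⟩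

@[fun_prop]
theorem isLinearMap_smul_right {g : A → B} (c : k) (hg : IsLinearMap k g) :
    IsLinearMap k (fun x => c • g x) :=
  ⟨fun x y => by rw [hg.map_add, smul_add], fun c x => by rw [hg.map_smul, smul_comm]⟩

@[fun_prop]
theorem isLinearMap_sum {ι : Type*} (s : Finset ι) {f : A → ι → B}
    (h : ∀ i, IsLinearMap k (fun x => f x i)) : IsLinearMap k (fun x => ∑ i ∈ s, f x i) :=
  ⟨fun x y => by simp only [(h _).map_add, Finset.sum_add_distrib],
    fun c x => by simp only [(h _).map_smul, Finset.smul_sum]⟩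

variable {R : Type*} [Ring R] [Algebra k R]

@[fun_prop]
theorem isLinearMap_mul_left {g : A → R} (c : R) (hg : IsLinearMap k g) :
    IsLinearMap k (fun x => g x * c) :=
  ⟨fun x y => by rw [hg.map_add, add_mul], fun c x => by rw [hg.map_smul, smul_mul_assoc]⟩

@[fun_prop]
theorem isLinearMap_mul_right {g : A → R} (c : R) (hg : IsLinearMap k g) :
    IsLinearMap k (fun x => c * g x) :=
  ⟨fun x y => by rw [hg.map_add, mul_add], fun c x => by rw [hg.map_smul, mul_smul_comm]⟩

end Linear

/-! ### Sums over the legs of a tensor -/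

section Sums

variable {k A B C D M N : Type*} [Field k] [AddCommGroup A] [Module k A]
  [AddCommGroup B] [Module k B] [AddCommGroup C] [Module k C] [AddCommGroup D] [Module k D]
  [AddCommGroup M] [Module k M] [AddCommGroup N] [Module k N]
  [FiniteDimensional k B] [FiniteDimensional k C] [FiniteDimensional k D]

/-- `a ⊗ b ↦ (bᵢ coordinate of b) a` for the chosen basis `(bᵢ)` of `B`. -/
def leg (i : Fin (Module.finrank k B)) : A ⊗[k] B →ₗ[k] A :=
  TensorProduct.rid k A ∘ₗ TensorProduct.map LinearMap.id ((Module.finBasis k B).coord i)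

/-- The value on `z = ∑ a ⊗ b` of the linear map induced by a bilinear `F`, written as a finite sum
`∑ F a b`; this is Sweedler's sum over `z`. It is defined for every function `F`, by
expanding the second leg in a basis, so that bilinearity has to be checked only where the choice
of the expansion of `z` matters. -/
def sw (z : A ⊗[k] B) (F : A → B → M) : M :=
  ∑ i, F (leg i z) (Module.finBasis k B i)

/-- Sweedler's sum over a triple tensor. -/
def sw3 (z : A ⊗[k] (B ⊗[k] C)) (F : A → B → C → M) : M :=
  sw z fun a y => sw y (F a)

/-- Sweedler's sum over a quadruple tensor. -/
def sw4 (z : A ⊗[k] (B ⊗[k] (C ⊗[k] D))) (F : A → B → C → D → M) : M :=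
  sw z fun a y => sw3 y (F a)

@[fun_prop]
theorem isLinearMap_sw {z : A ⊗[k] B} {F : N → A → B → M}
    (h : ∀ a b, IsLinearMap k (fun x => F x a b)) : IsLinearMap k (fun x => sw z (F x)) :=
  isLinearMap_sum _ fun _ => h _ _

@[fun_prop]
theorem isLinearMap_sw_tensor {z : N → A ⊗[k] B} {F : A → B → M} (hz : IsLinearMap k z)
    (h : ∀ b, IsLinearMap k (fun a => F a b)) : IsLinearMap k (fun x => sw (z x) F) :=
  isLinearMap_sum _ fun _ => isLinearMap_comp (h _) (isLinearMap_map _ hz)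

@[fun_prop]
theorem isLinearMap_sw3 {z : A ⊗[k] (B ⊗[k] C)} {F : N → A → B → C → M}
    (h : ∀ a b c, IsLinearMap k (fun x => F x a b c)) : IsLinearMap k (fun x => sw3 z (F x)) :=
  isLinearMap_sw fun _ _ => isLinearMap_sw fun _ _ => h _ _ _

@[fun_prop]
theorem isLinearMap_sw3_tensor {z : N → A ⊗[k] (B ⊗[k] C)} {F : A → B → C → M}
    (hz : IsLinearMap k z) (h : ∀ b c, IsLinearMap k (fun a => F a b c)) :
    IsLinearMap k (fun x => sw3 (z x) F) :=
  isLinearMap_sw_tensor hz fun _ => isLinearMap_sw fun _ _ => h _ _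

@[fun_prop]
theorem isLinearMap_sw4 {z : A ⊗[k] (B ⊗[k] (C ⊗[k] D))} {F : N → A → B → C → D → M}
    (h : ∀ a b c d, IsLinearMap k (fun x => F x a b c d)) : IsLinearMap k (fun x => sw4 z (F x)) :=
  isLinearMap_sw fun _ _ => isLinearMap_sw3 fun _ _ _ => h _ _ _ _

theorem sw_congr {z : A ⊗[k] B} {F G : A → B → M} (h : ∀ a b, F a b = G a b) : sw z F = sw z G :=
  Finset.sum_congr rfl fun _ _ => h _ _

theorem sw3_congr {z : A ⊗[k] (B ⊗[k] C)} {F G : A → B → C → M}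
    (h : ∀ a b c, F a b c = G a b c) : sw3 z F = sw3 z G :=
  sw_congr fun _ _ => sw_congr fun _ _ => h _ _ _

theorem map_sw {F' : Type*} [FunLike F' M N] [AddMonoidHomClass F' M N] (f : F') (z : A ⊗[k] B)
    (F : A → B → M) : f (sw z F) = sw z fun a b => f (F a b) :=
  map_sum f _ _

theorem map_sw3 {F' : Type*} [FunLike F' M N] [AddMonoidHomClass F' M N] (f : F')
    (z : A ⊗[k] (B ⊗[k] C)) (F : A → B → C → M) :
    f (sw3 z F) = sw3 z fun a b c => f (F a b c) := by
  simp only [sw3, map_sw]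

theorem _root_.IsLinearMap.map_sw {f : M → N} (hf : IsLinearMap k f) (z : A ⊗[k] B)
    (F : A → B → M) : f (sw z F) = sw z fun a b => f (F a b) :=
  Sweedler.map_sw (IsLinearMap.mk' f hf) z F

theorem _root_.IsLinearMap.map_sw3 {f : M → N} (hf : IsLinearMap k f) (z : A ⊗[k] (B ⊗[k] C))
    (F : A → B → C → M) : f (sw3 z F) = sw3 z fun a b c => f (F a b c) :=
  Sweedler.map_sw3 (IsLinearMap.mk' f hf) z F

theorem sw_smul (c : k) (z : A ⊗[k] B) (F : A → B → M) :
    (sw z fun a b => c • F a b) = c • sw z F :=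
  (isLinearMap_smul_right c isLinearMap_id).map_sw z F |>.symm

theorem sw3_smul (c : k) (z : A ⊗[k] (B ⊗[k] C)) (F : A → B → C → M) :
    (sw3 z fun a b c' => c • F a b c') = c • sw3 z F :=
  (isLinearMap_smul_right c isLinearMap_id).map_sw3 z F |>.symm

section Mul

variable {R : Type*} [Ring R] [Algebra k R]

theorem mul_sw (c : R) (z : A ⊗[k] B) (F : A → B → R) :
    c * sw z F = sw z fun a b => c * F a b :=
  Finset.mul_sum _ _ _

theorem sw_mul_right (c : R) (z : A ⊗[k] B) (F : A → B → R) :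
    sw z F * c = sw z fun a b => F a b * c :=
  Finset.sum_mul _ _ _

theorem mul_sw3 (c : R) (z : A ⊗[k] (B ⊗[k] C)) (F : A → B → C → R) :
    c * sw3 z F = sw3 z fun a b d => c * F a b d := by
  simp only [sw3, mul_sw]

theorem sw3_mul_right (c : R) (z : A ⊗[k] (B ⊗[k] C)) (F : A → B → C → R) :
    sw3 z F * c = sw3 z fun a b d => F a b d * c := by
  simp only [sw3, sw_mul_right]

end Mul

section Fubini

variable {A' B' C' : Type*} [AddCommGroup A'] [Module k A'] [AddCommGroup B'] [Module k B']
  [AddCommGroup C'] [Module k C'] [FiniteDimensional k B'] [FiniteDimensional k C']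

theorem sw_sw (z : A ⊗[k] B) (y : A' ⊗[k] B') (F : A → B → A' → B' → M) :
    (sw z fun a b => sw y fun a' b' => F a b a' b') =
      sw y fun a' b' => sw z fun a b => F a b a' b' :=
  Finset.sum_comm

theorem sw_sw3 (z : A ⊗[k] B) (y : A' ⊗[k] (B' ⊗[k] C')) (F : A → B → A' → B' → C' → M) :
    (sw z fun a b => sw3 y fun a' b' c' => F a b a' b' c') =
      sw3 y fun a' b' c' => sw z fun a b => F a b a' b' c' := by
  simp only [sw3, sw_sw z]

theorem sw3_sw (z : A ⊗[k] B) (y : A' ⊗[k] (B' ⊗[k] C')) (F : A → B → A' → B' → C' → M) :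
    (sw3 y fun a' b' c' => sw z fun a b => F a b a' b' c') =
    sw z fun a b => sw3 y fun a' b' c' => F a b a' b' c' := (sw_sw3 z y F).symm

theorem sw3_sw3 (z : A ⊗[k] (B ⊗[k] C)) (y : A' ⊗[k] (B' ⊗[k] C'))
    (F : A → B → C → A' → B' → C' → M) :
    (sw3 z fun a b c => sw3 y fun a' b' c' => F a b c a' b' c') =
      sw3 y fun a' b' c' => sw3 z fun a b c => F a b c a' b' c' := by
  calc (sw3 z fun a b c => sw3 y fun a' b' c' => F a b c a' b' c')
      = sw z fun a x => sw3 y fun a' b' c' => sw x fun b c => F a b c a' b' c' :=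
        sw_congr fun a x => sw_sw3 x y fun b c a' b' c' => F a b c a' b' c'
    _ = _ := sw_sw3 z y _

end Fubini

/-- A bilinear function. -/
def IsLin2 (k : Type*) {A B M : Type*} [Field k] [AddCommGroup A] [Module k A] [AddCommGroup B]
    [Module k B] [AddCommGroup M] [Module k M] (F : A → B → M) : Prop :=
  (∀ b, IsLinearMap k fun a => F a b) ∧ ∀ a, IsLinearMap k fun b => F a b

/-- A trilinear function. -/
def IsLin3 (k : Type*) {A B C M : Type*} [Field k] [AddCommGroup A] [Module k A] [AddCommGroup B]
    [Module k B] [AddCommGroup C] [Module k C] [AddCommGroup M] [Module k M]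
    (F : A → B → C → M) : Prop :=
  (∀ b c, IsLinearMap k fun a => F a b c) ∧ (∀ a c, IsLinearMap k fun b => F a b c) ∧
    ∀ a b, IsLinearMap k fun c => F a b c

/-- A quadrilinear function. -/
def IsLin4 (k : Type*) {A B C D M : Type*} [Field k] [AddCommGroup A] [Module k A]
    [AddCommGroup B] [Module k B] [AddCommGroup C] [Module k C] [AddCommGroup D] [Module k D]
    [AddCommGroup M] [Module k M] (F : A → B → C → D → M) : Prop :=
  (∀ b c d, IsLinearMap k fun a => F a b c d) ∧ (∀ a c d, IsLinearMap k fun b => F a b c d) ∧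
    (∀ a b d, IsLinearMap k fun c => F a b c d) ∧ ∀ a b c, IsLinearMap k fun d => F a b c d

theorem sw_tmul (a : A) (b : B) (F : A → B → M)
    (hF : IsLin2 k F := by refine ⟨?_, ?_⟩ <;> intros <;> fun_prop) :
    sw (a ⊗ₜ[k] b) F = F a b := by
  have h1 : ∀ i, F (leg i (a ⊗ₜ[k] b)) (Module.finBasis k B i) =
      F a ((Module.finBasis k B).repr b i • Module.finBasis k B i) := by
    intro i
    rw [(hF.2 _).map_smul, ← (hF.1 _).map_smul]
    simp [leg]
  rw [sw, Finset.sum_congr rfl fun i _ => h1 i]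
  have h2 := map_sum (IsLinearMap.mk' _ (hF.2 a))
    (fun i => (Module.finBasis k B).repr b i • Module.finBasis k B i) Finset.univ
  rw [(Module.finBasis k B).sum_repr b] at h2
  exact h2.symm

/-- Two linear functions of a tensor agree when they agree on pure tensors. -/
theorem ext_tensor {f g : A ⊗[k] B → M} (z : A ⊗[k] B) (h : ∀ a b, f (a ⊗ₜ b) = g (a ⊗ₜ b))
    (hf : IsLinearMap k f := by fun_prop) (hg : IsLinearMap k g := by fun_prop) : f z = g z := by
  induction z with
  | zero => rw [hf.map_zero, hg.map_zero]
  | tmul a b => exact h a b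
  | add x y hx hy => rw [hf.map_add, hg.map_add, hx, hy]

theorem sw_self (z : A ⊗[k] B) : (sw z fun a b => a ⊗ₜ[k] b) = z :=
  ext_tensor (f := fun z => sw z fun a b => a ⊗ₜ[k] b) (g := fun z => z) z
    fun a b => sw_tmul a b fun a b => a ⊗ₜ[k] b

theorem sw3_tmul (a : A) (b : B) (c : C) (F : A → B → C → M)
    (hF : IsLin3 k F := by refine ⟨?_, ?_, ?_⟩ <;> intros <;> fun_prop) :
    sw3 (a ⊗ₜ[k] (b ⊗ₜ[k] c)) F = F a b c := by
  obtain ⟨h1, h2, h3⟩ := hF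
  rw [sw3, sw_tmul _ _ _ ⟨fun _ => isLinearMap_sw fun _ _ => h1 _ _,
      fun _ => isLinearMap_sw_tensor isLinearMap_id fun _ => h2 _ _⟩,
    sw_tmul _ _ _ ⟨fun _ => h2 _ _, fun _ => h3 _ _⟩]

/-- Two linear functions of a triple tensor agree when they agree on pure tensors. -/
theorem ext_tensor3 {f g : A ⊗[k] (B ⊗[k] C) → M} (z : A ⊗[k] (B ⊗[k] C))
    (h : ∀ a b c, f (a ⊗ₜ (b ⊗ₜ c)) = g (a ⊗ₜ (b ⊗ₜ c)))
    (hf : IsLinearMap k f := by fun_prop) (hg : IsLinearMap k g := by fun_prop) : f z = g z :=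
  ext_tensor z fun a y =>
    ext_tensor (f := fun y => f (a ⊗ₜ y)) (g := fun y => g (a ⊗ₜ y)) y (fun b c => h a b c)
      (isLinearMap_comp hf (by fun_prop)) (isLinearMap_comp hg (by fun_prop))

theorem sw_map {A' B' : Type*} [AddCommGroup A'] [Module k A'] [AddCommGroup B'] [Module k B']
    [FiniteDimensional k B'] (f : A →ₗ[k] A') (g : B →ₗ[k] B') (z : A ⊗[k] B) (F : A' → B' → M)
    (hF : IsLin2 k F := by refine ⟨?_, ?_⟩ <;> intros <;> fun_prop) :
    sw (TensorProduct.map f g z) F = sw z fun a b => F (f a) (g b) := by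
  obtain ⟨h1, h2⟩ := hF
  have h3 : IsLin2 k fun a b => F (f a) (g b) :=
    ⟨fun b => isLinearMap_comp (h1 _) (by fun_prop), fun a => isLinearMap_comp (h2 _) (by fun_prop)⟩
  refine ext_tensor (f := fun z => sw (TensorProduct.map f g z) F) (g := fun z => sw z _) z ?_
    (isLinearMap_sw_tensor (by fun_prop) h1) (isLinearMap_sw_tensor (by fun_prop) h3.1)
  intro a b
  rw [TensorProduct.map_tmul, sw_tmul _ _ _ ⟨h1, h2⟩, sw_tmul _ _ _ h3]

theorem sw_tensorComm [FiniteDimensional k A] (z : A ⊗[k] B) (F : B → A → M)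
    (hF : IsLin2 k F := by refine ⟨?_, ?_⟩ <;> intros <;> fun_prop) :
    sw (TensorProduct.comm k A B z) F = sw z fun a b => F b a := by
  obtain ⟨h1, h2⟩ := hF
  refine ext_tensor (f := fun z => sw (TensorProduct.comm k A B z) F) (g := fun z => sw z _) z ?_
    (isLinearMap_sw_tensor (by fun_prop) h1) (isLinearMap_sw_tensor (by fun_prop) h2)
  intro a b
  rw [TensorProduct.comm_tmul, sw_tmul _ _ _ ⟨h1, h2⟩, sw_tmul _ _ _ ⟨h2, h1⟩]

/-- Fourfold version: two linear functions agree when they agree on pure tensors. -/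
theorem ext_tensor4 {f g : A ⊗[k] (B ⊗[k] (C ⊗[k] D)) → M} (z : A ⊗[k] (B ⊗[k] (C ⊗[k] D)))
    (h : ∀ a b c d, f (a ⊗ₜ (b ⊗ₜ (c ⊗ₜ d))) = g (a ⊗ₜ (b ⊗ₜ (c ⊗ₜ d))))
    (hf : IsLinearMap k f := by fun_prop) (hg : IsLinearMap k g := by fun_prop) : f z = g z :=
  ext_tensor3 z (fun a b y =>
    ext_tensor (f := fun y => f (a ⊗ₜ (b ⊗ₜ y))) (g := fun y => g (a ⊗ₜ (b ⊗ₜ y))) y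
      (fun c d => h a b c d)
      (isLinearMap_comp hf (isLinearMap_tmul_right _ (isLinearMap_tmul_right _ isLinearMap_id)))
      (isLinearMap_comp hg (isLinearMap_tmul_right _ (isLinearMap_tmul_right _ isLinearMap_id))))
    hf hg

theorem isLinearMap_sw4_tensor {z : N → A ⊗[k] (B ⊗[k] (C ⊗[k] D))} {F : A → B → C → D → M}
    (hz : IsLinearMap k z) (h : IsLin4 k F) : IsLinearMap k (fun x => sw4 (z x) F) :=
  isLinearMap_sw_tensor hz fun _ => isLinearMap_sw3 fun _ _ _ => h.1 _ _ _

theorem sw4_tmul (a : A) (b : B) (c : C) (d : D) (F : A → B → C → D → M) (hF : IsLin4 k F) :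
    sw4 (a ⊗ₜ[k] (b ⊗ₜ[k] (c ⊗ₜ[k] d))) F = F a b c d := by
  obtain ⟨h1, h2, h3, h4⟩ := hF
  have h5 : IsLin2 k fun (a : A) (y : B ⊗[k] (C ⊗[k] D)) => sw3 y (F a) :=
    ⟨fun y => isLinearMap_sw3 fun b c d => h1 b c d,
      fun a => isLinearMap_sw3_tensor isLinearMap_id fun c d => h2 a c d⟩
  exact (sw_tmul a _ _ h5).trans
    (sw3_tmul b c d (F a) ⟨fun _ _ => h2 _ _ _, fun _ _ => h3 _ _ _, fun _ _ => h4 _ _ _⟩)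

theorem sw_eq_zero_of {z : A ⊗[k] B} {F : A → B → M} (h : ∀ a b, F a b = 0) : sw z F = 0 := by
  simp [sw, h]

end Sums

section Algebras

variable {k A B C D M : Type*} [Field k] [Ring A] [Algebra k A] [Ring B] [Algebra k B]
  [Ring C] [Algebra k C] [Ring D] [Algebra k D] [AddCommGroup M] [Module k M]
  [FiniteDimensional k B] [FiniteDimensional k C] [FiniteDimensional k D]

theorem sw_mul (x y : A ⊗[k] B) (F : A → B → M)
    (hF : IsLin2 k F := by refine ⟨?_, ?_⟩ <;> intros <;> fun_prop) :
    sw (x * y) F = sw x fun a b => sw y fun a' b' => F (a * a') (b * b') := by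
  obtain ⟨h1, h2⟩ := hF
  have h3 : ∀ a b, IsLin2 k fun a' b' => F (a * a') (b * b') := fun a b =>
    ⟨fun _ => isLinearMap_comp (h1 _) (by fun_prop), fun _ => isLinearMap_comp (h2 _) (by fun_prop)⟩
  have h4 : IsLin2 k fun a b => sw y fun a' b' => F (a * a') (b * b') :=
    ⟨fun _ => isLinearMap_sw fun _ _ => isLinearMap_comp (h1 _) (by fun_prop),
      fun _ => isLinearMap_sw fun _ _ => isLinearMap_comp (h2 _) (by fun_prop)⟩
  refine ext_tensor (f := fun x => sw (x * y) F) (g := fun x => sw x _) x ?_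
    (isLinearMap_sw_tensor (by fun_prop) h1) (isLinearMap_sw_tensor (by fun_prop) h4.1)
  intro a b
  rw [sw_tmul _ _ _ h4]
  refine ext_tensor (f := fun y => sw (a ⊗ₜ b * y) F) (g := fun y => sw y _) y ?_
    (isLinearMap_sw_tensor (by fun_prop) h1) (isLinearMap_sw_tensor (by fun_prop) (h3 a b).1)
  intro a' b'
  rw [sw_tmul _ _ _ (h3 a b), Algebra.TensorProduct.tmul_mul_tmul, sw_tmul _ _ _ ⟨h1, h2⟩]

theorem sw3_mul (x y : A ⊗[k] (B ⊗[k] C)) (F : A → B → C → M)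
    (hF : IsLin3 k F := by refine ⟨?_, ?_, ?_⟩ <;> intros <;> fun_prop) :
    sw3 (x * y) F =
      sw3 x fun a b c => sw3 y fun a' b' c' => F (a * a') (b * b') (c * c') := by
  obtain ⟨h1, h2, h3⟩ := hF
  have h2' : ∀ a : A, IsLin2 k (F a) := fun a => ⟨fun _ => h2 _ _, fun _ => h3 _ _⟩
  rw [sw3, sw_mul _ _ _ ⟨fun _ => isLinearMap_sw fun _ _ => h1 _ _,
    fun _ => isLinearMap_sw_tensor isLinearMap_id fun _ => h2 _ _⟩, sw3]
  refine sw_congr fun a b => ?_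
  rw [sw_congr fun a' b' => sw_mul b b' (F (a * a')) (h2' _)]
  simp only [sw3]
  rw [sw_sw]

theorem sw4_mul (x y : A ⊗[k] (B ⊗[k] (C ⊗[k] D))) (F : A → B → C → D → M) (hF : IsLin4 k F) :
    sw4 (x * y) F =
      sw4 x fun a b c d => sw4 y fun a' b' c' d' => F (a * a') (b * b') (c * c') (d * d') := by
  obtain ⟨h1, h2, h3, h4⟩ := hF
  have h2' : ∀ a : A, IsLin3 k (F a) :=
    fun a => ⟨fun _ => h2 _ _, fun _ => h3 _ _, fun _ => h4 _ _⟩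
  rw [sw4, sw_mul _ _ _ ⟨fun _ => isLinearMap_sw3 fun _ _ _ => h1 _ _ _,
    fun _ => isLinearMap_sw3_tensor isLinearMap_id fun _ => h2 _ _⟩, sw4]
  refine sw_congr fun a b => ?_
  rw [sw_congr fun a' b' => sw3_mul b b' (F (a * a')) (h2' _)]
  simp only [sw4]
  rw [sw_sw3]

theorem sw_one (F : A → B → M)
    (hF : IsLin2 k F := by refine ⟨?_, ?_⟩ <;> intros <;> fun_prop) :
    sw (1 : A ⊗[k] B) F = F 1 1 :=
  sw_tmul _ _ _ hF

theorem sw3_one (F : A → B → C → M)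
    (hF : IsLin3 k F := by refine ⟨?_, ?_, ?_⟩ <;> intros <;> fun_prop) :
    sw3 (1 : A ⊗[k] (B ⊗[k] C)) F = F 1 1 1 :=
  sw3_tmul _ _ _ _ hF

end Algebras

end Sweedler

namespace QuasiHopfAlgebra

open Sweedler

section QuasiHopf

variable {k : Type v} {H : Type w} [Field k] [Ring H] [Algebra k H] [FiniteDimensional k H]
  {M : Type*} [AddCommGroup M] [Module k M] (Q : QuasiHopfAlgebra k H)

local notation "Δ" => Q.comul
local notation "ε" => Q.counit
local notation "S" => Q.antipode
local notation "α" => Q.alpha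
local notation "β" => Q.beta
local notation "Φ" => (Q.reassoc : H ⊗[k] (H ⊗[k] H))
local notation "Φi" => Q.reassocInv

/-! ### The axioms of a quasi-Hopf algebra in terms of Sweedler sums -/

theorem reassoc_mul_inv : Φ * Φi = 1 := Q.reassoc.mul_inv

theorem reassoc_inv_mul : Φi * Φ = 1 := Q.reassoc.inv_mul

theorem sw_reassoc_inv_mul (F : H → H → H → M)
    (hF : IsLin3 k F := by refine ⟨?_, ?_, ?_⟩ <;> intros <;> fun_prop) :
    (sw3 Φi fun a b c => sw3 Φ fun a' b' c' => F (a * a') (b * b') (c * c')) = F 1 1 1 := by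
  rw [← sw3_mul _ _ _ hF, reassoc_inv_mul, sw3_one _ hF]

theorem sw_reassoc_mul_inv (F : H → H → H → M)
    (hF : IsLin3 k F := by refine ⟨?_, ?_, ?_⟩ <;> intros <;> fun_prop) :
    (sw3 Φ fun a b c => sw3 Φi fun a' b' c' => F (a * a') (b * b') (c * c')) = F 1 1 1 := by
  rw [← sw3_mul _ _ _ hF, reassoc_mul_inv, sw3_one _ hF]

theorem sw_counit_right (h : H) (L : H → M) (hL : IsLinearMap k L := by fun_prop) :
    (sw (Δ h) fun a b => ε b • L a) = L h := by
  have h1 := congrArg (fun z => sw z fun a (c : k) => c • L a) (Q.counit_right h)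
  rw [sw_tmul h (1 : k) fun a (c : k) => c • L a, one_smul] at h1
  rw [← h1]
  exact (sw_map (AlgHom.id k H).toLinearMap Q.counit.toLinearMap (Q.comul h)
    fun a (c : k) => c • L a).symm

theorem sw_counit_left (h : H) (L : H → M) (hL : IsLinearMap k L := by fun_prop) :
    (sw (Δ h) fun a b => ε a • L b) = L h := by
  have h1 := congrArg (fun z => sw z fun (c : k) a => c • L a) (Q.counit_left h)
  rw [sw_tmul (1 : k) h fun (c : k) a => c • L a, one_smul] at h1
  rw [← h1]
  exact (sw_map Q.counit.toLinearMap (AlgHom.id k H).toLinearMap (Q.comul h)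
    fun (c : k) a => c • L a).symm

theorem sandwichLeft_eq_sw (T : H →ₗ[k] H) (c : H) (z : H ⊗[k] H) :
    sandwichLeft T c z = sw z fun a b => T a * c * b :=
  ext_tensor (f := fun z => sandwichLeft T c z) (g := fun z => sw z _) z
    fun a b => by rw [sw_tmul _ _ fun a b => T a * c * b]; simp [sandwichLeft]

theorem sandwichRight_eq_sw (T : H →ₗ[k] H) (c : H) (z : H ⊗[k] H) :
    sandwichRight T c z = sw z fun a b => a * c * T b :=
  ext_tensor (f := fun z => sandwichRight T c z) (g := fun z => sw z _) z
    fun a b => by rw [sw_tmul _ _ fun a b => a * c * T b]; simp [sandwichRight]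

theorem sw_alpha (h : H) (L : H → M) (hL : IsLinearMap k L := by fun_prop) :
    (sw (Δ h) fun a b => L (S a * α * b)) = ε h • L α := by
  rw [← hL.map_smul, ← Q.antipode_alpha, sandwichLeft_eq_sw, hL.map_sw]

theorem sw_beta (h : H) (L : H → M) (hL : IsLinearMap k L := by fun_prop) :
    (sw (Δ h) fun a b => L (a * β * S b)) = ε h • L β := by
  rw [← hL.map_smul, ← Q.antipode_beta, sandwichRight_eq_sw, hL.map_sw]

theorem sw3_map_right {A B C D : Type*} [AddCommGroup A] [Module k A] [AddCommGroup B]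
    [Module k B] [AddCommGroup C] [Module k C] [AddCommGroup D] [Module k D]
    [FiniteDimensional k B] [FiniteDimensional k C] [FiniteDimensional k D]
    (f : B ⊗[k] C →ₗ[k] D) (z : A ⊗[k] (B ⊗[k] C)) (F : A → D → M)
    (hF : IsLin2 k F := by refine ⟨?_, ?_⟩ <;> intros <;> fun_prop) :
    sw (TensorProduct.map LinearMap.id f z) F = sw3 z fun a b c => F a (f (b ⊗ₜ c)) := by
  rw [sw_map _ _ _ _ hF]
  refine sw_congr fun a y => ?_
  have h := hF.2 (LinearMap.id (R := k) a)
  conv_lhs => rw [← sw_self y, Sweedler.map_sw f, h.map_sw]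
  rfl

theorem sw_zigzag (L : H → M) (hL : IsLinearMap k L := by fun_prop) :
    (sw3 Φ fun a b c => L (a * β * S b * α * c)) = L 1 := by
  rw [← Q.antipode_reassoc, sandwichRight_eq_sw,
    sw3_map_right _ _ fun a b => a * β * LinearMap.id (R := k) b, hL.map_sw3]
  refine sw3_congr fun a b c => ?_
  simp [sandwichLeft, mul_assoc]

theorem sw_zigzag_inv (L : H → M) (hL : IsLinearMap k L := by fun_prop) :
    (sw3 Φi fun a b c => L (S a * α * b * β * S c)) = L 1 := by
  rw [← Q.antipode_reassoc_inv, sandwichLeft_eq_sw,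
    sw3_map_right _ _ fun a b => S a * α * b, hL.map_sw3]
  refine sw3_congr fun a b c => ?_
  simp [sandwichRight, mul_assoc]

theorem sw_comul_mul (x y : H) (F : H → H → M)
    (hF : IsLin2 k F := by refine ⟨?_, ?_⟩ <;> intros <;> fun_prop) :
    sw (Δ (x * y)) F = sw (Δ x) fun a b => sw (Δ y) fun a' b' => F (a * a') (b * b') := by
  rw [map_mul, sw_mul _ _ _ hF]

theorem sw_comul_one (F : H → H → M)
    (hF : IsLin2 k F := by refine ⟨?_, ?_⟩ <;> intros <;> fun_prop) :
    sw (Δ 1) F = F 1 1 := by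
  rw [map_one, sw_one _ hF]

theorem sw3_map_id_comul (z : H ⊗[k] H) (F : H → H → H → M)
    (hF : IsLin3 k F := by refine ⟨?_, ?_, ?_⟩ <;> intros <;> fun_prop) :
    sw3 (Algebra.TensorProduct.map (AlgHom.id k H) Q.comul z) F =
      sw z fun a b => sw (Δ b) fun c d => F a c d := by
  obtain ⟨h1, h2, h3⟩ := hF
  refine ext_tensor (f := fun z => sw3 (Algebra.TensorProduct.map (AlgHom.id k H) Q.comul z) F)
    (g := fun z => sw z _) z ?_
  intro a b
  rw [sw_tmul _ _ fun a b => sw (Δ b) fun c d => F a c d, Algebra.TensorProduct.map_tmul,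
    AlgHom.id_apply, sw3,
    sw_tmul a (Q.comul b) (fun a y => sw y (F a))]

theorem sw3_map_comul_id (z : H ⊗[k] H) (F : H → H → H → M)
    (hF : IsLin3 k F := by refine ⟨?_, ?_, ?_⟩ <;> intros <;> fun_prop) :
    sw3 (tensorAssoc k H H H (Algebra.TensorProduct.map Q.comul (AlgHom.id k H) z)) F =
      sw z fun a b => sw (Δ a) fun c d => F c d b := by
  obtain ⟨h1, h2, h3⟩ := hF
  refine ext_tensor (f := fun z => sw3 (tensorAssoc k H H H
    (Algebra.TensorProduct.map Q.comul (AlgHom.id k H) z)) F) (g := fun z => sw z _) z ?_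
  intro a b
  rw [sw_tmul _ _ fun a b => sw (Δ a) fun c d => F c d b, Algebra.TensorProduct.map_tmul,
    AlgHom.id_apply]
  refine ext_tensor (f := fun y => sw3 (tensorAssoc k H H H (y ⊗ₜ[k] b)) F)
    (g := fun y => sw y _) (Q.comul a) ?_
  intro c d
  rw [sw_tmul c d fun c d => F c d b]
  exact sw3_tmul c d b F

/-- `h₁X¹ ⊗ h₂₁X² ⊗ h₂₂X³ = X¹h₁₁ ⊗ X²h₁₂ ⊗ X³h₂`. -/
theorem sw_coassoc (h : H) (F : H → H → H → M)
    (hF : IsLin3 k F := by refine ⟨?_, ?_, ?_⟩ <;> intros <;> fun_prop) :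
    (sw (Δ h) fun a b => sw (Δ b) fun b₁ b₂ => sw3 Φ fun x y z => F (a * x) (b₁ * y) (b₂ * z)) =
      sw (Δ h) fun a b => sw (Δ a) fun a₁ a₂ => sw3 Φ fun x y z => F (x * a₁) (y * a₂) (z * b) := by
  have h1 := congrArg (fun t => sw3 (t * Φ) F) (Q.quasi_coassoc h)
  beta_reduce at h1
  obtain ⟨l1, l2, l3⟩ := hF
  rw [mul_assoc, Units.inv_mul, mul_one, sw3_mul _ _ F, sw3_mul _ _ F,
    Q.sw3_map_id_comul _ fun a b c => sw3 Φ fun x y z => F (a * x) (b * y) (c * z)] at h1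
  rw [h1, sw3_congr fun a b c => Q.sw3_map_comul_id (Δ h) fun x y z => F (a * x) (b * y) (c * z),
    sw3_sw]
  exact sw_congr fun _ _ => sw3_sw _ _ _

/-- `x¹h₁ ⊗ x²h₂₁ ⊗ x³h₂₂ = h₁₁x¹ ⊗ h₁₂x² ⊗ h₂x³`. -/
theorem sw_coassoc_inv (h : H) (F : H → H → H → M)
    (hF : IsLin3 k F := by refine ⟨?_, ?_, ?_⟩ <;> intros <;> fun_prop) :
    (sw (Δ h) fun a b => sw (Δ b) fun b₁ b₂ => sw3 Φi fun x y z =>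
      F (x * a) (y * b₁) (z * b₂)) =
    sw (Δ h) fun a b => sw (Δ a) fun a₁ a₂ => sw3 Φi fun x y z =>
      F (a₁ * x) (a₂ * y) (b * z) := by
  have h1 := congrArg (fun t => sw3 (Φi * t) F) (Q.quasi_coassoc h)
  beta_reduce at h1
  obtain ⟨l1, l2, l3⟩ := hF
  rw [← mul_assoc, ← mul_assoc, reassoc_inv_mul, one_mul, sw3_mul _ _ F, sw3_mul _ _ F,
    Q.sw3_map_comul_id _ fun a b c =>
      sw3 (Q.reassoc⁻¹).1 fun x y z => F (a * x) (b * y) (c * z)] at h1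
  refine Eq.trans ?_ h1
  rw [sw3_congr fun a b c => Q.sw3_map_id_comul (Δ h) fun x y z => F (a * x) (b * y) (c * z),
    sw3_sw]
  exact sw_congr fun _ _ => (sw3_sw _ _ _).symm

/-! ### The pentagon identity and its rearrangements -/

/-- The face `x ↦ 1 ⊗ x` of the pentagon. The pentagon identity reads
`emb₁ Φ * emb₂ Φ * emb₃ Φ = emb₄ Φ * emb₅ Φ`. -/
def emb₁ : H ⊗[k] (H ⊗[k] H) →ₐ[k] H ⊗[k] (H ⊗[k] (H ⊗[k] H)) :=
  Algebra.TensorProduct.includeRight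

/-- The face `id ⊗ Δ ⊗ id` of the pentagon. -/
def emb₂ : H ⊗[k] (H ⊗[k] H) →ₐ[k] H ⊗[k] (H ⊗[k] (H ⊗[k] H)) :=
  Algebra.TensorProduct.map (AlgHom.id k H)
    ((tensorAssoc k H H H : (H ⊗[k] H) ⊗[k] H →ₐ[k] H ⊗[k] (H ⊗[k] H)).comp
      (Algebra.TensorProduct.map Q.comul (AlgHom.id k H)))

/-- The face `x ↦ x ⊗ 1` of the pentagon. -/
def emb₃ : H ⊗[k] (H ⊗[k] H) →ₐ[k] H ⊗[k] (H ⊗[k] (H ⊗[k] H)) :=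
  Algebra.TensorProduct.map (AlgHom.id k H) (Algebra.TensorProduct.map (AlgHom.id k H)
    (Algebra.TensorProduct.includeLeft : H →ₐ[k] H ⊗[k] H))

/-- The face `id ⊗ id ⊗ Δ` of the pentagon. -/
def emb₄ : H ⊗[k] (H ⊗[k] H) →ₐ[k] H ⊗[k] (H ⊗[k] (H ⊗[k] H)) :=
  Algebra.TensorProduct.map (AlgHom.id k H) (Algebra.TensorProduct.map (AlgHom.id k H) Q.comul)

/-- The face `Δ ⊗ id ⊗ id` of the pentagon. -/
def emb₅ : H ⊗[k] (H ⊗[k] H) →ₐ[k] H ⊗[k] (H ⊗[k] (H ⊗[k] H)) :=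
  (tensorAssoc k H H (H ⊗[k] H) :
      (H ⊗[k] H) ⊗[k] (H ⊗[k] H) →ₐ[k] H ⊗[k] (H ⊗[k] (H ⊗[k] H))).comp
    (Algebra.TensorProduct.map Q.comul (AlgHom.id k (H ⊗[k] H)))

theorem sw4_emb₁ (t : H ⊗[k] (H ⊗[k] H)) (F : H → H → H → H → M)
    (hF : IsLin4 k F) : sw4 (emb₁ (k := k) (H := H) t) F = sw3 t fun a b c => F 1 a b c := by
  have l := hF
  obtain ⟨l1, l2, l3, l4⟩ := l
  refine ext_tensor3 (f := fun t => sw4 (emb₁ (k := k) (H := H) t) F)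
    (g := fun t => sw3 t fun a b c => F 1 a b c) t
    (fun a b c => ?_) (isLinearMap_sw4_tensor (isLinearMap_map _ isLinearMap_id) hF)
    (isLinearMap_sw3_tensor isLinearMap_id (by intros; fun_prop))
  have h : emb₁ (k := k) (a ⊗ₜ (b ⊗ₜ c)) = 1 ⊗ₜ (a ⊗ₜ (b ⊗ₜ c)) := rfl
  rw [sw3_tmul a b c fun a b c => F 1 a b c, h]
  exact sw4_tmul 1 a b c F hF

theorem sw4_emb₃ (t : H ⊗[k] (H ⊗[k] H)) (F : H → H → H → H → M)
    (hF : IsLin4 k F) : sw4 (emb₃ (k := k) (H := H) t) F = sw3 t fun a b c => F a b c 1 := by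
  have l := hF
  obtain ⟨l1, l2, l3, l4⟩ := l
  refine ext_tensor3 (f := fun t => sw4 (emb₃ (k := k) (H := H) t) F)
    (g := fun t => sw3 t fun a b c => F a b c 1) t
    (fun a b c => ?_) (isLinearMap_sw4_tensor (isLinearMap_map _ isLinearMap_id) hF)
    (isLinearMap_sw3_tensor isLinearMap_id (by intros; fun_prop))
  have h : emb₃ (k := k) (a ⊗ₜ (b ⊗ₜ c)) = a ⊗ₜ (b ⊗ₜ (c ⊗ₜ 1)) := rfl
  rw [sw3_tmul a b c fun a b c => F a b c 1, h]
  exact sw4_tmul a b c 1 F hF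

theorem sw4_emb₂ (t : H ⊗[k] (H ⊗[k] H)) (F : H → H → H → H → M)
    (hF : IsLin4 k F) :
    sw4 (Q.emb₂ t) F = sw3 t fun a b c => sw (Δ b) fun b₁ b₂ => F a b₁ b₂ c := by
  have l := hF
  obtain ⟨l1, l2, l3, l4⟩ := l
  refine ext_tensor3 (f := fun t => sw4 (Q.emb₂ t) F) (g := fun t => sw3 t _) t
    (fun a b c => ?_) (isLinearMap_sw4_tensor (by fun_prop) hF)
  rw [sw3_tmul a b c fun a b c => sw (Δ b) fun b₁ b₂ => F a b₁ b₂ c]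
  refine (ext_tensor (f := fun y => sw4 (a ⊗ₜ (tensorAssoc k H H H (y ⊗ₜ c))) F)
    (g := fun y => sw y _) (Δ b) ?_ (isLinearMap_sw4_tensor (by fun_prop) hF))
  intro x y
  rw [sw_tmul x y fun x y => F a x y c]
  exact sw4_tmul a x y c F hF

theorem sw4_emb₄ (t : H ⊗[k] (H ⊗[k] H)) (F : H → H → H → H → M)
    (hF : IsLin4 k F) :
    sw4 (Q.emb₄ t) F = sw3 t fun a b c => sw (Δ c) fun c₁ c₂ => F a b c₁ c₂ := by
  have l := hF
  obtain ⟨l1, l2, l3, l4⟩ := l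
  refine ext_tensor3 (f := fun t => sw4 (Q.emb₄ t) F) (g := fun t => sw3 t _) t
    (fun a b c => ?_) (isLinearMap_sw4_tensor (by fun_prop) hF)
  rw [sw3_tmul a b c fun a b c => sw (Δ c) fun c₁ c₂ => F a b c₁ c₂]
  refine (ext_tensor (f := fun y => sw4 (a ⊗ₜ (b ⊗ₜ y)) F)
    (g := fun y => sw y _) (Δ c) ?_ (isLinearMap_sw4_tensor (by fun_prop) hF))
  intro x y
  rw [sw_tmul x y fun x y => F a b x y]
  exact sw4_tmul a b x y F hF

theorem sw4_emb₅ (t : H ⊗[k] (H ⊗[k] H)) (F : H → H → H → H → M)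
    (hF : IsLin4 k F) :
    sw4 (Q.emb₅ t) F = sw3 t fun a b c => sw (Δ a) fun a₁ a₂ => F a₁ a₂ b c := by
  have l := hF
  obtain ⟨l1, l2, l3, l4⟩ := l
  refine ext_tensor3 (f := fun t => sw4 (Q.emb₅ t) F) (g := fun t => sw3 t _) t
    (fun a b c => ?_) (isLinearMap_sw4_tensor (by fun_prop) hF)
  rw [sw3_tmul a b c fun a b c => sw (Δ a) fun a₁ a₂ => F a₁ a₂ b c]
  refine (ext_tensor (f := fun y => sw4 (tensorAssoc k H H (H ⊗[k] H) (y ⊗ₜ (b ⊗ₜ c))) F)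
    (g := fun y => sw y _) (Δ a) ?_ (isLinearMap_sw4_tensor (by fun_prop) hF))
  intro x y
  rw [sw_tmul x y fun x y => F x y b c]
  exact sw4_tmul x y b c F hF

theorem sw4_emb₁_mul (t : H ⊗[k] (H ⊗[k] H)) (T : H ⊗[k] (H ⊗[k] (H ⊗[k] H)))
    (F : H → H → H → H → M) (hF : IsLin4 k F) :
    sw4 (emb₁ (k := k) (H := H) t * T) F =
      sw3 t fun a b c => sw4 T fun p q r s => F p (a * q) (b * r) (c * s) := by
  have l := hF
  obtain ⟨l1, l2, l3, l4⟩ := l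
  rw [sw4_mul _ _ F hF, sw4_emb₁ _ _ ⟨by intros; fun_prop, by intros; fun_prop,
    by intros; fun_prop, by intros; fun_prop⟩]
  simp only [one_mul]

theorem sw4_emb₃_mul (t : H ⊗[k] (H ⊗[k] H)) (T : H ⊗[k] (H ⊗[k] (H ⊗[k] H)))
    (F : H → H → H → H → M) (hF : IsLin4 k F) :
    sw4 (emb₃ (k := k) (H := H) t * T) F =
      sw3 t fun a b c => sw4 T fun p q r s => F (a * p) (b * q) (c * r) s := by
  have l := hF
  obtain ⟨l1, l2, l3, l4⟩ := l
  rw [sw4_mul _ _ F hF, sw4_emb₃ _ _ ⟨by intros; fun_prop, by intros; fun_prop,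
    by intros; fun_prop, by intros; fun_prop⟩]
  simp only [one_mul]

theorem sw4_emb₂_mul (t : H ⊗[k] (H ⊗[k] H)) (T : H ⊗[k] (H ⊗[k] (H ⊗[k] H)))
    (F : H → H → H → H → M) (hF : IsLin4 k F) :
    sw4 (Q.emb₂ t * T) F =
      sw3 t fun a b c => sw (Δ b) fun b₁ b₂ =>
        sw4 T fun p q r s => F (a * p) (b₁ * q) (b₂ * r) (c * s) := by
  have l := hF
  obtain ⟨l1, l2, l3, l4⟩ := l
  rw [sw4_mul _ _ F hF, sw4_emb₂ _ _ _ ⟨by intros; fun_prop, by intros; fun_prop,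
    by intros; fun_prop, by intros; fun_prop⟩]

theorem sw4_emb₄_mul (t : H ⊗[k] (H ⊗[k] H)) (T : H ⊗[k] (H ⊗[k] (H ⊗[k] H)))
    (F : H → H → H → H → M) (hF : IsLin4 k F) :
    sw4 (Q.emb₄ t * T) F =
      sw3 t fun a b c => sw (Δ c) fun c₁ c₂ =>
        sw4 T fun p q r s => F (a * p) (b * q) (c₁ * r) (c₂ * s) := by
  have l := hF
  obtain ⟨l1, l2, l3, l4⟩ := l
  rw [sw4_mul _ _ F hF, sw4_emb₄ _ _ _ ⟨by intros; fun_prop, by intros; fun_prop,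
    by intros; fun_prop, by intros; fun_prop⟩]

theorem sw4_emb₅_mul (t : H ⊗[k] (H ⊗[k] H)) (T : H ⊗[k] (H ⊗[k] (H ⊗[k] H)))
    (F : H → H → H → H → M) (hF : IsLin4 k F) :
    sw4 (Q.emb₅ t * T) F =
      sw3 t fun a b c => sw (Δ a) fun a₁ a₂ =>
        sw4 T fun p q r s => F (a₁ * p) (a₂ * q) (b * r) (c * s) := by
  have l := hF
  obtain ⟨l1, l2, l3, l4⟩ := l
  rw [sw4_mul _ _ F hF, sw4_emb₅ _ _ _ ⟨by intros; fun_prop, by intros; fun_prop,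
    by intros; fun_prop, by intros; fun_prop⟩]

/-- The pentagon `abc = de` in a group, solved for the products needed below. -/
theorem units_pentagon {G : Type*} [Group G] {a b c d e : G} (h : a * b * c = d * e) :
    a⁻¹ * d = b * (c * e⁻¹) ∧ c⁻¹ * b⁻¹ = e⁻¹ * (d⁻¹ * a) ∧ e * c⁻¹ = d⁻¹ * (a * b) ∧
      b⁻¹ * a⁻¹ = c * (e⁻¹ * d⁻¹) ∧ d⁻¹ * a = e * (c⁻¹ * b⁻¹) ∧ b * c = a⁻¹ * (d * e) := by
  obtain rfl : d = a * b * c * e⁻¹ := by rw [h]; group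
  refine ⟨?_, ?_, ?_, ?_, ?_, ?_⟩ <;> group

/-- The unit given by the image of `Φ` under a face map. -/
def embUnit (i : H ⊗[k] (H ⊗[k] H) →ₐ[k] H ⊗[k] (H ⊗[k] (H ⊗[k] H))) :
    (H ⊗[k] (H ⊗[k] (H ⊗[k] H)))ˣ :=
  Units.map (i : H ⊗[k] (H ⊗[k] H) →* H ⊗[k] (H ⊗[k] (H ⊗[k] H))) Q.reassoc

/-- The pentagon identity as an identity between units; its rearrangements below are identities in
the group of units. -/
theorem embUnit_pentagon :
    Q.embUnit emb₁ * Q.embUnit Q.emb₂ * Q.embUnit emb₃ = Q.embUnit Q.emb₄ * Q.embUnit Q.emb₅ :=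
  Units.ext Q.pentagon

/-- This and the five following rearrangements of the pentagon identity are named by their left-hand
sides. -/
theorem emb₁_inv_mul_emb₄ : emb₁ (k := k) (H := H) Φi * Q.emb₄ Φ =
    Q.emb₂ Φ * (emb₃ (k := k) (H := H) Φ * Q.emb₅ Φi) :=
  congrArg Units.val (units_pentagon Q.embUnit_pentagon).1

theorem emb₃_inv_mul_emb₂_inv : emb₃ (k := k) (H := H) Φi * Q.emb₂ Φi =
    Q.emb₅ Φi * (Q.emb₄ Φi * emb₁ (k := k) (H := H) Φ) :=
  congrArg Units.val (units_pentagon Q.embUnit_pentagon).2.1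

theorem emb₅_mul_emb₃_inv : Q.emb₅ Φ * emb₃ (k := k) (H := H) Φi =
    Q.emb₄ Φi * (emb₁ (k := k) (H := H) Φ * Q.emb₂ Φ) :=
  congrArg Units.val (units_pentagon Q.embUnit_pentagon).2.2.1

theorem emb₂_inv_mul_emb₁_inv : Q.emb₂ Φi * emb₁ (k := k) (H := H) Φi =
    emb₃ (k := k) (H := H) Φ * (Q.emb₅ Φi * Q.emb₄ Φi) :=
  congrArg Units.val (units_pentagon Q.embUnit_pentagon).2.2.2.1

theorem emb₄_inv_mul_emb₁ : Q.emb₄ Φi * emb₁ (k := k) (H := H) Φ =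
    Q.emb₅ Φ * (emb₃ (k := k) (H := H) Φi * Q.emb₂ Φi) :=
  congrArg Units.val (units_pentagon Q.embUnit_pentagon).2.2.2.2.1

theorem emb₂_mul_emb₃ : Q.emb₂ Φ * emb₃ (k := k) (H := H) Φ =
    emb₁ (k := k) (H := H) Φi * (Q.emb₄ Φ * Q.emb₅ Φ) :=
  congrArg Units.val (units_pentagon Q.embUnit_pentagon).2.2.2.2.2

section Rearrangements

variable (F : H → H → H → H → M)
    (hF : IsLin4 k F := by refine ⟨?_, ?_, ?_, ?_⟩ <;> intros <;> fun_prop)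

include hF

theorem sw_emb₁_inv_mul_emb₄ :
    (sw3 Φi fun a b c => sw3 Φ fun x y z => sw (Δ z) fun z₁ z₂ =>
      F x (a * y) (b * z₁) (c * z₂)) =
    sw3 Φ fun a b c => sw (Δ b) fun b₁ b₂ => sw3 Φ fun x y z => sw3 Φi fun u v w =>
      sw (Δ u) fun u₁ u₂ =>
      F (a * (x * u₁)) (b₁ * (y * u₂)) (b₂ * (z * v)) (c * w) := by
  obtain ⟨l1, l2, l3, l4⟩ := id hF
  refine Eq.trans (Eq.symm ?_) ((congrArg (fun t => sw4 t F) Q.emb₁_inv_mul_emb₄).trans ?_)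
  · refine (sw4_emb₁_mul Φi _ (fun p q r s => F p q r s)
        ⟨by intros; fun_prop, by intros; fun_prop, by intros; fun_prop,
          by intros; fun_prop⟩).trans ?_
    refine sw3_congr fun a b c => ?_
    exact Q.sw4_emb₄ Φ (fun p q r s => F p (a * q) (b * r) (c * s))
      ⟨by intros; fun_prop, by intros; fun_prop, by intros; fun_prop, by intros; fun_prop⟩
  · refine (Q.sw4_emb₂_mul Φ _ (fun p q r s => F p q r s)
        ⟨by intros; fun_prop, by intros; fun_prop, by intros; fun_prop,
          by intros; fun_prop⟩).trans ?_
    refine sw3_congr fun a b c => sw_congr fun b₁ b₂ => ?_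
    refine (sw4_emb₃_mul Φ _ (fun p q r s => F (a * p) (b₁ * q) (b₂ * r) (c * s))
        ⟨by intros; fun_prop, by intros; fun_prop, by intros; fun_prop,
          by intros; fun_prop⟩).trans ?_
    refine sw3_congr fun x y z => ?_
    exact Q.sw4_emb₅ Φi (fun p q r s => F (a * (x * p)) (b₁ * (y * q)) (b₂ * (z * r)) (c * s))
      ⟨by intros; fun_prop, by intros; fun_prop, by intros; fun_prop, by intros; fun_prop⟩

theorem sw_emb₃_inv_mul_emb₂_inv :
    (sw3 Φi fun a b c => sw3 Φi fun x y z => sw (Δ y) fun y₁ y₂ =>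
      F (a * x) (b * y₁) (c * y₂) z) =
    sw3 Φi fun a b c => sw (Δ a) fun a₁ a₂ => sw3 Φi fun x y z => sw (Δ z) fun z₁ z₂ =>
      sw3 Φ fun u v w =>
      F (a₁ * x) (a₂ * (y * u)) (b * (z₁ * v)) (c * (z₂ * w)) := by
  obtain ⟨l1, l2, l3, l4⟩ := id hF
  refine Eq.trans (Eq.symm ?_) ((congrArg (fun t => sw4 t F) Q.emb₃_inv_mul_emb₂_inv).trans ?_)
  · refine (sw4_emb₃_mul Φi _ (fun p q r s => F p q r s)
        ⟨by intros; fun_prop, by intros; fun_prop, by intros; fun_prop,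
          by intros; fun_prop⟩).trans ?_
    refine sw3_congr fun a b c => ?_
    exact Q.sw4_emb₂ Φi (fun p q r s => F (a * p) (b * q) (c * r) s)
      ⟨by intros; fun_prop, by intros; fun_prop, by intros; fun_prop, by intros; fun_prop⟩
  · refine (Q.sw4_emb₅_mul Φi _ (fun p q r s => F p q r s)
        ⟨by intros; fun_prop, by intros; fun_prop, by intros; fun_prop,
          by intros; fun_prop⟩).trans ?_
    refine sw3_congr fun a b c => sw_congr fun a₁ a₂ => ?_
    refine (Q.sw4_emb₄_mul Φi _ (fun p q r s => F (a₁ * p) (a₂ * q) (b * r) (c * s))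
        ⟨by intros; fun_prop, by intros; fun_prop, by intros; fun_prop,
          by intros; fun_prop⟩).trans ?_
    refine sw3_congr fun x y z => sw_congr fun z₁ z₂ => ?_
    simpa only [mul_one] using sw4_emb₁ Φ (fun p q r s =>
      F (a₁ * (x * p)) (a₂ * (y * q)) (b * (z₁ * r)) (c * (z₂ * s)))
      ⟨by intros; fun_prop, by intros; fun_prop, by intros; fun_prop, by intros; fun_prop⟩

theorem sw_emb₅_mul_emb₃_inv :
    (sw3 Φ fun a b c => sw (Δ a) fun a₁ a₂ => sw3 Φi fun x y z =>
      F (a₁ * x) (a₂ * y) (b * z) c) =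
    sw3 Φi fun a b c => sw (Δ c) fun c₁ c₂ => sw3 Φ fun x y z => sw3 Φ fun u v w =>
      sw (Δ v) fun v₁ v₂ =>
      F (a * u) (b * (x * v₁)) (c₁ * (y * v₂)) (c₂ * (z * w)) := by
  obtain ⟨l1, l2, l3, l4⟩ := id hF
  refine Eq.trans (Eq.symm ?_) ((congrArg (fun t => sw4 t F) Q.emb₅_mul_emb₃_inv).trans ?_)
  · refine (Q.sw4_emb₅_mul Φ _ (fun p q r s => F p q r s)
        ⟨by intros; fun_prop, by intros; fun_prop, by intros; fun_prop,
          by intros; fun_prop⟩).trans ?_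
    refine sw3_congr fun a b c => sw_congr fun a₁ a₂ => ?_
    simpa only [mul_one] using sw4_emb₃ Φi (fun p q r s => F (a₁ * p) (a₂ * q) (b * r) (c * s))
      ⟨by intros; fun_prop, by intros; fun_prop, by intros; fun_prop, by intros; fun_prop⟩
  · refine (Q.sw4_emb₄_mul Φi _ (fun p q r s => F p q r s)
        ⟨by intros; fun_prop, by intros; fun_prop, by intros; fun_prop,
          by intros; fun_prop⟩).trans ?_
    refine sw3_congr fun a b c => sw_congr fun c₁ c₂ => ?_
    refine (sw4_emb₁_mul Φ _ (fun p q r s => F (a * p) (b * q) (c₁ * r) (c₂ * s))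
        ⟨by intros; fun_prop, by intros; fun_prop, by intros; fun_prop,
          by intros; fun_prop⟩).trans ?_
    refine sw3_congr fun x y z => ?_
    exact Q.sw4_emb₂ Φ (fun p q r s => F (a * p) (b * (x * q)) (c₁ * (y * r)) (c₂ * (z * s)))
      ⟨by intros; fun_prop, by intros; fun_prop, by intros; fun_prop, by intros; fun_prop⟩

theorem sw_emb₂_inv_mul_emb₁_inv :
    (sw3 Φi fun a b c => sw (Δ b) fun b₁ b₂ => sw3 Φi fun x y z =>
      F a (b₁ * x) (b₂ * y) (c * z)) =
    sw3 Φ fun a b c => sw3 Φi fun x y z => sw (Δ x) fun x₁ x₂ => sw3 Φi fun u v w =>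
      sw (Δ w) fun w₁ w₂ =>
      F (a * (x₁ * u)) (b * (x₂ * v)) (c * (y * w₁)) (z * w₂) := by
  obtain ⟨l1, l2, l3, l4⟩ := id hF
  refine Eq.trans (Eq.symm ?_) ((congrArg (fun t => sw4 t F) Q.emb₂_inv_mul_emb₁_inv).trans ?_)
  · refine (Q.sw4_emb₂_mul Φi _ (fun p q r s => F p q r s)
        ⟨by intros; fun_prop, by intros; fun_prop, by intros; fun_prop,
          by intros; fun_prop⟩).trans ?_
    refine sw3_congr fun a b c => sw_congr fun b₁ b₂ => ?_
    simpa only [mul_one] using sw4_emb₁ Φi (fun p q r s => F (a * p) (b₁ * q) (b₂ * r) (c * s))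
      ⟨by intros; fun_prop, by intros; fun_prop, by intros; fun_prop, by intros; fun_prop⟩
  · refine (sw4_emb₃_mul Φ _ (fun p q r s => F p q r s)
        ⟨by intros; fun_prop, by intros; fun_prop, by intros; fun_prop,
          by intros; fun_prop⟩).trans ?_
    refine sw3_congr fun a b c => ?_
    refine (Q.sw4_emb₅_mul Φi _ (fun p q r s => F (a * p) (b * q) (c * r) s)
        ⟨by intros; fun_prop, by intros; fun_prop, by intros; fun_prop,
          by intros; fun_prop⟩).trans ?_
    refine sw3_congr fun x y z => sw_congr fun x₁ x₂ => ?_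
    exact Q.sw4_emb₄ Φi (fun p q r s => F (a * (x₁ * p)) (b * (x₂ * q)) (c * (y * r)) (z * s))
      ⟨by intros; fun_prop, by intros; fun_prop, by intros; fun_prop, by intros; fun_prop⟩

theorem sw_emb₄_inv_mul_emb₁ :
    (sw3 Φi fun a b c => sw (Δ c) fun c₁ c₂ => sw3 Φ fun x y z =>
      F a (b * x) (c₁ * y) (c₂ * z)) =
    sw3 Φ fun a b c => sw (Δ a) fun a₁ a₂ => sw3 Φi fun x y z => sw3 Φi fun u v w =>
      sw (Δ v) fun v₁ v₂ =>
      F (a₁ * (x * u)) (a₂ * (y * v₁)) (b * (z * v₂)) (c * w) := by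
  obtain ⟨l1, l2, l3, l4⟩ := id hF
  refine Eq.trans (Eq.symm ?_) ((congrArg (fun t => sw4 t F) Q.emb₄_inv_mul_emb₁).trans ?_)
  · refine (Q.sw4_emb₄_mul Φi _ (fun p q r s => F p q r s)
        ⟨by intros; fun_prop, by intros; fun_prop, by intros; fun_prop,
          by intros; fun_prop⟩).trans ?_
    refine sw3_congr fun a b c => sw_congr fun c₁ c₂ => ?_
    simpa only [mul_one] using sw4_emb₁ Φ (fun p q r s => F (a * p) (b * q) (c₁ * r) (c₂ * s))
      ⟨by intros; fun_prop, by intros; fun_prop, by intros; fun_prop, by intros; fun_prop⟩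
  · refine (Q.sw4_emb₅_mul Φ _ (fun p q r s => F p q r s)
        ⟨by intros; fun_prop, by intros; fun_prop, by intros; fun_prop,
          by intros; fun_prop⟩).trans ?_
    refine sw3_congr fun a b c => sw_congr fun a₁ a₂ => ?_
    refine (sw4_emb₃_mul Φi _ (fun p q r s => F (a₁ * p) (a₂ * q) (b * r) (c * s))
        ⟨by intros; fun_prop, by intros; fun_prop, by intros; fun_prop,
          by intros; fun_prop⟩).trans ?_
    refine sw3_congr fun x y z => ?_
    exact Q.sw4_emb₂ Φi (fun p q r s => F (a₁ * (x * p)) (a₂ * (y * q)) (b * (z * r)) (c * s))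
      ⟨by intros; fun_prop, by intros; fun_prop, by intros; fun_prop, by intros; fun_prop⟩

theorem sw_emb₂_mul_emb₃ :
    (sw3 Φ fun a b c => sw (Δ b) fun b₁ b₂ => sw3 Φ fun x y z =>
      F (a * x) (b₁ * y) (b₂ * z) c) =
    sw3 Φi fun a b c => sw3 Φ fun x y z => sw (Δ z) fun z₁ z₂ => sw3 Φ fun u v w =>
      sw (Δ u) fun u₁ u₂ =>
      F (x * u₁) (a * (y * u₂)) (b * (z₁ * v)) (c * (z₂ * w)) := by
  obtain ⟨l1, l2, l3, l4⟩ := id hF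
  refine Eq.trans (Eq.symm ?_) ((congrArg (fun t => sw4 t F) Q.emb₂_mul_emb₃).trans ?_)
  · refine (Q.sw4_emb₂_mul Φ _ (fun p q r s => F p q r s)
        ⟨by intros; fun_prop, by intros; fun_prop, by intros; fun_prop,
          by intros; fun_prop⟩).trans ?_
    refine sw3_congr fun a b c => sw_congr fun b₁ b₂ => ?_
    simpa only [mul_one] using sw4_emb₃ Φ (fun p q r s => F (a * p) (b₁ * q) (b₂ * r) (c * s))
      ⟨by intros; fun_prop, by intros; fun_prop, by intros; fun_prop, by intros; fun_prop⟩
  · refine (sw4_emb₁_mul Φi _ (fun p q r s => F p q r s)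
        ⟨by intros; fun_prop, by intros; fun_prop, by intros; fun_prop,
          by intros; fun_prop⟩).trans ?_
    refine sw3_congr fun a b c => ?_
    refine (Q.sw4_emb₄_mul Φ _ (fun p q r s => F p (a * q) (b * r) (c * s))
        ⟨by intros; fun_prop, by intros; fun_prop, by intros; fun_prop,
          by intros; fun_prop⟩).trans ?_
    refine sw3_congr fun x y z => sw_congr fun z₁ z₂ => ?_
    exact Q.sw4_emb₅ Φ (fun p q r s => F (x * p) (a * (y * q)) (b * (z₁ * r)) (c * (z₂ * s)))
      ⟨by intros; fun_prop, by intros; fun_prop, by intros; fun_prop, by intros; fun_prop⟩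

end Rearrangements

/-! ### The counit on the legs of the reassociator -/

section CounitLegs

variable (L : H → H → M) (hL : IsLin2 k L := by refine ⟨?_, ?_⟩ <;> intros <;> fun_prop)

include hL

theorem sw_reassoc_counit₂ : (sw3 Φ fun a b c => ε b • L a c) = L 1 1 := by
  obtain ⟨l1, l2⟩ := id hL
  have h := congrArg (fun z => sw z L) Q.counit_reassoc
  beta_reduce at h
  rw [sw_one L hL] at h
  rw [← h]
  refine Eq.trans ?_ (sw3_map_right ((Algebra.TensorProduct.lid k H : k ⊗[k] H →ₐ[k] H).comp
          (Algebra.TensorProduct.map Q.counit (AlgHom.id k H))).toLinearMap Φ L).symm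
  refine sw3_congr fun a b c => ?_
  simp [(l2 a).map_smul]

theorem sw_reassocInv_counit₂ : (sw3 Φi fun a b c => ε b • L a c) = L 1 1 := by
  obtain ⟨l1, l2⟩ := id hL
  have h := Q.sw_reassoc_mul_inv fun a b c => ε b • L a c
  simp only [map_one, one_smul, map_mul, mul_smul, sw3_smul] at h
  rw [Q.sw_reassoc_counit₂ fun a c => sw3 Φi fun a' b' c' => ε b' • L (a * a') (c * c')] at h
  simpa only [one_mul] using h

/-- `(ε ⊗ id ⊗ id)(Φ) = 1 ⊗ 1`. Only the version for the middle leg is an axiom; the outer ones come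
from the pentagon identity. -/
theorem sw_reassoc_counit₁ : (sw3 Φ fun a b c => ε a • L b c) = L 1 1 := by
  obtain ⟨l1, l2⟩ := id hL
  -- Apply `ε` to the first two legs: the left side becomes `(ε ⊗ id ⊗ id)(Φ)`, and the right
  -- side the image of `Φ⁻¹Φ`.
  have h := Q.sw_emb₂_mul_emb₃ fun p q r s => ε p • ε q • L r s
  have h1 : (sw3 Φ fun a b c => sw (Δ b) fun b₁ b₂ => sw3 Φ fun x y z =>
      ε (a * x) • ε (b₁ * y) • L (b₂ * z) c) = sw3 Φ fun a b c => ε a • L b c := by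
    refine sw3_congr fun a b c => ?_
    rw [← Q.sw_counit_left b fun b => ε a • L b c]
    refine sw_congr fun b₁ b₂ => ?_
    refine Eq.trans (sw3_congr fun x y z => ?_) ((Q.sw_reassoc_counit₂ fun x z =>
      (ε a * ε b₁ * ε x) • L (b₂ * z) c).trans ?_)
    · simp only [map_mul, smul_smul]; ring_nf
    · simp only [map_one, mul_one, smul_smul]; ring_nf
  rw [h1] at h
  refine h.trans (Eq.trans ?_
    ((Q.sw_reassoc_inv_mul fun a b c => ε a • L b c).trans (by rw [map_one, one_smul])))
  refine sw3_congr fun a b c => ?_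
  refine (sw3_congr fun x y z => (sw_congr fun z₁ z₂ => sw3_congr fun u v w =>
    (?_ : _ = (ε y * ε (a * u)) • ε x • L (b * (z₁ * v)) (c * (z₂ * w))))).trans ?_
  · rw [← Q.sw_counit_right u fun u => (ε y * ε (a * u)) • ε x • L (b * (z₁ * v)) (c * (z₂ * w))]
    refine sw_congr fun _ _ => ?_
    simp only [map_mul, smul_smul]; ring_nf
  refine Eq.trans ?_ ((Q.sw_reassoc_counit₂ fun x z => sw (Δ z) fun z₁ z₂ => sw3 Φ fun u v w =>
    ε (a * u) • ε x • L (b * (z₁ * v)) (c * (z₂ * w))).trans ?_)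
  · simp only [mul_smul, sw_smul, sw3_smul]
  · rw [Q.sw_comul_one fun z₁ z₂ => sw3 Φ fun u v w =>
      ε (a * u) • ε (1 : H) • L (b * (z₁ * v)) (c * (z₂ * w))]
    simp only [map_one, one_mul, one_smul]

theorem sw_reassocInv_counit₁ : (sw3 Φi fun a b c => ε a • L b c) = L 1 1 := by
  obtain ⟨l1, l2⟩ := id hL
  have h := Q.sw_reassoc_mul_inv fun a b c => ε a • L b c
  simp only [map_one, one_smul, map_mul, mul_smul, sw3_smul] at h
  rw [Q.sw_reassoc_counit₁ fun b c => sw3 Φi fun a' b' c' => ε a' • L (b * b') (c * c')] at h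
  simpa only [one_mul] using h

theorem sw_reassocInv_counit₃ : (sw3 Φi fun a b c => ε c • L a b) = L 1 1 := by
  obtain ⟨l1, l2⟩ := id hL
  -- Apply `ε` to the last two legs.
  have h := Q.sw_emb₅_mul_emb₃_inv fun p q r s => ε r • ε s • L p q
  have h1 : (sw3 Φ fun a b c => sw (Δ a) fun a₁ a₂ => sw3 Φi fun x y z =>
      ε (b * z) • ε c • L (a₁ * x) (a₂ * y)) = sw3 Φi fun a b c => ε c • L a b := by
    refine Eq.trans (sw3_congr fun a b c => ?_) ((Q.sw_reassoc_counit₂ fun a c =>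
      sw (Δ a) fun a₁ a₂ => sw3 Φi fun x y z => (ε z * ε c) • L (a₁ * x) (a₂ * y)).trans ?_)
    · simp only [map_mul, mul_smul, sw_smul, sw3_smul]
    · rw [Q.sw_comul_one fun a₁ a₂ => sw3 Φi fun x y z =>
        (ε z * ε (1 : H)) • L (a₁ * x) (a₂ * y)]
      simp only [map_one, one_mul, mul_one]
  rw [h1] at h
  refine h.trans (Eq.trans ?_
    ((Q.sw_reassoc_inv_mul fun a b c => ε c • L a b).trans (by rw [map_one, one_smul])))
  refine sw3_congr fun a b c => ?_
  rw [← Q.sw_counit_left c fun c => sw3 Φ fun u v w => ε (c * w) • L (a * u) (b * v)]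
  refine sw_congr fun c₁ c₂ => ?_
  refine (sw3_congr fun x y z => (sw3_congr fun u v w =>
    (?_ : _ = (ε y * (ε c₁ * ε z)) • ε (c₂ * w) • L (a * u) (b * (x * v))))).trans ?_
  · rw [← Q.sw_counit_right v fun v => (ε y * (ε c₁ * ε z)) • ε (c₂ * w) • L (a * u) (b * (x * v))]
    refine sw_congr fun _ _ => ?_
    simp only [map_mul, smul_smul]; ring_nf
  refine Eq.trans ?_ ((Q.sw_reassoc_counit₂ fun x z => sw3 Φ fun u v w =>
    (ε c₁ * ε z) • ε (c₂ * w) • L (a * u) (b * (x * v))).trans ?_)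
  · simp only [mul_smul, sw3_smul]
  · simp only [map_one, one_mul, mul_one, sw3_smul]

theorem sw_reassoc_counit₃ : (sw3 Φ fun a b c => ε c • L a b) = L 1 1 := by
  obtain ⟨l1, l2⟩ := id hL
  have h := Q.sw_reassoc_inv_mul fun a b c => ε c • L a b
  simp only [map_one, one_smul, map_mul, mul_smul, sw3_smul] at h
  rw [Q.sw_reassocInv_counit₃ fun b c => sw3 Φ fun a' b' c' => ε c' • L (b * a') (c * b')] at h
  simpa only [one_mul] using h

end CounitLegs

/-! ### The pentagon identity under maps absorbing a coproduct -/

/-- `θ` absorbs left multiplication by a coproduct in its first two variables. -/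
def AbsorbL₁₂ (θ : H → H → H → H → M) : Prop :=
  ∀ h a b c d, (sw (Δ h) fun x y => θ (x * a) (y * b) c d) = ε h • θ a b c d

/-- `θ` absorbs left multiplication by a coproduct in its middle variables. -/
def AbsorbL₂₃ (θ : H → H → H → H → M) : Prop :=
  ∀ h a b c d, (sw (Δ h) fun x y => θ a (x * b) (y * c) d) = ε h • θ a b c d

/-- `θ` absorbs left multiplication by a coproduct in its last two variables. -/
def AbsorbL₃₄ (θ : H → H → H → H → M) : Prop :=
  ∀ h a b c d, (sw (Δ h) fun x y => θ a b (x * c) (y * d)) = ε h • θ a b c d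

/-- `θ` absorbs right multiplication by a coproduct in its first two variables. -/
def AbsorbR₁₂ (θ : H → H → H → H → M) : Prop :=
  ∀ h a b c d, (sw (Δ h) fun x y => θ (a * x) (b * y) c d) = ε h • θ a b c d

/-- `θ` absorbs right multiplication by a coproduct in its middle variables. -/
def AbsorbR₂₃ (θ : H → H → H → H → M) : Prop :=
  ∀ h a b c d, (sw (Δ h) fun x y => θ a (b * x) (c * y) d) = ε h • θ a b c d

/-- `θ` absorbs right multiplication by a coproduct in its last two variables. -/
def AbsorbR₃₄ (θ : H → H → H → H → M) : Prop :=
  ∀ h a b c d, (sw (Δ h) fun x y => θ a b (c * x) (d * y)) = ε h • θ a b c d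

section Absorb

variable (θ : H → H → H → H → M)
    (hθ : IsLin4 k θ := by refine ⟨?_, ?_, ?_, ?_⟩ <;> intros <;> fun_prop)

include hθ

/-- `θ(1 ⊗ Φ⁻¹) = θ((Φ ⊗ 1)(Δ ⊗ id ⊗ id)(Φ⁻¹))`. Here and in the following lemmas a face of the
pentagon whose coproduct is absorbed by `θ` collapses, by the counit axioms, to `1`. -/
theorem absorb_emb₁_inv (h₁ : Q.AbsorbL₂₃ θ) (h₂ : Q.AbsorbR₃₄ θ) :
    (sw3 Φi fun a b c => θ 1 a b c) = sw3 Φ fun a b c => sw3 Φi fun x y z =>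
      sw (Δ x) fun x₁ x₂ => θ (a * x₁) (b * x₂) (c * y) z := by
  obtain ⟨l1, l2, l3, l4⟩ := id hθ
  refine Eq.trans (sw3_congr fun a b c => ?_) ((Q.sw_emb₁_inv_mul_emb₄ θ).trans ?_)
  · have e := Q.sw_reassoc_counit₃ fun x y => θ x (a * y) b c
    rw [mul_one] at e
    rw [← e]
    exact sw3_congr fun x y z => (h₂ z _ _ _ _).symm
  · refine (sw3_congr fun a b c => (sw_sw3 _ _ _).trans (sw3_congr fun x y z =>
      (sw_sw3 _ _ _).trans (sw3_congr fun u v w => (sw_sw _ _ _).trans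
        (sw_congr fun u₁ u₂ => h₁ b _ _ _ _)))).trans ?_
    simp only [sw_smul, sw3_smul]
    rw [Q.sw_reassoc_counit₂ fun a c => sw3 Φ fun x y z => sw3 Φi fun u v w =>
      sw (Δ u) fun u₁ u₂ => θ (a * (x * u₁)) (y * u₂) (z * v) (c * w)]
    simp only [one_mul]

/-- `θ(Φ ⊗ 1) = θ(1 ⊗ Φ⁻¹)`. -/
theorem absorb_emb₃_eq_emb₁_inv (h₁ : Q.AbsorbL₂₃ θ) (h₂ : Q.AbsorbR₃₄ θ) (h₃ : Q.AbsorbR₁₂ θ) :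
    (sw3 Φ fun a b c => θ a b c 1) = sw3 Φi fun a b c => θ 1 a b c := by
  obtain ⟨l1, l2, l3, l4⟩ := id hθ
  rw [Q.absorb_emb₁_inv θ hθ h₁ h₂]
  refine sw3_congr fun a b c => ?_
  have e := Q.sw_reassocInv_counit₁ fun y z => θ a b (c * y) z
  rw [mul_one] at e
  rw [← e]
  exact sw3_congr fun x y z => (h₃ x _ _ _ _).symm

/-- `θ((Φ⁻¹ ⊗ 1)(id ⊗ Δ ⊗ id)(Φ⁻¹)) = θ(1 ⊗ Φ)`. -/
theorem absorb_emb₃_inv_mul_emb₂_inv (h₁ : Q.AbsorbL₁₂ θ) (h₂ : Q.AbsorbL₃₄ θ) :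
    (sw3 Φi fun a b c => sw3 Φi fun x y z => sw (Δ y) fun y₁ y₂ =>
      θ (a * x) (b * y₁) (c * y₂) z) = sw3 Φ fun a b c => θ 1 a b c := by
  obtain ⟨l1, l2, l3, l4⟩ := id hθ
  refine (Q.sw_emb₃_inv_mul_emb₂_inv θ).trans ?_
  refine (sw3_congr fun a b c => (sw_sw3 _ _ _).trans (sw3_congr fun x y z =>
    (sw_sw _ _ _).trans (sw_congr fun z₁ z₂ => (sw_sw3 _ _ _).trans (sw3_congr fun u v w =>
      h₁ a _ _ _ _)))).trans ?_
  simp only [sw_smul, sw3_smul]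
  rw [Q.sw_reassocInv_counit₁ fun b c => sw3 Φi fun x y z => sw (Δ z) fun z₁ z₂ =>
    sw3 Φ fun u v w => θ x (y * u) (b * (z₁ * v)) (c * (z₂ * w))]
  simp only [one_mul]
  refine (sw3_congr fun x y z => (sw_sw3 _ _ _).trans (sw3_congr fun u v w =>
    h₂ z _ _ _ _)).trans ?_
  simp only [sw3_smul]
  rw [Q.sw_reassocInv_counit₃ fun x y => sw3 Φ fun u v w => θ x (y * u) v w]
  simp only [one_mul]

/-- `θ(Φ⁻¹ ⊗ 1) = θ(1 ⊗ Φ)`. -/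
theorem absorb_emb₃_inv_eq_emb₁ (h₁ : Q.AbsorbL₁₂ θ) (h₂ : Q.AbsorbL₃₄ θ) (h₃ : Q.AbsorbR₂₃ θ) :
    (sw3 Φi fun a b c => θ a b c 1) = sw3 Φ fun a b c => θ 1 a b c := by
  obtain ⟨l1, l2, l3, l4⟩ := id hθ
  rw [← Q.absorb_emb₃_inv_mul_emb₂_inv θ hθ h₁ h₂]
  refine sw3_congr fun a b c => ?_
  have e := Q.sw_reassocInv_counit₂ fun x z => θ (a * x) b c z
  rw [mul_one] at e
  rw [← e]
  exact sw3_congr fun x y z => (h₃ y _ _ _ _).symm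

/-- `θ((Δ ⊗ id ⊗ id)(Φ)(Φ⁻¹ ⊗ 1)) = θ(1 ⊗ Φ)`. -/
theorem absorb_emb₅_mul_emb₃_inv (h₁ : Q.AbsorbL₃₄ θ) (h₂ : Q.AbsorbR₂₃ θ) :
    (sw3 Φ fun a b c => sw (Δ a) fun a₁ a₂ => sw3 Φi fun x y z =>
      θ (a₁ * x) (a₂ * y) (b * z) c) = sw3 Φ fun a b c => θ 1 a b c := by
  obtain ⟨l1, l2, l3, l4⟩ := id hθ
  refine (Q.sw_emb₅_mul_emb₃_inv θ).trans ?_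
  refine (sw3_congr fun a b c => (sw_sw3 _ _ _).trans (sw3_congr fun x y z =>
      (sw_sw3 _ _ _).trans (sw3_congr fun u v w => (sw_sw _ _ _).trans
        (sw_congr fun v₁ v₂ => h₁ c _ _ _ _)))).trans ?_
  simp only [sw_smul, sw3_smul]
  rw [Q.sw_reassocInv_counit₃ fun a b => sw3 Φ fun x y z => sw3 Φ fun u v w =>
    sw (Δ v) fun v₁ v₂ => θ (a * u) (b * (x * v₁)) (y * v₂) (z * w)]
  simp only [one_mul]
  refine sw3_congr fun x y z => ?_
  refine (sw3_congr fun u v w => h₂ v _ _ _ _).trans ?_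
  rw [Q.sw_reassoc_counit₂ fun u w => θ u x y (z * w), mul_one]

/-- `θ((1 ⊗ Φ⁻¹)(id ⊗ id ⊗ Δ)(Φ)) = θ(Φ ⊗ 1)`. -/
theorem absorb_emb₁_inv_mul_emb₄ (h₁ : Q.AbsorbL₂₃ θ) (h₂ : Q.AbsorbR₁₂ θ) :
    (sw3 Φi fun a b c => sw3 Φ fun x y z => sw (Δ z) fun z₁ z₂ =>
      θ x (a * y) (b * z₁) (c * z₂)) = sw3 Φ fun a b c => θ a b c 1 := by
  obtain ⟨l1, l2, l3, l4⟩ := id hθ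
  refine (Q.sw_emb₁_inv_mul_emb₄ θ).trans ?_
  refine (sw3_congr fun a b c => (sw_sw3 _ _ _).trans (sw3_congr fun x y z =>
      (sw_sw3 _ _ _).trans (sw3_congr fun u v w => (sw_sw _ _ _).trans
        (sw_congr fun v₁ v₂ => h₁ b _ _ _ _)))).trans ?_
  simp only [sw_smul, sw3_smul]
  rw [Q.sw_reassoc_counit₂ fun a c => sw3 Φ fun x y z => sw3 Φi fun u v w =>
    sw (Δ u) fun u₁ u₂ => θ (a * (x * u₁)) (y * u₂) (z * v) (c * w)]
  simp only [one_mul]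
  refine sw3_congr fun x y z => ?_
  refine (sw3_congr fun u v w => h₂ u _ _ _ _).trans ?_
  rw [Q.sw_reassocInv_counit₁ fun v w => θ x y (z * v) w, mul_one]

/-- `θ((id ⊗ Δ ⊗ id)(Φ)(Φ ⊗ 1)) = θ((1 ⊗ Φ⁻¹)(id ⊗ id ⊗ Δ)(Φ))`. -/
theorem absorb_emb₂_mul_emb₃ (h₁ : Q.AbsorbR₁₂ θ) :
    (sw3 Φ fun a b c => sw (Δ b) fun b₁ b₂ => sw3 Φ fun x y z =>
      θ (a * x) (b₁ * y) (b₂ * z) c) =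
    sw3 Φi fun a b c => sw3 Φ fun x y z => sw (Δ z) fun z₁ z₂ =>
      θ x (a * y) (b * z₁) (c * z₂) := by
  obtain ⟨l1, l2, l3, l4⟩ := id hθ
  refine (Q.sw_emb₂_mul_emb₃ θ).trans ?_
  refine sw3_congr fun a b c => sw3_congr fun x y z => sw_congr fun z₁ z₂ => ?_
  have e := Q.sw_reassoc_counit₁ fun v w => θ x (a * y) (b * (z₁ * v)) (c * (z₂ * w))
  rw [mul_one, mul_one] at e
  rw [← e]
  refine sw3_congr fun u v w => ?_
  rw [← h₁ u]
  simp only [mul_assoc]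

/-- `θ((id ⊗ id ⊗ Δ)(Φ⁻¹)(1 ⊗ Φ)) = θ((Δ ⊗ id ⊗ id)(Φ)(Φ⁻¹ ⊗ 1))`. -/
theorem absorb_emb₄_inv_mul_emb₁ (h₁ : Q.AbsorbR₂₃ θ) :
    (sw3 Φi fun a b c => sw (Δ c) fun c₁ c₂ => sw3 Φ fun x y z =>
      θ a (b * x) (c₁ * y) (c₂ * z)) =
    sw3 Φ fun a b c => sw (Δ a) fun a₁ a₂ => sw3 Φi fun x y z =>
      θ (a₁ * x) (a₂ * y) (b * z) c := by
  obtain ⟨l1, l2, l3, l4⟩ := id hθ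
  refine (Q.sw_emb₄_inv_mul_emb₁ θ).trans ?_
  refine sw3_congr fun a b c => sw_congr fun a₁ a₂ => sw3_congr fun x y z => ?_
  have e := Q.sw_reassocInv_counit₂ fun u w => θ (a₁ * (x * u)) (a₂ * y) (b * z) (c * w)
  rw [mul_one, mul_one] at e
  rw [← e]
  refine sw3_congr fun u v w => ?_
  rw [← h₁ v]
  simp only [mul_assoc]

end Absorb

/-! ### The elements `p_R`, `q_R` and `q_L` -/

section Bilinear

variable (h : H) (F : H → H → M)
    (hF : IsLin2 k F := by refine ⟨?_, ?_⟩ <;> intros <;> fun_prop)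

include hF

theorem sw_pR : sw Q.pR F = sw3 Φi fun x y z => F x (y * β * S z) := by
  refine (sw3_map_right _ _ F hF).trans (sw3_congr fun x y z => ?_)
  simp [sandwichRight]

/-- `p_R (h ⊗ 1) = Δ(h₁) p_R (1 ⊗ S(h₂))`. -/
theorem sw_pR_mul : (sw3 Φi fun x y z => F (x * h) (y * β * S z)) =
    sw (Δ h) fun h₁ h₂ => sw (Δ h₁) fun h₁₁ h₁₂ => sw3 Φi fun x y z =>
      F (h₁₁ * x) (h₁₂ * (y * β * S z * S h₂)) := by
  obtain ⟨l1, l2⟩ := id hF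
  have e := Q.sw_coassoc_inv h fun a b c => F a (b * β * S c)
  refine Eq.trans ?_ (e.trans ?_)
  · rw [← Q.sw_counit_right h fun h => sw3 Φi fun x y z => F (x * h) (y * β * S z)]
    refine sw_congr fun a b => ?_
    rw [sw_sw3, ← sw3_smul]
    refine sw3_congr fun x y z => ?_
    rw [← Q.sw_beta b fun t => F (x * a) (y * t * S z)]
    simp only [antipode_mul, mul_assoc]
  · simp only [antipode_mul, mul_assoc]

/-- `h X¹ ⊗ S(X²)αX³ = X¹h₁₁ ⊗ S(X²h₁₂)αX³h₂`. -/
theorem sw_mul_qR : (sw3 Φ fun x y z => F (h * x) (S y * α * z)) =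
    sw (Δ h) fun h₁ h₂ => sw (Δ h₁) fun h₁₁ h₁₂ => sw3 Φ fun x y z =>
      F (x * h₁₁) (S (y * h₁₂) * α * (z * h₂)) := by
  obtain ⟨l1, l2⟩ := id hF
  refine Eq.trans ?_ (Q.sw_coassoc h fun a b c => F a (S b * α * c))
  rw [← Q.sw_counit_right h fun h => sw3 Φ fun x y z => F (h * x) (S y * α * z)]
  refine sw_congr fun a b => ?_
  rw [sw_sw3, ← sw3_smul]
  refine sw3_congr fun x y z => ?_
  rw [← Q.sw_alpha b fun t => F (a * x) (S y * t * z)]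
  simp only [antipode_mul, mul_assoc]

/-- `S(x¹h₁)αx²h₂₁ ⊗ x³h₂₂ = S(x¹)αx² ⊗ hx³`. -/
theorem sw_qL_mul : (sw (Δ h) fun h₁ h₂ => sw (Δ h₂) fun h₂₁ h₂₂ => sw3 Φi fun x y z =>
      F (S (x * h₁) * α * (y * h₂₁)) (z * h₂₂)) =
    sw3 Φi fun x y z => F (S x * α * y) (h * z) := by
  obtain ⟨l1, l2⟩ := id hF
  refine (Q.sw_coassoc_inv h fun a b c => F (S a * α * b) c).trans ?_
  rw [← Q.sw_counit_left h fun h => sw3 Φi fun x y z => F (S x * α * y) (h * z)]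
  refine sw_congr fun a b => ?_
  rw [sw_sw3, ← sw3_smul]
  refine sw3_congr fun x y z => ?_
  rw [← Q.sw_alpha a fun t => F (S x * t * y) (b * z)]
  simp only [antipode_mul, mul_assoc]

/-- `X¹₁p¹ ⊗ X¹₂p²S(X²)αX³ = 1 ⊗ 1`. -/
theorem sw_qR_pR : (sw3 Φ fun a b c => sw (Δ a) fun a₁ a₂ => sw3 Φi fun x y z =>
      F (a₁ * x) (a₂ * (y * β * S z) * (S b * α * c))) = F 1 1 := by
  obtain ⟨l1, l2⟩ := id hF
  have e := Q.absorb_emb₅_mul_emb₃_inv (fun p q r s => F p (q * β * S r * α * s))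
    (hθ := ⟨by intros; fun_prop, by intros; fun_prop, by intros; fun_prop, by intros; fun_prop⟩)
    (fun h a b c d => by
      rw [← Q.sw_alpha h fun t => F a (b * β * S c * t * d)]
      simp only [antipode_mul, mul_assoc])
    (fun h a b c d => by
      rw [← Q.sw_beta h fun t => F a (b * t * S c * α * d)]
      simp only [antipode_mul, mul_assoc])
  rw [Q.sw_zigzag fun t => F 1 t] at e
  rw [← e]
  simp only [antipode_mul, mul_assoc]

/-- `X¹p¹₁ ⊗ S(X²p¹₂)αX³p² = 1 ⊗ 1`. -/
theorem sw_pR_qR : (sw3 Φ fun a b c => sw3 Φi fun x y z => sw (Δ x) fun x₁ x₂ =>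
      F (a * x₁) (S (b * x₂) * α * (c * (y * β * S z)))) = F 1 1 := by
  obtain ⟨l1, l2⟩ := id hF
  have e := Q.absorb_emb₁_inv (fun p q r s => F p (S q * α * r * β * S s))
    (hθ := ⟨by intros; fun_prop, by intros; fun_prop, by intros; fun_prop, by intros; fun_prop⟩)
    (fun h a b c d => by
      rw [← Q.sw_alpha h fun t => F a (S b * t * c * β * S d)]
      simp only [antipode_mul, mul_assoc])
    (fun h a b c d => by
      rw [← Q.sw_beta h fun t => F a (S b * α * c * t * S d)]
      simp only [antipode_mul, mul_assoc])
  rw [Q.sw_zigzag_inv fun t => F 1 t] at e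
  rw [e]
  simp only [antipode_mul, mul_assoc]

end Bilinear

/-- `X¹βS(x¹X²)αx²X³₁ ⊗ x³X³₂ = 1 ⊗ 1`. -/
theorem sw_zigzag_comul (F : H → H → M)
    (hF : IsLin2 k F := by refine ⟨?_, ?_⟩ <;> intros <;> fun_prop) :
    (sw3 Φi fun a b c => sw3 Φ fun x y z => sw (Δ z) fun z₁ z₂ =>
      F (x * β * S (a * y) * α * (b * z₁)) (c * z₂)) = F 1 1 := by
  obtain ⟨l1, l2⟩ := id hF
  rw [Q.absorb_emb₁_inv_mul_emb₄ (fun p q r s => F (p * β * S q * α * r) s)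
    (hθ := ⟨by intros; fun_prop, by intros; fun_prop, by intros; fun_prop, by intros; fun_prop⟩)
    (fun h a b c d => by
      rw [← Q.sw_alpha h fun t => F (a * β * S b * t * c) d]
      simp only [antipode_mul, mul_assoc])
    (fun h a b c d => by
      rw [← Q.sw_beta h fun t => F (a * t * S b * α * c) d]
      simp only [antipode_mul, mul_assoc])]
  rw [Q.sw_zigzag fun t => F t 1]

/-! ### Integrals: existence and uniqueness -/

@[fun_prop]
theorem isLinearMap_dualHitRight {N : Type*} [AddCommGroup N] [Module k N]
    {f : N → Module.Dual k H} (a : H) (hf : IsLinearMap k f) :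
    IsLinearMap k fun x => dualHitRight (f x) a :=
  ⟨fun x y => by ext; simp [dualHitRight, hf.map_add],
    fun c x => by ext; simp [dualHitRight, hf.map_smul]⟩

@[fun_prop]
theorem isLinearMap_dualHitRight_right {N : Type*} [AddCommGroup N] [Module k N]
    {f : N → H} (φ : Module.Dual k H) (hf : IsLinearMap k f) :
    IsLinearMap k fun x => dualHitRight φ (f x) :=
  ⟨fun x y => by ext; simp [dualHitRight, hf.map_add, add_mul],
    fun c x => by ext; simp [dualHitRight, hf.map_smul]⟩

theorem dualHitRight_mul (φ : Module.Dual k H) (a b : H) :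
    dualHitRight (dualHitRight φ a) b = dualHitRight φ (a * b) := by
  ext; simp [dualHitRight]

theorem dualHitRight_one (φ : Module.Dual k H) : dualHitRight φ 1 = φ := by
  ext; simp [dualHitRight]

/-- The endomorphism `w ↦ φ(w)h` of `H` given by `h ⊗ φ`. -/
def tensorEnd : H ⊗[k] Module.Dual k H ≃ₗ[k] (H →ₗ[k] H) :=
  (TensorProduct.comm k H (Module.Dual k H)).trans (dualTensorHomEquiv k H H)

theorem tensorEnd_tmul (h : H) (φ : Module.Dual k H) (w : H) :
    tensorEnd (h ⊗ₜ φ) w = φ w • h := by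
  simp [tensorEnd]

/-- The map `h ⊗ φ ↦ h₁p¹ ⊗ (φ ↼ S(h₂p²))`. It is injective, hence bijective, and turns left
multiplication on the first factor into the diagonal action. -/
def mulPR : H ⊗[k] Module.Dual k H →ₗ[k] H ⊗[k] Module.Dual k H :=
  IsLinearMap.mk' (fun τ => sw τ fun h φ => sw (Δ h) fun h₁ h₂ => sw3 Φi fun x y z =>
    (h₁ * x) ⊗ₜ[k] dualHitRight φ (S (h₂ * (y * β * S z)))) (by fun_prop)

theorem mulPR_tmul (h : H) (φ : Module.Dual k H) :
    Q.mulPR (h ⊗ₜ φ) = sw (Δ h) fun h₁ h₂ => sw3 Φi fun x y z =>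
      (h₁ * x) ⊗ₜ[k] dualHitRight φ (S (h₂ * (y * β * S z))) :=
  sw_tmul h φ fun h φ => sw (Δ h) fun h₁ h₂ => sw3 Φi fun x y z =>
    (h₁ * x) ⊗ₜ[k] dualHitRight φ (S (h₂ * (y * β * S z)))

/-- The map `h ⊗ φ ↦ X¹h₁ ⊗ (φ ↼ S(S(X²h₂)αX³))`, inverse to `mulPR`. -/
def mulQR : H ⊗[k] Module.Dual k H →ₗ[k] H ⊗[k] Module.Dual k H :=
  IsLinearMap.mk' (fun τ => sw τ fun h φ => sw3 Φ fun a b c => sw (Δ h) fun h₁ h₂ =>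
    (a * h₁) ⊗ₜ[k] dualHitRight φ (S (S (b * h₂) * α * c))) (by fun_prop)

theorem mulQR_tmul (h : H) (φ : Module.Dual k H) :
    Q.mulQR (h ⊗ₜ φ) = sw3 Φ fun a b c => sw (Δ h) fun h₁ h₂ =>
      (a * h₁) ⊗ₜ[k] dualHitRight φ (S (S (b * h₂) * α * c)) :=
  sw_tmul h φ fun h φ => sw3 Φ fun a b c => sw (Δ h) fun h₁ h₂ =>
    (a * h₁) ⊗ₜ[k] dualHitRight φ (S (S (b * h₂) * α * c))

theorem mulQR_mulPR (τ : H ⊗[k] Module.Dual k H) : Q.mulQR (Q.mulPR τ) = τ := by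
  refine ext_tensor (f := fun τ => Q.mulQR (Q.mulPR τ)) (g := fun τ => τ) τ fun h φ => ?_
  rw [mulPR_tmul, map_sw]
  simp only [map_sw3, mulQR_tmul, dualHitRight_mul, ← antipode_mul]
  have e := Q.sw_pR_qR fun p q => (h * p) ⊗ₜ[k] dualHitRight φ (S q)
  rw [mul_one, antipode_one, dualHitRight_one] at e
  refine Eq.trans ?_ e
  -- Split `Δ(hx¹)`, move `q_R` past `h`, and use `q_R p_R = 1`.
  calc _ = sw3 Φi fun x y z => sw (Δ x) fun x₁ x₂ => sw (Δ h) fun h₁ h₂ =>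
        sw (Δ h₁) fun h₁₁ h₁₂ => sw3 Φ fun a b c =>
        (a * h₁₁ * x₁) ⊗ₜ[k] dualHitRight φ
          (S (S x₂ * (S (b * h₁₂) * α * (c * h₂)) * (y * β * S z))) := by
        rw [sw_sw3]
        refine sw3_congr fun x y z => ?_
        rw [sw_sw]
        refine sw_congr fun h₁ h₂ => ?_
        rw [sw_sw, sw3_congr fun a b c => Q.sw_comul_mul h₁ x fun u v => (a * u) ⊗ₜ[k]
          dualHitRight φ (S (S (b * v) * α * c * (h₂ * (y * β * S z)))), sw3_sw]
        refine sw_congr fun h₁₁ h₁₂ => ?_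
        rw [sw3_sw]
        simp only [antipode_mul, mul_assoc]
    _ = sw3 Φi fun x y z => sw (Δ x) fun x₁ x₂ => sw3 Φ fun a b c =>
        (h * a * x₁) ⊗ₜ[k] dualHitRight φ (S (S x₂ * (S b * α * c) * (y * β * S z))) := by
        refine sw3_congr fun x y z => sw_congr fun x₁ x₂ => ?_
        exact (Q.sw_mul_qR h fun p q =>
          (p * x₁) ⊗ₜ[k] dualHitRight φ (S (S x₂ * q * (y * β * S z)))).symm
    _ = _ := by
        rw [sw3_sw3]
        refine sw3_congr fun x y z => ?_
        rw [sw_sw3]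
        simp only [antipode_mul, mul_assoc]

theorem mulPR_injective : Function.Injective Q.mulPR :=
  Function.LeftInverse.injective Q.mulQR_mulPR

theorem mulPR_surjective : Function.Surjective Q.mulPR :=
  LinearMap.surjective_of_injective Q.mulPR_injective

theorem tensorEnd_mulPR_tmul (h : H) (φ : Module.Dual k H) (w : H) :
    tensorEnd (Q.mulPR (h ⊗ₜ φ)) w = sw (Δ h) fun h₁ h₂ => sw3 Φi fun x y z =>
      φ (S (h₂ * (y * β * S z)) * w) • (h₁ * x) := by
  rw [mulPR_tmul]
  refine (IsLinearMap.map_sw (k := k) (f := fun t => tensorEnd t w) ?_ _ _).trans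
    (sw_congr fun _ _ => (IsLinearMap.map_sw3 (k := k) (f := fun t => tensorEnd t w) ?_ _ _).trans
      (sw3_congr fun _ _ _ => tensorEnd_tmul _ _ _)) <;>
  exact ⟨fun _ _ => by simp, fun _ _ => by simp⟩

/-- `mulPR` carries left multiplication by `h` on the first factor to the diagonal action. -/
theorem tensorEnd_mulPR_mul (h : H) (τ : H ⊗[k] Module.Dual k H) (w : H) :
    tensorEnd (Q.mulPR (TensorProduct.map (LinearMap.mulLeft k h) LinearMap.id τ)) w =
      sw (Δ h) fun h₁ h₂ => h₁ * tensorEnd (Q.mulPR τ) (S h₂ * w) := by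
  refine ext_tensor (k := k) (f := fun τ =>
    tensorEnd (Q.mulPR (TensorProduct.map (LinearMap.mulLeft k h) LinearMap.id τ)) w)
    (g := fun τ => sw (Δ h) fun h₁ h₂ => h₁ * tensorEnd (Q.mulPR τ) (S h₂ * w)) τ
    (fun g φ => ?_) ⟨fun _ _ => by simp, fun _ _ => by simp⟩
    (isLinearMap_sw fun _ _ => ⟨fun _ _ => by simp [mul_add], fun _ _ => by simp⟩)
  rw [TensorProduct.map_tmul, LinearMap.mulLeft_apply, LinearMap.id_apply,
    tensorEnd_mulPR_tmul, Q.sw_comul_mul h g fun p q => sw3 Φi fun x y z =>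
      φ (S (q * (y * β * S z)) * w) • (p * x)]
  refine sw_congr fun h₁ h₂ => ?_
  rw [tensorEnd_mulPR_tmul, mul_sw]
  refine sw_congr fun g₁ g₂ => ?_
  rw [mul_sw3]
  refine sw3_congr fun x y z => ?_
  simp only [mul_smul_comm, antipode_mul, mul_assoc]

/-- A linear map `g` with `h₁ g(S(h₂)w) = ε(h)g(w)`. -/
def IsInvariantEnd (g : H →ₗ[k] H) : Prop :=
  ∀ h w, (sw (Δ h) fun h₁ h₂ => h₁ * g (S h₂ * w)) = ε h • g w

/-- `X¹ g(S(X²)αX³)`. -/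
def invariantEndValue (g : H →ₗ[k] H) : H := sw3 Φ fun a b c => a * g (S b * α * c)

/-- An invariant linear map is determined by one element `y`: it is `w ↦ βwy`. -/
theorem IsInvariantEnd.apply_eq {Q : QuasiHopfAlgebra k H} {g : H →ₗ[k] H}
    (hg : Q.IsInvariantEnd g) (w : H) :
    g w = Q.beta * w * Q.invariantEndValue g := by
  -- Invariance allows to move `h` from the left of `X¹g(S(X²)αX³)` into the argument of `g`.
  have h1 : ∀ h, (sw3 (Q.reassoc : H ⊗[k] (H ⊗[k] H)) fun a b c =>
      a * g (Q.antipode b * Q.alpha * c * h)) = h * Q.invariantEndValue g := by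
    intro h
    have e := Q.sw_mul_qR h fun p q => p * g q
    rw [invariantEndValue, mul_sw3]
    simp only [← mul_assoc] at e ⊢
    rw [e, ← Q.sw_counit_left h fun h => sw3 (Q.reassoc : H ⊗[k] (H ⊗[k] H)) fun a b c =>
      a * g (Q.antipode b * Q.alpha * c * h)]
    refine sw_congr fun h₁ h₂ => ?_
    rw [sw_sw3, ← sw3_smul]
    refine sw3_congr fun a b c => ?_
    rw [← mul_smul_comm, ← hg h₁, mul_sw]
    simp only [antipode_mul, mul_assoc]
  -- By invariance of `g` and the pentagon identity `g(w) = g(S(x¹)αx²βS(x³)w)` becomes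
  -- `X¹g(S(X²)αX³βw)`.
  have e := Q.absorb_emb₃_eq_emb₁_inv
    (fun p q r s => p * g (Q.antipode q * Q.alpha * r * Q.beta * Q.antipode s * w))
    (hθ := ⟨by intros; fun_prop, by intros; fun_prop, by intros; fun_prop, by intros; fun_prop⟩)
    (fun h a b c d => by
      rw [← Q.sw_alpha h fun t => a * g (Q.antipode b * t * c * Q.beta * Q.antipode d * w)]
      simp only [antipode_mul, mul_assoc])
    (fun h a b c d => by
      rw [← Q.sw_beta h fun t => a * g (Q.antipode b * Q.alpha * c * t * Q.antipode d * w)]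
      simp only [antipode_mul, mul_assoc])
    (fun h a b c d => by
      rw [← mul_smul_comm, ← hg h, mul_sw]
      simp only [antipode_mul, mul_assoc])
  simp only [one_mul] at e
  rw [Q.sw_zigzag_inv fun t => g (t * w), one_mul, antipode_one] at e
  rw [← e, ← h1]
  simp only [mul_assoc, one_mul]

/-- For an integral the diagonal action is trivial. -/
theorem isInvariantEnd_mulPR {t : H} (ht : t ∈ Q.leftIntegrals) (φ : Module.Dual k H) :
    Q.IsInvariantEnd (tensorEnd (Q.mulPR (t ⊗ₜ φ))) := by
  intro h w
  rw [← tensorEnd_mulPR_mul, TensorProduct.map_tmul, LinearMap.mulLeft_apply, LinearMap.id_apply,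
    ht h, ← TensorProduct.smul_tmul', map_smul, map_smul, LinearMap.smul_apply]

theorem nontrivial (Q : QuasiHopfAlgebra k H) : Nontrivial H := by
  refine ⟨⟨1, 0, fun h => ?_⟩⟩
  have := congrArg Q.counit h
  simp at this

/-- The invariant endomorphism `w ↦ βw` comes from an element of `H ⊗ H*` whose first leg consists
of integrals, and `β ≠ 0`. -/
theorem exists_leftIntegral_ne_zero : ∃ t ∈ Q.leftIntegrals, t ≠ 0 := by
  obtain ⟨τ, hτ⟩ := Q.mulPR_surjective (tensorEnd.symm (LinearMap.mulLeft k β))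
  have h1 : ∀ w, tensorEnd (Q.mulPR τ) w = β * w := by
    intro w; rw [hτ, LinearEquiv.apply_symm_apply, LinearMap.mulLeft_apply]
  -- The first leg of `τ` consists of integrals, by injectivity of `mulPR`.
  have h2 : ∀ h, TensorProduct.map (LinearMap.mulLeft k h) LinearMap.id τ = ε h • τ := by
    intro h
    apply Q.mulPR_injective
    apply tensorEnd.injective
    ext w
    rw [tensorEnd_mulPR_mul, map_smul, map_smul, LinearMap.smul_apply]
    simp only [h1]
    simpa only [mul_assoc, smul_mul_assoc] using Q.sw_beta h fun t => t * w
  have h3 : ∀ (h w : H) (τ : H ⊗[k] Module.Dual k H), tensorEnd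
      (TensorProduct.map (LinearMap.mulLeft k h) LinearMap.id τ) w = h * tensorEnd τ w := by
    intro h w τ
    induction τ with
    | zero => simp
    | add x y hx hy => simp [hx, hy, mul_add]
    | tmul a φ => simp [tensorEnd_tmul]
  by_contra! hne
  have h4 : τ = 0 := by
    apply tensorEnd.injective
    ext w
    rw [map_zero, LinearMap.zero_apply]
    refine hne _ fun h => ?_
    rw [← h3, h2, map_smul, LinearMap.smul_apply]
  -- If all integrals vanish, so do `τ` and `β`, contradicting `X¹βS(X²)αX³ = 1`.
  have h5 : β = 0 := by
    have := h1 1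
    rwa [h4, map_zero, map_zero, LinearMap.zero_apply, mul_one, eq_comm] at this
  have h6 := Q.sw_zigzag fun t => t
  simp only [h5, mul_zero, zero_mul] at h6
  have := Q.nontrivial
  refine zero_ne_one (Eq.trans ?_ h6)
  simp [sw3, sw]

/-- For an integral `t`, the map `φ ↦ X¹t₁p¹ φ(S(X²t₂p²)αX³)` from the dual of `H` to `H`. -/
def integralMap (t : H) : Module.Dual k H →ₗ[k] H :=
  IsLinearMap.mk' (fun φ => Q.invariantEndValue (tensorEnd (Q.mulPR (t ⊗ₜ φ))))
    ⟨fun φ ψ => by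
      simp only [invariantEndValue, TensorProduct.tmul_add, map_add, LinearMap.add_apply, mul_add]
      simp only [sw3, sw, Finset.sum_add_distrib],
     fun c φ => by
      simp only [invariantEndValue, TensorProduct.tmul_smul, map_smul, LinearMap.smul_apply,
        mul_smul_comm, sw3_smul]⟩

/-- The invariant endomorphism given by `t ⊗ φ` is `w ↦ βw · integralMap t φ`. -/
theorem tensorEnd_mulPR_eq {t : H} (ht : t ∈ Q.leftIntegrals) (φ : Module.Dual k H) (w : H) :
    tensorEnd (Q.mulPR (t ⊗ₜ φ)) w = β * w * Q.integralMap t φ :=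
  (Q.isInvariantEnd_mulPR ht φ).apply_eq w

theorem integralMap_injective {t : H} (ht : t ∈ Q.leftIntegrals) (ht0 : t ≠ 0) :
    Function.Injective (Q.integralMap t) := by
  rw [injective_iff_map_eq_zero]
  intro φ hφ
  have h1 : t ⊗ₜ[k] φ = 0 := by
    apply Q.mulPR_injective
    apply tensorEnd.injective
    ext w
    rw [Q.tensorEnd_mulPR_eq ht, hφ, mul_zero, map_zero, map_zero, LinearMap.zero_apply]
  ext w
  have h2 : φ w • t = 0 := by rw [← tensorEnd_tmul, h1, map_zero, LinearMap.zero_apply]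
  exact (smul_eq_zero.1 h2).resolve_right ht0

theorem integralMap_surjective {t : H} (ht : t ∈ Q.leftIntegrals) (ht0 : t ≠ 0) :
    Function.Surjective (Q.integralMap t) := by
  have h : Module.finrank k (Module.Dual k H) = Module.finrank k H := Subspace.dual_finrank_eq
  exact (LinearMap.injective_iff_surjective_of_finrank_eq_finrank h).1
    (Q.integralMap_injective ht ht0)

/-- Uniqueness of integrals: as `integralMap t` is onto, `s ⊗ ψ` and some `t ⊗ φ` give the same
invariant endomorphism and are equal. -/
theorem leftIntegral_eq_smul {t s : H} (ht : t ∈ Q.leftIntegrals) (ht0 : t ≠ 0)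
    (hs : s ∈ Q.leftIntegrals) : ∃ c : k, s = c • t := by
  have := Q.nontrivial
  obtain ⟨ψ, hψ⟩ := Module.Projective.exists_dual_eq_one k (one_ne_zero : (1 : H) ≠ 0)
  obtain ⟨φ, hφ⟩ := Q.integralMap_surjective ht ht0 (Q.integralMap s ψ)
  have h1 : t ⊗ₜ[k] φ = s ⊗ₜ[k] ψ := by
    apply Q.mulPR_injective
    apply tensorEnd.injective
    ext w
    rw [Q.tensorEnd_mulPR_eq ht, Q.tensorEnd_mulPR_eq hs, hφ]
  have h2 := congrArg (fun τ => tensorEnd τ 1) h1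
  simp only [tensorEnd_tmul, hψ, one_smul] at h2
  exact ⟨φ 1, h2.symm⟩

/-! ### The Frobenius element of an integral and bijectivity of the antipode -/

section Integral

variable {t : H} (ht : t ∈ Q.leftIntegrals)

include ht

/-- `Δ(h)Δ(t) = ε(h)Δ(t)`. -/
theorem sw_integral_mul (h : H) (F : H → H → M)
    (hF : IsLin2 k F := by refine ⟨?_, ?_⟩ <;> intros <;> fun_prop) :
    (sw (Δ h) fun h₁ h₂ => sw (Δ t) fun t₁ t₂ => F (h₁ * t₁) (h₂ * t₂)) =
      ε h • sw (Δ t) F := by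
  rw [← Q.sw_comul_mul h t F hF, ht h, map_smul]
  exact (isLinearMap_sw_tensor (z := fun x => x) (F := F) (by fun_prop) hF.1).map_smul _ _

/-- `q_L Δ(t) = q_R Δ(t)`, in the form
`S(x¹)αx²t₁ ⊗ S(x³t₂) = X¹t₁ ⊗ S(X²t₂)αX³`; no inverse of the antipode is used. -/
theorem qL_integral_eq_qR_integral :
    (sw (Δ t) fun t₁ t₂ => sw3 Φi fun x y z => (S x * α * y * t₁) ⊗ₜ[k] S (z * t₂)) =
      sw (Δ t) fun t₁ t₂ => sw3 Φ fun x y z => (x * t₁) ⊗ₜ[k] (S (y * t₂) * α * z) := by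
  set zL := sw (Δ t) fun t₁ t₂ => sw3 Φi fun x y z => (S x * α * y * t₁) ⊗ₜ[k] S (z * t₂) with hL
  set zR := sw (Δ t) fun t₁ t₂ => sw3 Φ fun x y z => (x * t₁) ⊗ₜ[k] (S (y * t₂) * α * z) with hR
  -- Up to the factors `α`, the two sides agree by the pentagon identity.
  have h1 : zL * (1 ⊗ₜ α) = (α ⊗ₜ 1) * zR := by
    have e := Q.absorb_emb₃_inv_eq_emb₁ (fun a b c d =>
        sw (Δ t) fun t₁ t₂ => (S a * α * b * t₁) ⊗ₜ[k] (S (c * t₂) * α * d))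
      (hθ := ⟨by intros; fun_prop, by intros; fun_prop, by intros; fun_prop, by intros; fun_prop⟩)
      (fun h a b c d => by
        rw [← Q.sw_alpha h fun m =>
          sw (Δ t) fun t₁ t₂ => (S a * m * b * t₁) ⊗ₜ[k] (S (c * t₂) * α * d)]
        simp only [antipode_mul, mul_assoc])
      (fun h a b c d => by
        rw [← Q.sw_alpha h fun m =>
          sw (Δ t) fun t₁ t₂ => (S a * α * b * t₁) ⊗ₜ[k] (S (c * t₂) * m * d)]
        simp only [antipode_mul, mul_assoc])
      (fun h a b c d => by
        rw [← Q.sw_integral_mul ht h fun t₁ t₂ => (S a * α * b * t₁) ⊗ₜ[k] (S (c * t₂) * α * d)]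
        simp only [antipode_mul, mul_assoc])
    rw [hL, hR, sw_mul_right, mul_sw]
    simp only [sw3_mul_right, mul_sw3, Algebra.TensorProduct.tmul_mul_tmul, one_mul, mul_one]
    rw [sw_sw3, sw_sw3]
    simpa only [mul_one, antipode_one, one_mul, mul_assoc] using e
  -- Both sides intertwine the two factors of `H ⊗ H`; on the left only elements `S(h)` are allowed.
  have h2 : ∀ h : H, (h ⊗ₜ 1) * zR = zR * (1 ⊗ₜ h) := by
    intro h
    rw [hR, sw_mul_right, mul_sw]
    simp only [sw3_mul_right, mul_sw3, Algebra.TensorProduct.tmul_mul_tmul, one_mul, mul_one]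
    have e : ∀ t₁ t₂, (sw3 Φ fun x y z => (h * (x * t₁)) ⊗ₜ[k] (S (y * t₂) * α * z)) =
      sw (Δ h) fun h₁ h₂ => sw (Δ h₁) fun h₁₁ h₁₂ => sw3 Φ fun x y z =>
        (x * (h₁₁ * t₁)) ⊗ₜ[k] (S (y * (h₁₂ * t₂)) * α * (z * h₂)) := by
      intro t₁ t₂
      have e := Q.sw_mul_qR h fun p q => (p * t₁) ⊗ₜ[k] (S t₂ * q)
      simpa only [antipode_mul, mul_assoc] using e
    rw [sw_congr e, sw_sw, ← Q.sw_counit_left h fun h => sw (Δ t) fun t₁ t₂ => sw3 Φ fun x y z =>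
      (x * t₁) ⊗ₜ[k] (S (y * t₂) * α * z * h)]
    refine sw_congr fun h₁ h₂ => ?_
    rw [sw_sw, Q.sw_integral_mul ht h₁ fun t₁ t₂ => sw3 Φ fun x y z =>
      (x * t₁) ⊗ₜ[k] (S (y * t₂) * α * (z * h₂))]
    simp only [mul_assoc]
  have h3 : ∀ h : H, zL * (1 ⊗ₜ S h) = (S h ⊗ₜ 1) * zL := by
    intro h
    rw [hL, sw_mul_right, mul_sw]
    simp only [sw3_mul_right, mul_sw3, Algebra.TensorProduct.tmul_mul_tmul, one_mul, mul_one]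
    have e : ∀ t₁ t₂, (sw3 Φi fun x y z => (S x * α * y * t₁) ⊗ₜ[k] (S (z * t₂) * S h)) =
      sw (Δ h) fun h₁ h₂ => sw (Δ h₂) fun h₂₁ h₂₂ => sw3 Φi fun x y z =>
        (S h₁ * (S x * α * y * (h₂₁ * t₁))) ⊗ₜ[k] S (z * (h₂₂ * t₂)) := by
      intro t₁ t₂
      have e := Q.sw_qL_mul h fun p q => (p * t₁) ⊗ₜ[k] S (q * t₂)
      simpa only [antipode_mul, mul_assoc] using e.symm
    rw [sw_congr e, sw_sw, ← Q.sw_counit_right h fun h => sw (Δ t) fun t₁ t₂ =>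
      sw3 Φi fun x y z => (S h * (S x * α * y * t₁)) ⊗ₜ[k] S (z * t₂)]
    refine sw_congr fun h₁ h₂ => ?_
    rw [sw_sw, Q.sw_integral_mul ht h₂ fun t₁ t₂ => sw3 Φi fun x y z =>
      (S h₁ * (S x * α * y * t₁)) ⊗ₜ[k] S (z * t₂)]
  -- The difference commutes with `S(h)` and is annihilated by `α`, so it is annihilated by
  -- `S(x¹)αx²βS(x³) = 1`.
  have h4 : (zL - zR) * (1 ⊗ₜ α) = 0 := by
    rw [sub_mul, h1, h2, sub_self]
  have h5 : ∀ h : H, (zL - zR) * (1 ⊗ₜ S h) = (S h ⊗ₜ 1) * (zL - zR) := by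
    intro h
    rw [sub_mul, mul_sub, h3, h2]
  have h6 := Q.sw_zigzag_inv fun m => (zL - zR) * (1 ⊗ₜ[k] m)
  rw [← Algebra.TensorProduct.one_def, mul_one] at h6
  rw [← sub_eq_zero, ← h6]
  refine (sw3_congr fun x y z => (?_ : _ = (0 : H ⊗[k] H))).trans (by simp [sw3, sw])
  have e : (1 : H) ⊗ₜ[k] (S x * α * y * β * S z) =
      (1 ⊗ₜ S x) * ((1 ⊗ₜ α) * (1 ⊗ₜ (y * β * S z))) := by
    simp only [Algebra.TensorProduct.tmul_mul_tmul, one_mul, mul_assoc]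
  rw [e, ← mul_assoc, h5, mul_assoc, ← mul_assoc _ (1 ⊗ₜ α), h4, zero_mul, mul_zero]

theorem sw_qL_integral (F : H → H → M)
    (hF : IsLin2 k F := by refine ⟨?_, ?_⟩ <;> intros <;> fun_prop) :
    (sw (Δ t) fun t₁ t₂ => sw3 Φi fun x y z => F (S x * α * y * t₁) (S (z * t₂))) =
      sw (Δ t) fun t₁ t₂ => sw3 Φ fun x y z => F (x * t₁) (S (y * t₂) * α * z) := by
  have h1 : IsLinearMap k fun y => sw y F := isLinearMap_sw_tensor (by fun_prop) hF.1
  have h2 : ∀ a b, sw (a ⊗ₜ b) F = F a b := fun a b => sw_tmul a b F hF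
  have h3 := congrArg (fun y => sw y F) (Q.qL_integral_eq_qR_integral ht)
  beta_reduce at h3
  rw [h1.map_sw, h1.map_sw, sw_congr fun _ _ => h1.map_sw3 _ _,
    sw_congr fun _ _ => h1.map_sw3 _ _] at h3
  simpa only [h2] using h3

end Integral

/-- The element `Γ = q_L Δ(t) p_R`. For a non-zero integral `t` it is the dual basis element of a
Frobenius structure on `H`. -/
def frobeniusElement (t : H) : H ⊗[k] H :=
  sw (Δ t) fun t₁ t₂ => sw3 Φi fun x y z => sw3 Φi fun p q r =>
    (S x * α * y * (t₁ * p)) ⊗ₜ[k] (z * (t₂ * (q * β * S r)))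

theorem sw_frobeniusElement (t : H) (F : H → H → M)
    (hF : IsLin2 k F := by refine ⟨?_, ?_⟩ <;> intros <;> fun_prop) :
    sw (Q.frobeniusElement t) F = sw (Δ t) fun t₁ t₂ => sw3 Φi fun x y z => sw3 Φi fun p q r =>
      F (S x * α * y * (t₁ * p)) (z * (t₂ * (q * β * S r))) := by
  have h1 : IsLinearMap k fun y => sw y F := isLinearMap_sw_tensor (by fun_prop) hF.1
  rw [frobeniusElement, h1.map_sw]
  refine sw_congr fun _ _ => ?_
  rw [h1.map_sw3]
  refine sw3_congr fun _ _ _ => ?_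
  rw [h1.map_sw3]
  exact sw3_congr fun _ _ _ => sw_tmul _ _ F hF

theorem integralMap_apply (t : H) (φ : Module.Dual k H) :
    Q.integralMap t φ = sw3 Φ fun a b c =>
      a * tensorEnd (Q.mulPR (t ⊗ₜ φ)) (S b * α * c) := rfl

/-- `integralMap t φ = φ(S(Γ²))Γ¹`. The map therefore only sees the values of `φ` on the image of
`S`, and its injectivity makes `S` surjective. -/
theorem integralMap_eq_sw {t : H} (ht : t ∈ Q.leftIntegrals) (φ : Module.Dual k H) :
    Q.integralMap t φ = sw (Q.frobeniusElement t) fun a b => φ (S b) • a := by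
  rw [Q.sw_frobeniusElement t fun a b => φ (S b) • a]
  have h1 := sw3_congr (z := Φi) fun p q r => Q.sw_qL_integral ht fun a b =>
    φ (S (q * β * S r) * b) • (a * p)
  calc Q.integralMap t φ
      = sw3 Φ fun a b c => sw (Δ t) fun t₁ t₂ => sw3 Φi fun p q r =>
          a * φ (S (t₂ * (q * β * S r)) * (S b * α * c)) • (t₁ * p) := by
        rw [integralMap_apply]
        refine sw3_congr fun a b c => ?_
        rw [tensorEnd_mulPR_tmul, mul_sw]
        exact sw_congr fun _ _ => mul_sw3 _ _ _
    _ = sw (Δ t) fun t₁ t₂ => sw3 Φ fun a b c => sw3 Φi fun p q r =>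
          a * φ (S (t₂ * (q * β * S r)) * (S b * α * c)) • (t₁ * p) := sw3_sw _ _ _
    _ = sw (Δ t) fun t₁ t₂ => sw3 Φi fun p q r => sw3 Φ fun a b c =>
          φ (S (q * β * S r) * (S (b * t₂) * α * c)) • (a * t₁ * p) :=
        sw_congr fun t₁ t₂ => (sw3_sw3 _ _ _).trans (sw3_congr fun p q r => sw3_congr fun a b c =>
          by simp only [antipode_mul, mul_assoc, mul_smul_comm])
    _ = sw3 Φi fun p q r => sw (Δ t) fun t₁ t₂ => sw3 Φ fun a b c =>
          φ (S (q * β * S r) * (S (b * t₂) * α * c)) • (a * t₁ * p) := sw_sw3 _ _ _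
    _ = _ := h1.symm
    _ = sw (Δ t) fun t₁ t₂ => sw3 Φi fun p q r => sw3 Φi fun a b c =>
          φ (S (q * β * S r) * S (c * t₂)) • (S a * α * b * t₁ * p) := sw3_sw _ _ _
    _ = _ := sw_congr fun t₁ t₂ => (sw3_sw3 _ _ _).trans
        (sw3_congr fun p q r => sw3_congr fun a b c => by simp only [antipode_mul, mul_assoc])

theorem antipode_bijective : Function.Bijective Q.antipode := by
  obtain ⟨t, ht, ht0⟩ := Q.exists_leftIntegral_ne_zero
  -- A functional vanishing on the image of `S` is in the kernel of `integralMap`.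
  have h : Function.Surjective Q.antipode := by
    rw [← LinearMap.range_eq_top]
    by_contra hne
    obtain ⟨φ, hφ0, hφ⟩ := Submodule.exists_le_ker_of_lt_top _ (lt_top_iff_ne_top.2 hne)
    apply hφ0
    apply Q.integralMap_injective ht ht0
    rw [map_zero, Q.integralMap_eq_sw ht]
    refine sw_eq_zero_of (k := k) fun a b => ?_
    rw [LinearMap.mem_ker.1 (hφ ⟨b, rfl⟩), zero_smul]
  exact ⟨LinearMap.injective_iff_surjective.2 h, h⟩

theorem finrank_leftIntegrals : Module.finrank k Q.leftIntegrals = 1 := by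
  obtain ⟨t, ht, ht0⟩ := Q.exists_leftIntegral_ne_zero
  refine finrank_eq_one (⟨t, ht⟩ : Q.leftIntegrals) (by simpa using ht0) fun s => ?_
  obtain ⟨c, hc⟩ := Q.leftIntegral_eq_smul ht ht0 s.2
  exact ⟨c, Subtype.ext hc.symm⟩

theorem mul_mem_leftIntegrals {t : H} (ht : t ∈ Q.leftIntegrals) (h : H) :
    t * h ∈ Q.leftIntegrals := by
  intro g
  rw [← mul_assoc, ht g, smul_mul_assoc]

/-- `th` is again an integral, hence a multiple of `t`. -/
theorem exists_modularFunction :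
    ∃ μ : H →ₐ[k] k, ∀ t ∈ Q.leftIntegrals, ∀ h : H, t * h = μ h • t := by
  obtain ⟨t, ht, ht0⟩ := Q.exists_leftIntegral_ne_zero
  obtain ⟨φ, hφ⟩ := Module.Projective.exists_dual_eq_one k ht0
  have h1 : ∀ h, t * h = φ (t * h) • t := by
    intro h
    obtain ⟨c, hc⟩ := Q.leftIntegral_eq_smul ht ht0 (Q.mul_mem_leftIntegrals ht h)
    rw [hc, map_smul, hφ, smul_eq_mul, mul_one]
  refine ⟨AlgHom.ofLinearMap (φ ∘ₗ LinearMap.mulLeft k t) (by simp [hφ]) (fun a b => ?_), ?_⟩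
  · simp only [LinearMap.comp_apply, LinearMap.mulLeft_apply]
    rw [← mul_assoc, h1 a, smul_mul_assoc, map_smul, smul_eq_mul]
    simp only [map_smul, hφ, smul_eq_mul, mul_one]
  · intro s hs h
    obtain ⟨c, rfl⟩ := Q.leftIntegral_eq_smul ht ht0 hs
    rw [smul_mul_assoc, h1 h, smul_comm c]
    simp

section FrobeniusElement

variable (t : H)

/-- `S(h)Γ¹ ⊗ Γ² = Γ¹ ⊗ hΓ²`. -/
theorem sw_frobeniusElement_antipode_mul (ht : t ∈ Q.leftIntegrals) (h : H) (F : H → H → M)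
    (hF : IsLin2 k F := by refine ⟨?_, ?_⟩ <;> intros <;> fun_prop) :
    (sw (Q.frobeniusElement t) fun a b => F (S h * a) b) =
      sw (Q.frobeniusElement t) fun a b => F a (h * b) := by
  obtain ⟨l1, l2⟩ := id hF
  rw [Q.sw_frobeniusElement t fun a b => F (S h * a) b,
    Q.sw_frobeniusElement t fun a b => F a (h * b),
    ← Q.sw_counit_right h fun h => sw (Δ t) fun t₁ t₂ => sw3 Φi fun x y z => sw3 Φi fun p q r =>
      F (S h * (S x * α * y * (t₁ * p))) (z * (t₂ * (q * β * S r)))]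
  have e : ∀ t₁ t₂ p q : H, (sw3 Φi fun x y z => F (S x * α * y * (t₁ * p)) (h * (z * (t₂ * q)))) =
      sw (Δ h) fun h₁ h₂ => sw (Δ h₂) fun h₂₁ h₂₂ => sw3 Φi fun x y z =>
        F (S h₁ * (S x * α * y * (h₂₁ * t₁ * p))) (z * (h₂₂ * t₂ * q)) := by
    intro t₁ t₂ p q
    have e := Q.sw_qL_mul h fun a b => F (a * (t₁ * p)) (b * (t₂ * q))
    simpa only [antipode_mul, mul_assoc] using e.symm
  symm
  calc _ = sw (Δ t) fun t₁ t₂ => sw3 Φi fun p q r => sw3 Φi fun x y z =>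
        F (S x * α * y * (t₁ * p)) (h * (z * (t₂ * (q * β * S r)))) :=
        sw_congr fun _ _ => sw3_sw3 _ _ _
    _ = sw (Δ t) fun t₁ t₂ => sw (Δ h) fun h₁ h₂ => sw (Δ h₂) fun h₂₁ h₂₂ =>
        sw3 Φi fun p q r => sw3 Φi fun x y z =>
        F (S h₁ * (S x * α * y * (h₂₁ * t₁ * p))) (z * (h₂₂ * t₂ * (q * β * S r))) := by
        refine sw_congr fun _ _ => ?_
        rw [sw3_congr fun p q r => e _ _ _ _, sw3_sw]
        exact sw_congr fun _ _ => sw3_sw _ _ _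
    _ = _ := by
        rw [sw_sw]
        refine sw_congr fun h₁ h₂ => ?_
        rw [sw_sw, Q.sw_integral_mul ht h₂ fun t₁ t₂ => sw3 Φi fun p q r => sw3 Φi fun x y z =>
          F (S h₁ * (S x * α * y * (t₁ * p))) (z * (t₂ * (q * β * S r)))]
        exact congrArg _ (sw_congr fun _ _ => sw3_sw3 _ _ _)

variable {t} {μ : H →ₐ[k] k}

/-- `Δ(t)Δ(h) = μ(h)Δ(t)`. -/
theorem sw_integral_mul_right (hμ : ∀ h, t * h = μ h • t) (h : H) (F : H → H → M)
    (hF : IsLin2 k F := by refine ⟨?_, ?_⟩ <;> intros <;> fun_prop) :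
    (sw (Δ t) fun t₁ t₂ => sw (Δ h) fun h₁ h₂ => F (t₁ * h₁) (t₂ * h₂)) =
      μ h • sw (Δ t) F := by
  rw [← Q.sw_comul_mul t h F hF, hμ h, map_smul]
  exact (isLinearMap_sw_tensor (z := fun x => x) (F := F) (by fun_prop) hF.1).map_smul _ _

/-- `Γ¹h ⊗ Γ² = μ(h₁) Γ¹ ⊗ Γ²S(h₂)`. -/
theorem sw_frobeniusElement_mul (hμ : ∀ h, t * h = μ h • t) (h : H) (F : H → H → M)
    (hF : IsLin2 k F := by refine ⟨?_, ?_⟩ <;> intros <;> fun_prop) :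
    (sw (Q.frobeniusElement t) fun a b => F (a * h) b) =
      sw (Δ h) fun h₁ h₂ => μ h₁ • sw (Q.frobeniusElement t) fun a b => F a (b * S h₂) := by
  obtain ⟨l1, l2⟩ := id hF
  rw [Q.sw_frobeniusElement t fun a b => F (a * h) b]
  have e : ∀ t₁ t₂ x y : H, (sw3 Φi fun p q r => F (x * (t₁ * p) * h) (y * (t₂ * (q * β * S r)))) =
      sw (Δ h) fun h₁ h₂ => sw (Δ h₁) fun h₁₁ h₁₂ => sw3 Φi fun p q r =>
        F (x * (t₁ * h₁₁ * p)) (y * (t₂ * h₁₂ * (q * β * S r)) * S h₂) := by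
    intro t₁ t₂ x y
    have e := Q.sw_pR_mul h fun a b => F (x * (t₁ * a)) (y * (t₂ * b))
    simpa only [mul_assoc] using e
  calc _ = sw (Δ t) fun t₁ t₂ => sw (Δ h) fun h₁ h₂ => sw (Δ h₁) fun h₁₁ h₁₂ =>
        sw3 Φi fun x y z => sw3 Φi fun p q r =>
          F (S x * α * y * (t₁ * h₁₁ * p)) (z * (t₂ * h₁₂ * (q * β * S r)) * S h₂) := by
        refine sw_congr fun _ _ => ?_
        rw [sw3_congr fun x y z => e _ _ _ _, sw3_sw]
        exact sw_congr fun _ _ => sw3_sw _ _ _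
    _ = _ := by
        rw [sw_sw]
        refine sw_congr fun h₁ h₂ => ?_
        rw [Q.sw_frobeniusElement t fun a b => F a (b * S h₂),
          Q.sw_integral_mul_right hμ h₁ fun t₁ t₂ => sw3 Φi fun x y z => sw3 Φi fun p q r =>
          F (S x * α * y * (t₁ * p)) (z * (t₂ * (q * β * S r)) * S h₂)]

end FrobeniusElement

/-! ### The counit on the antipode, and the Frobenius form -/

/-- For an algebra map `χ` to `k`, `χ(X¹S(X²)X³) χ(α) χ(β) = 1`; in particular `χ(α)` and
`χ(β)` do not vanish. -/
theorem character_alpha_beta (χ : H →ₐ[k] k) :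
    (sw3 Φ fun a b c => χ a * χ (S b) * χ c) * (χ α * χ β) = 1 := by
  have e := Q.sw_zigzag fun h => χ h
  rw [map_one] at e
  rw [← e, sw3_mul_right (k := k)]
  refine sw3_congr fun a b c => ?_
  simp only [map_mul]
  ring

/-- `ε ∘ S = ε`, although `α` and `β` are not normalized. -/
theorem counit_antipode (h : H) : ε (S h) = ε h := by
  have h0 := Q.character_alpha_beta ε
  have h1 : ε α ≠ 0 := by
    rintro h
    simp [h] at h0
  have e := Q.sw_alpha h fun m => ε m
  simp only [map_mul, smul_eq_mul] at e
  refine mul_right_cancel₀ h1 (Eq.trans ?_ e)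
  have e2 := Q.sw_counit_right h fun m => ε (S m) * ε α
  rw [← e2]
  refine sw_congr fun a b => ?_
  simp only [smul_eq_mul]
  ring

theorem counit_alpha_mul_counit_beta : ε α * ε β = 1 := by
  have h0 := Q.character_alpha_beta ε
  have h1 : (sw3 Φ fun a b c => ε a * ε (S b) * ε c) = 1 := by
    have e := Q.sw_reassoc_counit₂ fun a c => ε a * ε c
    rw [map_one, one_mul] at e
    rw [← e]
    refine sw3_congr fun a b c => ?_
    rw [counit_antipode, smul_eq_mul]
    ring
  rwa [h1, one_mul] at h0

section FrobeniusForm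

variable {t : H} (ht : t ∈ Q.leftIntegrals)

include ht

/-- `ε(Γ²)Γ¹ = t`. -/
theorem frobeniusElement_counit : (sw (Q.frobeniusElement t) fun a b => ε b • a) = t := by
  rw [Q.sw_frobeniusElement t fun a b => ε b • a]
  have h1 : ∀ t₁ t₂ u v : H, (sw3 Φi fun p q r =>
      ε (v * (t₂ * (q * β * S r))) • (u * (t₁ * p))) = ε t₂ • (ε v * ε β) • (u * t₁) := by
    intro t₁ t₂ u v
    have e := Q.sw_reassocInv_counit₂ fun a c => (ε v * ε t₂ * ε β * ε c) • (u * (t₁ * a))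
    rw [map_one, mul_one, mul_one] at e
    rw [smul_smul, ← mul_assoc, mul_comm (ε t₂), ← e]
    refine sw3_congr fun p q r => ?_
    simp only [map_mul, counit_antipode, smul_smul]
    congr 1
    ring
  rw [sw_congr fun t₁ t₂ => sw3_congr fun x y z => h1 t₁ t₂ _ z]
  simp only [sw3_smul]
  rw [Q.sw_counit_right t fun t => sw3 Φi fun x y z => (ε z * ε β) • (S x * α * y * t)]
  simp only [mul_smul]
  rw [Q.sw_reassocInv_counit₃ fun x y => ε β • (S x * α * y * t), antipode_one, one_mul, mul_one,
    ht, smul_smul, mul_comm, counit_alpha_mul_counit_beta, one_smul]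

/-- The functional `λ₀` with `λ₀(hΓ²)Γ¹ = S(h)`. -/
theorem exists_frobeniusForm (ht0 : t ≠ 0) : ∃ lam : Module.Dual k H,
    ∀ h, (sw (Q.frobeniusElement t) fun a b => lam (h * b) • a) = S h := by
  -- `λ = φ ∘ S` where `φ(S(Γ²))Γ¹ = 1`.
  obtain ⟨φ, hφ⟩ := Q.integralMap_surjective ht ht0 1
  refine ⟨φ ∘ₗ Q.antipode, fun h => ?_⟩
  have e := Q.sw_frobeniusElement_antipode_mul t ht h fun a b => φ (S b) • a
  refine e.symm.trans ?_
  rw [integralMap_eq_sw _ ht] at hφ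
  conv_rhs => rw [← mul_one (S h), ← hφ, mul_sw]
  simp only [mul_smul_comm]

theorem antipodeInv_integral_mul (hS : Function.Bijective Q.antipode) (h : H) :
    Q.antipodeInv hS t * h = ε h • Q.antipodeInv hS t := by
  apply hS.1
  rw [antipode_mul, antipode_antipodeInv, ht, map_smul, antipode_antipodeInv, counit_antipode]

/-- `S⁻¹(t)` is a right integral, and `ε(Γ²)Γ¹ = t`; so the dual form takes the value `1` on it. -/
theorem frobeniusForm_antipodeInv (ht0 : t ≠ 0) (hS : Function.Bijective Q.antipode)
    {lam : Module.Dual k H}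
    (hlam : ∀ h, (sw (Q.frobeniusElement t) fun a b => lam (h * b) • a) = S h) :
    lam (Q.antipodeInv hS t) = 1 := by
  -- `λ(S⁻¹(t)Γ²)Γ¹ = λ(S⁻¹(t))ε(Γ²)Γ¹ = λ(S⁻¹(t))t`.
  have e := hlam (Q.antipodeInv hS t)
  simp only [Q.antipodeInv_integral_mul ht hS, map_smul, smul_eq_mul, mul_comm _ (lam _),
    mul_smul, sw_smul, antipode_antipodeInv] at e
  rw [Q.frobeniusElement_counit ht] at e
  have h1 : (lam (Q.antipodeInv hS t) - 1) • t = 0 := by rw [sub_smul, e, one_smul, sub_self]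
  exact sub_eq_zero.1 ((smul_eq_zero.1 h1).resolve_right ht0)

end FrobeniusForm

/-! ### The Drinfeld twist -/

theorem antipodeComulCop_eq (h : H) :
    Q.antipodeComulCop h = sw (Δ h) fun a b => S b ⊗ₜ[k] S a := by
  have e := sw_self (TensorProduct.map S S (TensorProduct.comm k H H (Δ h)))
  rw [sw_map S S _ fun a b => a ⊗ₜ[k] b, sw_tensorComm _ fun a b => S a ⊗ₜ[k] S b] at e
  exact e.symm

theorem antipodeComulCop_mul (a b : H) :
    Q.antipodeComulCop (a * b) = Q.antipodeComulCop b * Q.antipodeComulCop a := by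
  rw [antipodeComulCop_eq, antipodeComulCop_eq, antipodeComulCop_eq,
    Q.sw_comul_mul a b fun x y => S y ⊗ₜ[k] S x, sw_mul_right, sw_sw]
  refine sw_congr fun _ _ => ?_
  rw [mul_sw]
  refine sw_congr fun _ _ => ?_
  rw [antipode_mul, antipode_mul, Algebra.TensorProduct.tmul_mul_tmul]

theorem antipodeComulCop_one : Q.antipodeComulCop 1 = 1 := by
  rw [antipodeComulCop_eq, Q.sw_comul_one fun x y => S y ⊗ₜ[k] S x, antipode_one,
    Algebra.TensorProduct.one_def]

/-- `γ = S(x¹X²)αx²X³₁ ⊗ S(X¹)αx³X³₂`. -/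
theorem gamma_eq : Q.gamma = sw3 Φi fun x y z => sw3 Φ fun u v w => sw (Δ w) fun w₁ w₂ =>
    (S (x * v) * α * (y * w₁)) ⊗ₜ[k] (S u * α * (z * w₂)) := by
  have h1 : ∀ T : H ⊗[k] (H ⊗[k] (H ⊗[k] H)),
      TensorProduct.map (sandwichLeft Q.antipode Q.alpha) (sandwichLeft Q.antipode Q.alpha)
        ((TensorProduct.assoc k H H (H ⊗[k] H)).symm
          (TensorProduct.map LinearMap.id (TensorProduct.leftComm k H H H).toLinearMap
            (TensorProduct.leftComm k H H (H ⊗[k] H) T))) =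
        sw4 T fun p q r s => (S q * α * r) ⊗ₜ[k] (S p * α * s) := by
    intro T
    have hl : IsLin4 k fun p q r s => (S q * α * r) ⊗ₜ[k] (S p * α * s) :=
      ⟨by intros; fun_prop, by intros; fun_prop, by intros; fun_prop, by intros; fun_prop⟩
    refine ext_tensor4 (f := fun T : H ⊗[k] (H ⊗[k] (H ⊗[k] H)) =>
      TensorProduct.map (sandwichLeft Q.antipode Q.alpha) (sandwichLeft Q.antipode Q.alpha)
        ((TensorProduct.assoc k H H (H ⊗[k] H)).symm
          (TensorProduct.map LinearMap.id (TensorProduct.leftComm k H H H).toLinearMap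
            (TensorProduct.leftComm k H H (H ⊗[k] H) T)))) (g := fun T => sw4 T _) T
      (fun p q r s => ?_) (by fun_prop) (isLinearMap_sw4_tensor isLinearMap_id hl)
    rw [sw4_tmul p q r s _ hl]
    simp [sandwichLeft]
  refine (h1 _).trans ?_
  have hl : IsLin4 k fun p q r s => (S q * α * r) ⊗ₜ[k] (S p * α * s) :=
    ⟨by intros; fun_prop, by intros; fun_prop, by intros; fun_prop, by intros; fun_prop⟩
  refine (sw4_emb₁_mul Φi (Q.emb₄ Φ) _ hl).trans (sw3_congr fun a b c => ?_)
  exact Q.sw4_emb₄ Φ (fun p q r s => (S (a * q) * α * (b * r)) ⊗ₜ[k] (S p * α * (c * s)))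
    ⟨by intros; fun_prop, by intros; fun_prop, by intros; fun_prop, by intros; fun_prop⟩

/-- `(S ⊗ S)(Δ^cop(h₁)) γ Δ(h₂) = ε(h)γ`. -/
theorem antipodeComulCop_gamma_comul (h : H) :
    (sw (Δ h) fun h₁ h₂ => Q.antipodeComulCop h₁ * Q.gamma * Δ h₂) = ε h • Q.gamma := by
  calc (sw (Δ h) fun h₁ h₂ => Q.antipodeComulCop h₁ * Q.gamma * Δ h₂)
      = sw (Δ h) fun h₁ h₂ => sw (Δ h₁) fun a₁ a₂ => sw3 Φ fun u v w => sw3 Φi fun x y z =>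
          sw (Δ (w * h₂)) fun w₁ w₂ =>
            (S (x * (v * a₂)) * α * (y * w₁)) ⊗ₜ[k] (S (u * a₁) * α * (z * w₂)) := by
        refine sw_congr fun h₁ h₂ => ?_
        rw [antipodeComulCop_eq, gamma_eq, mul_assoc, sw_mul_right]
        refine sw_congr fun a₁ a₂ => ?_
        rw [sw3_mul_right, mul_sw3, sw3_sw3 Φ Φi]
        refine sw3_congr fun x y z => ?_
        rw [sw3_mul_right, mul_sw3]
        refine sw3_congr fun u v w => ?_
        rw [Q.sw_comul_mul w h₂ fun w₁ w₂ =>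
          (S (x * (v * a₂)) * α * (y * w₁)) ⊗ₜ[k] (S (u * a₁) * α * (z * w₂)), sw_mul_right, mul_sw]
        refine sw_congr fun w₁ w₂ => ?_
        conv_lhs => rw [← sw_self (Δ h₂), mul_sw, mul_sw]
        refine sw_congr fun b₁ b₂ => ?_
        simp only [Algebra.TensorProduct.tmul_mul_tmul, antipode_mul, mul_assoc]
    _ = sw (Δ h) fun a b => sw (Δ b) fun b₁ b₂ => sw3 Φ fun u v w => sw3 Φi fun x y z =>
          sw (Δ (b₂ * w)) fun w₁ w₂ =>
            (S (x * (b₁ * v)) * α * (y * w₁)) ⊗ₜ[k] (S (a * u) * α * (z * w₂)) :=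
        (Q.sw_coassoc h fun a b c => sw3 Φi fun x y z => sw (Δ c) fun w₁ w₂ =>
            (S (x * b) * α * (y * w₁)) ⊗ₜ[k] (S a * α * (z * w₂))).symm
    _ = sw (Δ h) fun a b => sw3 Φ fun u v w => sw (Δ w) fun w₁ w₂ =>
          sw (Δ b) fun b₁ b₂ => sw (Δ b₂) fun c₁ c₂ => sw3 Φi fun x y z =>
            (S (x * b₁ * v) * α * (y * c₁ * w₁)) ⊗ₜ[k] (S (a * u) * α * (z * c₂ * w₂)) := by
        refine sw_congr fun a b => ?_
        rw [sw_sw3]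
        refine sw3_congr fun u v w => ?_
        rw [sw_sw]
        refine sw_congr fun b₁ b₂ => ?_
        rw [sw3_congr fun x y z => Q.sw_comul_mul b₂ w fun w₁ w₂ =>
            (S (x * (b₁ * v)) * α * (y * w₁)) ⊗ₜ[k] (S (a * u) * α * (z * w₂)), sw3_sw, sw_sw]
        refine sw_congr fun c₁ c₂ => ?_
        rw [sw3_sw]
        simp only [mul_assoc]
    _ = sw (Δ h) fun a b => sw3 Φ fun u v w => sw (Δ w) fun w₁ w₂ =>
          sw (Δ b) fun b₁ b₂ => sw (Δ b₁) fun c₁ c₂ => sw3 Φi fun x y z =>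
            (S (c₁ * x * v) * α * (c₂ * y * w₁)) ⊗ₜ[k] (S (a * u) * α * (b₂ * z * w₂)) :=
        sw_congr fun a b => sw3_congr fun u v w => sw_congr fun w₁ w₂ =>
          Q.sw_coassoc_inv b fun p q r =>
            (S (p * v) * α * (q * w₁)) ⊗ₜ[k] (S (a * u) * α * (r * w₂))
    _ = sw (Δ h) fun a b => sw3 Φ fun u v w => sw (Δ w) fun w₁ w₂ => sw3 Φi fun x y z =>
            (S (x * v) * α * (y * w₁)) ⊗ₜ[k] (S u * (S a * α * b) * (z * w₂)) := by
        refine sw_congr fun a b => sw3_congr fun u v w => sw_congr fun w₁ w₂ => ?_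
        rw [← Q.sw_counit_left b fun b => sw3 Φi fun x y z =>
            (S (x * v) * α * (y * w₁)) ⊗ₜ[k] (S u * (S a * α * b) * (z * w₂))]
        refine sw_congr fun b₁ b₂ => ?_
        rw [sw_sw3, ← sw3_smul]
        refine sw3_congr fun x y z => ?_
        rw [← Q.sw_alpha b₁ fun m =>
          (S (x * v) * m * (y * w₁)) ⊗ₜ[k] (S u * (S a * α * b₂) * (z * w₂))]
        simp only [antipode_mul, mul_assoc]
    _ = ε h • Q.gamma := by
        rw [Q.sw_alpha h fun m => sw3 Φ fun u v w => sw (Δ w) fun w₁ w₂ => sw3 Φi fun x y z =>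
            (S (x * v) * α * (y * w₁)) ⊗ₜ[k] (S u * m * (z * w₂)), gamma_eq, sw3_sw3]
        congr 1
        exact sw3_congr fun _ _ _ => sw_sw3 _ _ _

theorem twist_eq : Q.twist =
    sw3 Φi fun x y z => Q.antipodeComulCop x * Q.gamma * Δ (y * β * S z) := by
  have h : ∀ T : H ⊗[k] (H ⊗[k] H), LinearMap.mul' k (H ⊗[k] H)
      (TensorProduct.map (LinearMap.mulRight k Q.gamma ∘ₗ Q.antipodeComulCop)
        (Q.comul.toLinearMap ∘ₗ sandwichRight Q.antipode Q.beta) T) =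
      sw3 T fun x y z => Q.antipodeComulCop x * Q.gamma * Δ (y * β * S z) := by
    intro T
    refine ext_tensor3 (f := fun T => LinearMap.mul' k (H ⊗[k] H)
      (TensorProduct.map (LinearMap.mulRight k Q.gamma ∘ₗ Q.antipodeComulCop)
        (Q.comul.toLinearMap ∘ₗ sandwichRight Q.antipode Q.beta) T)) (g := fun T => sw3 T _) T
        fun x y z => ?_
    rw [sw3_tmul x y z fun x y z => Q.antipodeComulCop x * Q.gamma * Δ (y * β * S z)]
    simp [sandwichRight]
  exact h _

/-- `(S ⊗ S)(Δ^cop(h)) f = f Δ(S(h))`. -/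
theorem antipodeComulCop_mul_twist (h : H) :
    Q.antipodeComulCop h * Q.twist = Q.twist * Δ (S h) := by
  rw [twist_eq, mul_sw3, sw3_mul_right]
  refine Eq.trans (sw3_congr fun x y z => ?_) ((Q.sw_pR_mul h fun a b =>
    Q.antipodeComulCop a * Q.gamma * Δ b).trans ?_)
  · simp only [antipodeComulCop_mul, mul_assoc]
  · rw [← Q.sw_counit_left h fun h => sw3 Φi fun x y z =>
      Q.antipodeComulCop x * Q.gamma * Δ (y * β * S z) * Δ (S h)]
    refine sw_congr fun a b => ?_
    rw [sw_sw3, ← sw3_smul]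
    refine sw3_congr fun x y z => ?_
    have e := congrArg (fun m => Q.antipodeComulCop x * m * Δ (y * β * S z * S b))
      (Q.antipodeComulCop_gamma_comul a)
    simp only [mul_sw, sw_mul_right, mul_smul_comm, smul_mul_assoc] at e
    rw [mul_assoc _ (Δ _) (Δ _), ← map_mul, ← e]
    refine sw_congr fun _ _ => ?_
    simp only [antipodeComulCop_mul, map_mul, mul_assoc]

/-- `f Δ(α) = γ`. -/
theorem twist_mul_comul_alpha : Q.twist * Δ α = Q.gamma := by
  have e := Q.absorb_emb₃_inv_eq_emb₁ (fun a b c d =>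
      Q.antipodeComulCop a * Q.gamma * Δ (b * β * S c * α * d))
    (hθ := ⟨by intros; fun_prop, by intros; fun_prop, by intros; fun_prop, by intros; fun_prop⟩)
    (fun h a b c d => by
      have e := congrArg (fun m => Q.antipodeComulCop a * m * Δ (b * β * S c * α * d))
        (Q.antipodeComulCop_gamma_comul h)
      simp only [mul_sw, sw_mul_right, mul_smul_comm, smul_mul_assoc] at e
      rw [← e]
      simp only [antipodeComulCop_mul, map_mul, mul_assoc])
    (fun h a b c d => by
      rw [← Q.sw_alpha h fun m => Q.antipodeComulCop a * Q.gamma * Δ (b * β * S c * m * d)]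
      simp only [antipode_mul, mul_assoc])
    (fun h a b c d => by
      rw [← Q.sw_beta h fun m => Q.antipodeComulCop a * Q.gamma * Δ (b * m * S c * α * d)]
      simp only [antipode_mul, mul_assoc])
  rw [Q.sw_zigzag fun m => Q.antipodeComulCop 1 * Q.gamma * Δ m, antipodeComulCop_one, one_mul,
    map_one, mul_one] at e
  rw [twist_eq, sw3_mul_right]
  refine Eq.trans ?_ e
  simp only [mul_one, map_mul, mul_assoc]

/-! ### The twist against the Frobenius element -/

/-- `P = S(Z³) ⊗ Z¹βS(Z²)`, where `Φ = Z¹ ⊗ Z² ⊗ Z³`. -/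
def pTilde : H ⊗[k] H := sw3 Φ fun a b c => S c ⊗ₜ[k] (a * β * S b)

/-- `(1 ⊗ h₁) P (S ⊗ S)(Δ^cop(h₂)) = (S(h) ⊗ 1) P` for `P = S(Z³) ⊗ Z¹βS(Z²)`. -/
theorem mul_pTilde_antipodeComulCop (h : H) :
    (sw (Δ h) fun h₁ h₂ => (1 ⊗ₜ h₁) * Q.pTilde * Q.antipodeComulCop h₂) =
      (S h ⊗ₜ 1) * Q.pTilde := by
  calc _ = sw (Δ h) fun a b => sw (Δ b) fun b₁ b₂ => sw3 Φ fun x y z =>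
        S (b₂ * z) ⊗ₜ[k] ((a * x) * β * S (b₁ * y)) := by
        refine sw_congr fun a b => ?_
        rw [antipodeComulCop_eq, mul_sw]
        refine sw_congr fun b₁ b₂ => ?_
        rw [pTilde, mul_sw3, sw3_mul_right]
        refine sw3_congr fun x y z => ?_
        simp only [Algebra.TensorProduct.tmul_mul_tmul, antipode_mul, one_mul, mul_assoc]
    _ = _ := by
        rw [Q.sw_coassoc h fun a b c => S c ⊗ₜ[k] (a * β * S b), ← Q.sw_counit_left h fun h =>
          (S h ⊗ₜ 1) * Q.pTilde]
        refine sw_congr fun a b => ?_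
        rw [pTilde, mul_sw3, sw_sw3, ← sw3_smul]
        refine sw3_congr fun x y z => ?_
        rw [Algebra.TensorProduct.tmul_mul_tmul, one_mul, ← Q.sw_beta a fun m =>
          (S b * S z) ⊗ₜ[k] (x * m * S y)]
        simp only [antipode_mul, mul_assoc]

theorem mul_comul (a b h : H) : (a ⊗ₜ[k] b) * Δ h = sw (Δ h) fun x y => (a * x) ⊗ₜ[k] (b * y) := by
  conv_lhs => rw [← sw_self (Δ h), mul_sw]
  simp only [Algebra.TensorProduct.tmul_mul_tmul]

/-- `(1 ⊗ X¹) P (S ⊗ S)(Δ^cop(X²)) γ Δ(X³) = q_L`. -/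
theorem pTilde_gamma :
    (sw3 Φ fun a b c =>
      (1 ⊗ₜ a) * Q.pTilde * Q.antipodeComulCop b * Q.gamma * Δ c) =
      sw3 Φi fun a b c => (S a * α * b) ⊗ₜ[k] c := by
  have e := Q.absorb_emb₂_mul_emb₃ (fun p q r s => (S r ⊗ₜ[k] (p * β * S q)) * Q.gamma * Δ s)
    (hθ := ⟨by intros; fun_prop, by intros; fun_prop, by intros; fun_prop, by intros; fun_prop⟩)
    (fun h a b c d => by
      rw [← Q.sw_beta h fun m => (S c ⊗ₜ[k] (a * m * S b)) * Q.gamma * Δ d]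
      simp only [antipode_mul, mul_assoc])
  refine Eq.trans (sw3_congr fun a b c => ?_) (e.trans ?_)
  · rw [antipodeComulCop_eq, mul_sw, sw_mul_right, sw_mul_right]
    refine sw_congr fun b₁ b₂ => ?_
    rw [pTilde, mul_sw3]
    simp only [sw3_mul_right]
    refine sw3_congr fun x y z => ?_
    simp only [Algebra.TensorProduct.tmul_mul_tmul, antipode_mul, one_mul, mul_assoc]
  · calc _ = sw3 Φ fun x y z => sw (Δ z) fun z₁ z₂ => sw3 Φi fun p q r =>
          sw3 Φ fun u v w => sw3 Φi fun a b c => sw (Δ ((w * c) * z₂)) fun w₁ w₂ =>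
            (S (p * ((v * b) * z₁)) * α * (q * w₁)) ⊗ₜ[k]
              (x * β * S ((u * a) * y) * α * (r * w₂)) := by
          rw [sw3_sw3]
          refine sw3_congr fun x y z => ?_
          rw [sw3_sw]
          refine sw_congr fun z₁ z₂ => ?_
          rw [sw3_congr fun p q r => sw3_sw3 Φ Φi _, sw3_sw3 Φi Φi]
          refine sw3_congr fun a b c => ?_
          rw [gamma_eq, mul_sw3, sw3_mul_right]
          refine sw3_congr fun p q r => ?_
          rw [mul_sw3, sw3_mul_right]
          refine sw3_congr fun u v w => ?_
          rw [mul_assoc w, Q.sw_comul_mul w (c * z₂) fun w₁ w₂ =>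
            (S (p * (v * b * z₁)) * α * (q * w₁)) ⊗ₜ[k] (x * β * S (u * a * y) * α * (r * w₂)),
            mul_sw, sw_mul_right]
          refine sw_congr fun w₁ w₂ => ?_
          rw [Algebra.TensorProduct.tmul_mul_tmul, mul_comul]
          simp only [antipode_mul, mul_assoc]
      _ = sw3 Φ fun x y z => sw (Δ z) fun z₁ z₂ => sw3 Φi fun p q r => sw (Δ z₂) fun w₁ w₂ =>
            (S (p * z₁) * α * (q * w₁)) ⊗ₜ[k] (x * β * S y * α * (r * w₂)) := by
          refine sw3_congr fun x y z => sw_congr fun z₁ z₂ => sw3_congr fun p q r => ?_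
          rw [Q.sw_reassoc_mul_inv fun a b c => sw (Δ (c * z₂)) fun w₁ w₂ =>
            (S (p * (b * z₁)) * α * (q * w₁)) ⊗ₜ[k] (x * β * S (a * y) * α * (r * w₂))]
          simp only [one_mul]
      _ = sw3 Φ fun x y z => sw3 Φi fun p q r =>
            (S p * α * q) ⊗ₜ[k] (x * β * S y * α * (z * r)) := by
          refine sw3_congr fun x y z => ?_
          rw [← Q.sw_qL_mul z fun a b => a ⊗ₜ[k] (x * β * S y * α * b)]
          exact sw_congr fun _ _ => sw3_sw _ _ _
      _ = _ := by
          rw [sw3_sw3]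
          refine sw3_congr fun p q r => ?_
          rw [← one_mul r, ← Q.sw_zigzag fun m => (S p * α * q) ⊗ₜ[k] (m * r)]
          simp only [one_mul, mul_assoc]

/-- `κ(v, g) = v¹ ⊗ S(v²)αg`. -/
def kappa (v : H ⊗[k] H) (g : H) : H ⊗[k] H := sw v fun p q => p ⊗ₜ[k] (S q * α * g)

@[fun_prop]
theorem isLinearMap_kappa {N : Type*} [AddCommGroup N] [Module k N] {f : N → H ⊗[k] H} (g : H)
    (hf : IsLinearMap k f) : IsLinearMap k fun x => Q.kappa (f x) g := by
  unfold kappa; fun_prop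

@[fun_prop]
theorem isLinearMap_kappa_right {N : Type*} [AddCommGroup N] [Module k N] {f : N → H}
    (v : H ⊗[k] H) (hf : IsLinearMap k f) : IsLinearMap k fun x => Q.kappa v (f x) := by
  unfold kappa; fun_prop

theorem kappa_tmul (a b g : H) : Q.kappa (a ⊗ₜ b) g = a ⊗ₜ (S b * α * g) :=
  sw_tmul a b fun p q => p ⊗ₜ[k] (S q * α * g)

/-- `κ(vΔ(m), gn) = v¹m₁ ⊗ S(m₂)(S(v²)αg)n`. -/
theorem kappa_mul_comul (v : H ⊗[k] H) (m g n : H) :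
    Q.kappa (v * Δ m) (g * n) =
      sw (Q.kappa v g) fun a b => sw (Δ m) fun m₁ m₂ => (a * m₁) ⊗ₜ[k] (S m₂ * b * n) := by
  refine ext_tensor (f := fun v => Q.kappa (v * Δ m) (g * n)) (g := fun v =>
    sw (Q.kappa v g) fun a b => sw (Δ m) fun m₁ m₂ => (a * m₁) ⊗ₜ[k] (S m₂ * b * n)) v
    fun a b => ?_
  have h1 : IsLinearMap k fun v : H ⊗[k] H => Q.kappa v (g * n) := by fun_prop
  rw [kappa_tmul, sw_tmul _ _ fun a b => sw (Δ m) fun m₁ m₂ => (a * m₁) ⊗ₜ[k] (S m₂ * b * n),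
    mul_comul, h1.map_sw]
  refine sw_congr fun x y => ?_
  rw [kappa_tmul]
  simp only [antipode_mul, mul_assoc]

section Integral

variable {t : H} (ht : t ∈ Q.leftIntegrals)

include ht

/-- `κ(P (S ⊗ S)(Δ^cop(x¹)) γ Δ(x²t₁), x³t₂) = ε(α) tX¹ ⊗ S(X²)αX³`. -/
theorem kappa_gamma_integral :
    (sw (Δ t) fun t₁ t₂ => sw3 Φi fun x y z =>
      Q.kappa (Q.pTilde * Q.antipodeComulCop x * Q.gamma * Δ (y * t₁)) (z * t₂)) =
    ε α • sw3 Φ fun x y z => (t * x) ⊗ₜ[k] (S y * α * z) := by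
  -- Replace `1 ⊗ Φ⁻¹` by `(Φ ⊗ 1)(Δ ⊗ id ⊗ id)(Φ⁻¹)`, which puts a factor to the left of `P`.
  have e := Q.absorb_emb₁_inv (fun a b c d => sw (Δ t) fun t₁ t₂ =>
      Q.kappa ((1 ⊗ₜ a) * Q.pTilde * Q.antipodeComulCop b * Q.gamma * Δ (c * t₁)) (d * t₂))
    (hθ := ⟨by intros; fun_prop, by intros; fun_prop, by intros; fun_prop, by intros; fun_prop⟩)
    (fun h a b c d => by
      rw [sw_sw, ← sw_smul]
      refine sw_congr fun t₁ t₂ => ?_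
      have h1 : IsLinearMap k fun m => Q.kappa
        ((1 ⊗ₜ a) * Q.pTilde * Q.antipodeComulCop b * m * Δ (c * t₁)) (d * t₂) := by fun_prop
      rw [← h1.map_smul, ← antipodeComulCop_gamma_comul, h1.map_sw]
      refine sw_congr fun h₁ h₂ => ?_
      simp only [antipodeComulCop_mul, map_mul, mul_assoc])
    (fun h a b c d => by
      have e := Q.sw_integral_mul ht h fun t₁ t₂ => Q.kappa
        ((1 ⊗ₜ a) * Q.pTilde * Q.antipodeComulCop b * Q.gamma * Δ (c * t₁)) (d * t₂)
      rw [← e]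
      simp only [mul_assoc])
  -- Now `P (S ⊗ S)(Δ^cop(·)) γ Δ(·)` simplifies to `q_L`, by `pTilde_gamma`.
  have e2 : ∀ t₁ t₂ : H, (sw3 Φ fun a b c => sw3 Φi fun x y z => sw (Δ x) fun x₁ x₂ =>
      Q.kappa ((1 ⊗ₜ (a * x₁)) * Q.pTilde * Q.antipodeComulCop (b * x₂) * Q.gamma *
        Δ (c * y * t₁)) (z * t₂)) = sw3 Φi fun p q r => sw3 Φi fun x y z =>
        sw (Δ (y * t₁)) fun u v => (S (p * x) * α * (q * u)) ⊗ₜ[k] (S (r * v) * α * (z * t₂)) := by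
    intro t₁ t₂
    rw [sw3_sw3, sw3_sw3 Φi Φi]
    refine sw3_congr fun x y z => ?_
    have h1 : IsLinearMap k fun m => Q.kappa ((S x ⊗ₜ 1) * m * Δ (y * t₁)) (z * t₂) := by fun_prop
    calc _ = sw3 Φ fun a b c => Q.kappa ((S x ⊗ₜ 1) * ((1 ⊗ₜ a) * Q.pTilde *
          Q.antipodeComulCop b * Q.gamma * Δ c) * Δ (y * t₁)) (z * t₂) := by
          refine sw3_congr fun a b c => ?_
          have h2 : IsLinearMap k fun m => Q.kappa ((1 ⊗ₜ a) * m * Q.antipodeComulCop b *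
            Q.gamma * Δ c * Δ (y * t₁)) (z * t₂) := by fun_prop
          have h3 : (S x ⊗ₜ[k] (1 : H)) * ((1 ⊗ₜ a) * Q.pTilde * Q.antipodeComulCop b *
            Q.gamma * Δ c) = (1 ⊗ₜ a) * ((S x ⊗ₜ 1) * Q.pTilde) * Q.antipodeComulCop b *
            Q.gamma * Δ c := by
            simp only [← mul_assoc, Algebra.TensorProduct.tmul_mul_tmul, one_mul, mul_one]
          rw [h3, ← mul_pTilde_antipodeComulCop, h2.map_sw]
          refine sw_congr fun x₁ x₂ => ?_
          have h4 : (1 : H) ⊗ₜ[k] (a * x₁) = (1 ⊗ₜ a) * (1 ⊗ₜ x₁) := by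
            rw [Algebra.TensorProduct.tmul_mul_tmul, one_mul]
          simp only [antipodeComulCop_mul, map_mul, mul_assoc, h4]
      _ = _ := by
          rw [← h1.map_sw3, pTilde_gamma, h1.map_sw3]
          refine sw3_congr fun p q r => ?_
          have h5 : IsLinearMap k fun v => Q.kappa v (z * t₂) := by fun_prop
          rw [Algebra.TensorProduct.tmul_mul_tmul, one_mul, mul_comul, h5.map_sw]
          refine sw_congr fun u v => ?_
          rw [kappa_tmul]
          simp only [antipode_mul, mul_assoc]
  -- The two copies of `Φ⁻¹` combine to one `Φ`, which is then moved to the right of `Δ(t)`, where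
  -- `S(t₂₁)αt₂₂` absorbs a leg.
  have e3 := Q.absorb_emb₃_inv_mul_emb₂_inv (fun a b c d =>
      sw (Δ t) fun t₁ t₂ => sw (Δ t₁) fun u v =>
      (S a * α * (b * u)) ⊗ₜ[k] (S (c * v) * α * (d * t₂)))
    (hθ := ⟨by intros; fun_prop, by intros; fun_prop, by intros; fun_prop, by intros; fun_prop⟩)
    (fun h a b c d => by
      rw [← Q.sw_alpha h fun m => sw (Δ t) fun t₁ t₂ => sw (Δ t₁) fun u v =>
        (S a * m * (b * u)) ⊗ₜ[k] (S (c * v) * α * (d * t₂))]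
      simp only [antipode_mul, mul_assoc])
    (fun h a b c d => by
      rw [← Q.sw_alpha h fun m => sw (Δ t) fun t₁ t₂ => sw (Δ t₁) fun u v =>
        (S a * α * (b * u)) ⊗ₜ[k] (S (c * v) * m * (d * t₂))]
      simp only [antipode_mul, mul_assoc])
  calc _ = sw3 Φi fun x y z => sw (Δ t) fun t₁ t₂ =>
      Q.kappa ((1 ⊗ₜ 1) * Q.pTilde * Q.antipodeComulCop x * Q.gamma * Δ (y * t₁)) (z * t₂) := by
        rw [sw_sw3, ← Algebra.TensorProduct.one_def]
        simp only [one_mul]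
    _ = sw (Δ t) fun t₁ t₂ => sw3 Φ fun a b c => sw3 Φi fun x y z => sw (Δ x) fun x₁ x₂ =>
      Q.kappa ((1 ⊗ₜ (a * x₁)) * Q.pTilde * Q.antipodeComulCop (b * x₂) * Q.gamma *
        Δ (c * y * t₁)) (z * t₂) := by
        rw [e, sw_sw3]
        refine sw3_congr fun a b c => ?_
        rw [sw_sw3]
        exact sw3_congr fun x y z => sw_sw _ _ _
    _ = sw3 Φi fun p q r => sw3 Φi fun x y z => sw (Δ y) fun y₁ y₂ => sw (Δ t) fun t₁ t₂ =>
        sw (Δ t₁) fun u v =>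
        (S (p * x) * α * (q * y₁ * u)) ⊗ₜ[k] (S (r * y₂ * v) * α * (z * t₂)) := by
        rw [sw_congr e2, sw_sw3]
        refine sw3_congr fun p q r => ?_
        rw [sw_sw3]
        refine sw3_congr fun x y z => ?_
        rw [sw_sw (Δ y)]
        refine sw_congr fun t₁ t₂ => ?_
        rw [Q.sw_comul_mul y t₁ fun u v =>
          (S (p * x) * α * (q * u)) ⊗ₜ[k] (S (r * v) * α * (z * t₂))]
        simp only [mul_assoc]
    _ = sw (Δ t) fun t₁ t₂ => sw (Δ t₁) fun u v => sw3 Φ fun a b c =>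
        (α * (a * u)) ⊗ₜ[k] (S (b * v) * α * (c * t₂)) := by
        rw [e3, sw3_sw]
        refine sw_congr fun t₁ t₂ => ?_
        rw [sw3_sw]
        simp only [antipode_one, one_mul]
    _ = sw (Δ t) fun t₁ t₂ => sw (Δ t₂) fun u v => sw3 Φ fun a b c =>
        (α * (t₁ * a)) ⊗ₜ[k] (S (u * b) * α * (v * c)) :=
        (Q.sw_coassoc t fun a b c => (α * a) ⊗ₜ[k] (S b * α * c)).symm
    _ = sw3 Φ fun a b c => (α * (t * a)) ⊗ₜ[k] (S b * α * c) := by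
        rw [← Q.sw_counit_right t fun t => sw3 Φ fun a b c => (α * (t * a)) ⊗ₜ[k] (S b * α * c)]
        refine sw_congr fun t₁ t₂ => ?_
        rw [sw_sw3, ← sw3_smul]
        refine sw3_congr fun a b c => ?_
        rw [← Q.sw_alpha t₂ fun m => (α * (t₁ * a)) ⊗ₜ[k] (S b * m * c)]
        simp only [antipode_mul, mul_assoc]
    _ = _ := by
        rw [← sw3_smul]
        refine sw3_congr fun a b c => ?_
        rw [← mul_assoc, ht, smul_mul_assoc, TensorProduct.smul_tmul']

/-- `S(Z³)f¹Γ¹₁ ⊗ S(Z¹βS(Z²)f²Γ¹₂)αΓ² = ε(α) t ⊗ 1`. -/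
theorem kappa_twist_frobeniusElement :
    (sw (Q.frobeniusElement t) fun a b => Q.kappa (Q.pTilde * Q.twist * Δ a) b) =
      ε α • (t ⊗ₜ[k] 1) := by
  rw [Q.sw_frobeniusElement t fun a b => Q.kappa (Q.pTilde * Q.twist * Δ a) b]
  have h1 : ∀ x y m, Q.pTilde * Q.twist * Δ (S x * α * y * m) =
      Q.pTilde * Q.antipodeComulCop x * Q.gamma * Δ (y * m) := by
    intro x y m
    simp only [map_mul, ← mul_assoc]
    rw [mul_assoc Q.pTilde, ← antipodeComulCop_mul_twist, mul_assoc _ _ (Δ α),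
      mul_assoc _ _ (Δ α), twist_mul_comul_alpha]
    simp only [mul_assoc]
  calc _ = sw3 Φi fun p q r => sw (sw (Δ t) fun t₁ t₂ => sw3 Φi fun x y z =>
      Q.kappa (Q.pTilde * Q.antipodeComulCop x * Q.gamma * Δ (y * t₁)) (z * t₂)) fun a b =>
        sw (Δ p) fun p₁ p₂ => (a * p₁) ⊗ₜ[k] (S p₂ * b * (q * β * S r)) := by
        have h2 : ∀ p q r : H, sw (sw (Δ t) fun t₁ t₂ => sw3 Φi fun x y z =>
            Q.kappa (Q.pTilde * Q.antipodeComulCop x * Q.gamma * Δ (y * t₁)) (z * t₂)) (fun a b =>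
              sw (Δ p) fun p₁ p₂ => (a * p₁) ⊗ₜ[k] (S p₂ * b * (q * β * S r))) =
            sw (Δ t) fun t₁ t₂ => sw3 Φi fun x y z => Q.kappa (Q.pTilde * Q.antipodeComulCop x *
              Q.gamma * Δ (y * t₁) * Δ p) (z * t₂ * (q * β * S r)) := by
          intro p q r
          have h3 : IsLinearMap k fun v : H ⊗[k] H => sw v fun a b =>
            sw (Δ p) fun p₁ p₂ => (a * p₁) ⊗ₜ[k] (S p₂ * b * (q * β * S r)) := by fun_prop
          rw [h3.map_sw]
          refine sw_congr fun t₁ t₂ => ?_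
          rw [h3.map_sw3]
          exact sw3_congr fun x y z => (Q.kappa_mul_comul _ _ _ _).symm
        rw [sw3_congr h2, sw3_sw]
        refine sw_congr fun t₁ t₂ => (sw3_sw3 Φi Φi _).trans ?_
        refine sw3_congr fun p q r => sw3_congr fun x y z => ?_
        rw [h1, ← mul_assoc y, map_mul (Δ) (y * t₁) p]
        simp only [mul_assoc]
    _ = ε α • sw3 Φ fun x y z => sw3 Φi fun p q r => sw (Δ p) fun p₁ p₂ =>
        (t * (x * p₁)) ⊗ₜ[k] (S (y * p₂) * α * (z * (q * β * S r))) := by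
        rw [sw3_sw3 Φ Φi, ← sw3_smul, kappa_gamma_integral Q ht]
        refine sw3_congr fun p q r => ?_
        have h3 : IsLinearMap k fun v : H ⊗[k] H => sw v fun a b =>
          sw (Δ p) fun p₁ p₂ => (a * p₁) ⊗ₜ[k] (S p₂ * b * (q * β * S r)) := by fun_prop
        rw [h3.map_smul, h3.map_sw3]
        congr 1
        refine sw3_congr fun x y z => ?_
        rw [sw_tmul (t * x) (S y * α * z) fun a b =>
          sw (Δ p) fun p₁ p₂ => (a * p₁) ⊗ₜ[k] (S p₂ * b * (q * β * S r))]
        simp only [antipode_mul, mul_assoc]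
    _ = _ := by
        rw [Q.sw_pR_qR fun a b => (t * a) ⊗ₜ[k] b, mul_one]

end Integral

/-! ### The inverse twist against balanced trilinear maps -/

/-- `δ = x¹βS(x³₂X³) ⊗ x²X¹βS(x³₁X²)`. -/
theorem delta_eq : Q.delta = sw3 Φi fun x y z => sw (Δ z) fun z₁ z₂ => sw3 Φ fun u v w =>
    (x * β * S (z₂ * w)) ⊗ₜ[k] (y * u * β * S (z₁ * v)) := by
  have h1 : ∀ T : H ⊗[k] (H ⊗[k] (H ⊗[k] H)),
      TensorProduct.map (sandwichRight Q.antipode Q.beta) (sandwichRight Q.antipode Q.beta)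
        ((TensorProduct.assoc k H H (H ⊗[k] H)).symm
          (TensorProduct.map LinearMap.id
            ((TensorProduct.comm k (H ⊗[k] H) H).toLinearMap ∘ₗ
              (TensorProduct.assoc k H H H).symm.toLinearMap) T)) =
        sw4 T fun p q r s => (p * β * S s) ⊗ₜ[k] (q * β * S r) := by
    intro T
    have hl : IsLin4 k fun p q r s => (p * β * S s) ⊗ₜ[k] (q * β * S r) :=
      ⟨by intros; fun_prop, by intros; fun_prop, by intros; fun_prop, by intros; fun_prop⟩
    refine ext_tensor4 (f := fun T : H ⊗[k] (H ⊗[k] (H ⊗[k] H)) =>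
      TensorProduct.map (sandwichRight Q.antipode Q.beta) (sandwichRight Q.antipode Q.beta)
        ((TensorProduct.assoc k H H (H ⊗[k] H)).symm
          (TensorProduct.map LinearMap.id
            ((TensorProduct.comm k (H ⊗[k] H) H).toLinearMap ∘ₗ
              (TensorProduct.assoc k H H H).symm.toLinearMap) T))) (g := fun T => sw4 T _) T
      (fun p q r s => ?_) (by fun_prop) (isLinearMap_sw4_tensor isLinearMap_id hl)
    rw [sw4_tmul p q r s _ hl]
    simp [sandwichRight]
  refine (h1 _).trans ?_
  have hl : IsLin4 k fun p q r s => (p * β * S s) ⊗ₜ[k] (q * β * S r) :=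
    ⟨by intros; fun_prop, by intros; fun_prop, by intros; fun_prop, by intros; fun_prop⟩
  refine (Q.sw4_emb₄_mul Φi (emb₁ Φ) _ hl).trans (sw3_congr fun a b c => sw_congr fun c₁ c₂ => ?_)
  refine (sw4_emb₁ Φ (fun p q r s => (a * p * β * S (c₂ * s)) ⊗ₜ[k] (b * q * β * S (c₁ * r)))
    ⟨by intros; fun_prop, by intros; fun_prop, by intros; fun_prop, by intros; fun_prop⟩).trans ?_
  simp only [mul_one]

theorem twistInv_eq : Q.twistInv =
    sw3 Φi fun x y z => Δ (S x * α * y) * Q.delta * Q.antipodeComulCop z := by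
  have h : ∀ T : H ⊗[k] (H ⊗[k] H), LinearMap.mul' k (H ⊗[k] H)
      (TensorProduct.map
        (LinearMap.mulRight k Q.delta ∘ₗ Q.comul.toLinearMap ∘ₗ
          sandwichLeft Q.antipode Q.alpha)
        Q.antipodeComulCop ((TensorProduct.assoc k H H H).symm T)) =
      sw3 T fun x y z => Δ (S x * α * y) * Q.delta * Q.antipodeComulCop z := by
    intro T
    refine ext_tensor3 (f := fun T => LinearMap.mul' k (H ⊗[k] H)
      (TensorProduct.map
        (LinearMap.mulRight k Q.delta ∘ₗ Q.comul.toLinearMap ∘ₗ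
          sandwichLeft Q.antipode Q.alpha)
        Q.antipodeComulCop ((TensorProduct.assoc k H H H).symm T))) (g := fun T => sw3 T _) T
        fun x y z => ?_
    rw [sw3_tmul x y z fun x y z => Δ (S x * α * y) * Q.delta * Q.antipodeComulCop z]
    simp [sandwichLeft]
  exact h _

/-- The definition of `f⁻¹` under a bilinear map, with `δ` written out. -/
theorem sw_twistInv (F : H → H → M)
    (hF : IsLin2 k F := by refine ⟨?_, ?_⟩ <;> intros <;> fun_prop) :
    sw Q.twistInv F = sw3 Φi fun x y z => sw3 Φi fun p q r => sw (Δ (S x * α * y)) fun m₁ m₂ =>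
      sw (Δ (z * r)) fun s₁ s₂ => sw3 Φ fun u v w =>
        F (m₁ * (p * β * S (s₂ * w))) (m₂ * (q * u * β * S (s₁ * v))) := by
  have h1 : IsLinearMap k fun y => sw y F := isLinearMap_sw_tensor (by fun_prop) hF.1
  obtain ⟨l1, l2⟩ := id hF
  have h2 : ∀ a b h : H, ∀ n : H ⊗[k] H, sw (n * (a ⊗ₜ b) * Q.antipodeComulCop h) F =
      sw n fun n₁ n₂ => sw (Δ h) fun h₁ h₂ => F (n₁ * (a * S h₂)) (n₂ * (b * S h₁)) := by
    intro a b h n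
    rw [antipodeComulCop_eq, mul_sw, h1.map_sw, sw_sw]
    refine sw_congr fun h₁ h₂ => ?_
    rw [mul_assoc, Algebra.TensorProduct.tmul_mul_tmul, sw_mul _ _ F]
    refine sw_congr fun n₁ n₂ => ?_
    rw [sw_tmul _ _ fun x y => F (n₁ * x) (n₂ * y)]
  rw [twistInv_eq, h1.map_sw3]
  refine sw3_congr fun x y z => ?_
  rw [delta_eq, mul_sw3, sw3_mul_right, h1.map_sw3]
  refine sw3_congr fun p q r => ?_
  rw [mul_sw, sw_mul_right, h1.map_sw, sw_sw (Δ (S x * α * y)), sw_congr fun s₁ s₂ => sw_sw3 _ _ _]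
  rw [Q.sw_comul_mul z r fun s₁ s₂ => sw3 Φ fun u v w => sw (Δ (S x * α * y)) fun m₁ m₂ =>
    F (m₁ * (p * β * S (s₂ * w))) (m₂ * (q * u * β * S (s₁ * v))), sw_sw]
  refine sw_congr fun r₁ r₂ => ?_
  rw [mul_sw3, sw3_mul_right, h1.map_sw3, sw_sw3]
  refine sw3_congr fun u v w => ?_
  rw [h2, sw_sw]
  refine sw_congr fun z₁ z₂ => sw_congr fun m₁ m₂ => ?_
  simp only [antipode_mul, mul_assoc]

/-- A trilinear map `J` is balanced if `J(a₁b, c, a₂e) = J(b, ca, e)`: a coproduct multiplied from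
the left to the outer legs can be moved to the middle leg. -/
def IsBalanced (J : H → H → H → M) : Prop :=
  ∀ a b c e, (sw (Δ a) fun a₁ a₂ => J (a₁ * b) c (a₂ * e)) = J b (c * a) e

section Balanced

variable {J : H → H → H → M} (hJ : IsLin3 k J) (hb : Q.IsBalanced J)

include hJ hb

/-- Quasi-coassociativity and balancedness produce `S(h₁)αh₂` in the middle leg, which
absorbs `h`. -/
theorem IsBalanced.sw_comul (a b c e h x : H) :
    (sw (Δ h) fun h₁ h₂ => sw (Δ (h₁ * x)) fun p₁ p₂ => sw3 Φ fun X Y Z =>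
      J (Y * (p₂ * b)) (c * S (X * (p₁ * a)) * α) (Z * (h₂ * e))) =
    ε h • sw (Δ x) fun p₁ p₂ => sw3 Φ fun X Y Z =>
      J (Y * (p₂ * b)) (c * S (X * (p₁ * a)) * α) (Z * e) := by
  obtain ⟨l1, l2, l3⟩ := id hJ
  calc _ = sw (Δ x) fun x₁ x₂ => sw (Δ h) fun h₁ h₂ => sw (Δ h₁) fun p₁ p₂ =>
        sw3 Φ fun X Y Z =>
        J ((Y * p₂) * (x₂ * b)) (c * S ((X * p₁) * (x₁ * a)) * α) ((Z * h₂) * e) := by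
        rw [sw_sw (Δ x)]
        refine sw_congr fun h₁ h₂ => ?_
        rw [Q.sw_comul_mul h₁ x fun p₁ p₂ => sw3 Φ fun X Y Z =>
          J (Y * (p₂ * b)) (c * S (X * (p₁ * a)) * α) (Z * (h₂ * e)), sw_sw]
        simp only [mul_assoc]
    _ = sw (Δ x) fun x₁ x₂ => sw (Δ h) fun a' b' => sw (Δ b') fun b₁ b₂ => sw3 Φ fun X Y Z =>
        J ((b₁ * Y) * (x₂ * b)) (c * S ((a' * X) * (x₁ * a)) * α) ((b₂ * Z) * e) :=
        sw_congr fun x₁ x₂ => (Q.sw_coassoc h fun X Y Z =>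
          J (Y * (x₂ * b)) (c * S (X * (x₁ * a)) * α) (Z * e)).symm
    _ = _ := by
        rw [← sw_smul]
        refine sw_congr fun x₁ x₂ => ?_
        rw [← sw3_smul, sw_congr fun a' b' => sw_sw3 _ _ _, sw_sw3]
        refine sw3_congr fun X Y Z => ?_
        rw [← Q.sw_alpha h fun m => J (Y * (x₂ * b)) (c * S (X * (x₁ * a)) * m) (Z * e)]
        refine sw_congr fun a' b' => ?_
        simp only [mul_assoc]
        rw [hb]
        simp only [antipode_mul, mul_assoc]

end Balanced

section BalancedTwistInv

variable {J : H → H → H → M} (hJ : IsLin3 k J) (hb : Q.IsBalanced J)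

include hJ

/-- The pentagon identity for `(id ⊗ Δ ⊗ id)(Φ⁻¹)(1 ⊗ Φ⁻¹)` removes the coproduct of the middle leg
that balancedness introduces. -/
theorem sw_twistInv_pentagon (c : H) :
    (sw3 Φi fun x y z => sw (Δ y) fun y₁ y₂ => sw3 Φi fun p q r =>
      sw (Δ (z * r)) fun s₁ s₂ => sw3 Φ fun u v w =>
        J (y₁ * p * β * S (s₂ * w)) (c * S x * α) (y₂ * q * u * β * S (s₁ * v))) =
    sw3 Φi fun x y z => sw (Δ z) fun z₁ z₂ => sw3 Φ fun u v w => sw (Δ x) fun x₁ x₂ =>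
      sw3 Φ fun X Y Z => sw3 Φi fun p q r =>
        J (Y * (x₂ * (q * β * S (z₂ * w * r)))) (c * S (X * (x₁ * p)) * α)
          (Z * (y * u * β * S (z₁ * v))) := by
  obtain ⟨l1, l2, l3⟩ := id hJ
  have e1 : ∀ X Y Z x₁ x₂ y z p q r : H,
      (sw (Δ r) fun r₁ r₂ => sw (Δ (z * r₂)) fun s₁ s₂ => sw3 Φ fun u v w =>
        J (Y * (x₂ * q) * β * S (s₂ * w)) (c * S (X * (x₁ * p)) * α)
          (Z * (y * r₁) * u * β * S (s₁ * v))) =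
      sw (Δ z) fun z₁ z₂ => sw3 Φ fun u v w =>
        J (Y * (x₂ * (q * β * S (z₂ * w * r)))) (c * S (X * (x₁ * p)) * α)
          (Z * (y * u * β * S (z₁ * v))) := by
    intro X Y Z x₁ x₂ y z p q r
    rw [sw_congr fun r₁ r₂ => Q.sw_comul_mul z r₂ fun s₁ s₂ => sw3 Φ fun u v w =>
        J (Y * (x₂ * q) * β * S (s₂ * w)) (c * S (X * (x₁ * p)) * α)
          (Z * (y * r₁) * u * β * S (s₁ * v)), sw_sw]
    refine sw_congr fun z₁ z₂ => ?_
    have e2 := Q.sw_coassoc r fun u v w =>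
      J (Y * (x₂ * q) * β * S (z₂ * w)) (c * S (X * (x₁ * p)) * α)
          (Z * y * u * β * S (z₁ * v))
    simp only [← mul_assoc] at e2 ⊢
    rw [e2, ← Q.sw_counit_left r fun r => sw3 Φ fun u v w =>
        J (Y * x₂ * q * β * S (z₂ * w * r)) (c * S (X * x₁ * p) * α)
          (Z * y * u * β * S (z₁ * v))]
    refine sw_congr fun r₁ r₂ => ?_
    rw [sw_sw3, ← sw3_smul]
    refine sw3_congr fun u v w => ?_
    rw [← Q.sw_beta r₁ fun m => J (Y * x₂ * q * β * S (z₂ * w * r₂)) (c * S (X * x₁ * p) * α)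
          (Z * y * u * m * S (z₁ * v))]
    simp only [antipode_mul, mul_assoc]
  calc _ = sw3 Φ fun X Y Z => sw3 Φi fun x y z => sw (Δ x) fun x₁ x₂ => sw3 Φi fun p q r =>
        sw (Δ r) fun r₁ r₂ => sw (Δ (z * r₂)) fun s₁ s₂ => sw3 Φ fun u v w =>
        J (Y * (x₂ * q) * β * S (s₂ * w)) (c * S (X * (x₁ * p)) * α)
          (Z * (y * r₁) * u * β * S (s₁ * v)) :=
        Q.sw_emb₂_inv_mul_emb₁_inv fun x y z t => sw (Δ t) fun s₁ s₂ => sw3 Φ fun u v w =>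
          J (y * β * S (s₂ * w)) (c * S x * α) (z * u * β * S (s₁ * v))
    _ = sw3 Φ fun X Y Z => sw3 Φi fun x y z => sw (Δ x) fun x₁ x₂ => sw3 Φi fun p q r =>
        sw (Δ z) fun z₁ z₂ => sw3 Φ fun u v w =>
        J (Y * (x₂ * (q * β * S (z₂ * w * r)))) (c * S (X * (x₁ * p)) * α)
          (Z * (y * u * β * S (z₁ * v))) :=
        sw3_congr fun X Y Z => sw3_congr fun x y z => sw_congr fun x₁ x₂ =>
          sw3_congr fun p q r => e1 X Y Z x₁ x₂ y z p q r
    _ = _ := by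
        rw [sw3_sw3 Φ Φi]
        refine sw3_congr fun x y z => ?_
        rw [sw3_congr fun X Y Z => (sw_congr fun x₁ x₂ => (sw3_sw _ _ _).trans
          (sw_congr fun z₁ z₂ => sw3_sw3 _ _ _)).trans (sw_sw _ _ _), sw3_sw]
        refine sw_congr fun z₁ z₂ => ?_
        rw [sw3_congr fun X Y Z => sw_sw3 _ _ _, sw3_sw3]
        exact sw3_congr fun u v w => sw3_sw _ _ _

include hb

/-- The components of `f⁻¹` in the outer legs of a balanced trilinear map. -/
theorem IsBalanced.sw_twistInv (c : H) :
    (sw Q.twistInv fun p q => J p c q) =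
      sw3 Φi fun x y z => sw (Δ x) fun x₁ x₂ => sw3 Φ fun X Y Z => sw3 Φi fun p q r =>
        J (Y * (x₂ * (q * β * S r))) (c * S (X * (x₁ * p)) * α) (Z * (y * β * S z)) := by
  obtain ⟨l1, l2, l3⟩ := id hJ
  calc _ = sw3 Φi fun x y z => sw (Δ y) fun y₁ y₂ => sw3 Φi fun p q r =>
      sw (Δ (z * r)) fun s₁ s₂ => sw3 Φ fun u v w =>
        J (y₁ * p * β * S (s₂ * w)) (c * S x * α) (y₂ * q * u * β * S (s₁ * v)) := by
        rw [Q.sw_twistInv fun p q => J p c q]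
        refine sw3_congr fun x y z => ?_
        rw [sw_sw3]
        refine sw3_congr fun p q r => ?_
        rw [sw_sw, sw_sw (Δ y)]
        refine sw_congr fun s₁ s₂ => ?_
        rw [sw_sw3, sw_sw3]
        refine sw3_congr fun u v w => ?_
        rw [hb, ← mul_assoc c, ← mul_assoc c, ← hb]
        simp only [mul_assoc]
    _ = sw3 Φi fun x y z => sw (Δ z) fun z₁ z₂ => sw3 Φ fun u v w => sw (Δ x) fun x₁ x₂ =>
      sw3 Φ fun X Y Z => sw3 Φi fun p q r =>
        J (Y * (x₂ * (q * β * S (z₂ * w * r)))) (c * S (X * (x₁ * p)) * α)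
          (Z * (y * u * β * S (z₁ * v))) := Q.sw_twistInv_pentagon hJ c
    _ = sw3 Φ fun u v w => sw (Δ u) fun u₁ u₂ => sw3 Φi fun x y z =>
        sw (Δ (u₁ * x)) fun x₁ x₂ => sw3 Φ fun X Y Z => sw3 Φi fun p q r =>
        J (Y * (x₂ * (q * β * S (w * r)))) (c * S (X * (x₁ * p)) * α)
          (Z * ((u₂ * y) * β * S (v * z))) :=
        Q.absorb_emb₄_inv_mul_emb₁ (fun p q r s => sw (Δ p) fun x₁ x₂ => sw3 Φ fun X Y Z =>
          sw3 Φi fun u v w =>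
          J (Y * (x₂ * (v * β * S (s * w)))) (c * S (X * (x₁ * u)) * α) (Z * (q * β * S r)))
          (hθ := ⟨by intros; fun_prop, by intros; fun_prop, by intros; fun_prop,
            by intros; fun_prop⟩)
          (fun h a b c' d => by
            rw [← Q.sw_beta h fun m => sw (Δ a) fun x₁ x₂ => sw3 Φ fun X Y Z =>
              sw3 Φi fun u v w =>
              J (Y * (x₂ * (v * β * S (d * w)))) (c * S (X * (x₁ * u)) * α) (Z * (b * m * S c'))]
            simp only [antipode_mul, mul_assoc])
    _ = sw3 Φ fun u v w => ε u • sw3 Φi fun x y z => sw (Δ x) fun x₁ x₂ => sw3 Φ fun X Y Z =>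
        sw3 Φi fun p q r =>
        J (Y * (x₂ * (q * β * S (w * r)))) (c * S (X * (x₁ * p)) * α)
          (Z * (y * β * S (v * z))) := by
        refine sw3_congr fun u v w => ?_
        rw [sw_sw3, ← sw3_smul]
        refine sw3_congr fun x y z => ?_
        rw [sw_congr fun u₁ u₂ => (sw_congr fun x₁ x₂ => sw3_sw3 _ _ _).trans (sw_sw3 _ _ _),
          sw_sw3, sw_congr fun x₁ x₂ => sw3_sw3 _ _ _, sw_sw3 (Δ x), ← sw3_smul]
        refine sw3_congr fun p q r => ?_
        rw [← IsBalanced.sw_comul Q hJ hb p (q * β * S (w * r)) c (y * β * S (v * z)) u x]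
        simp only [mul_assoc]
    _ = _ := by
        rw [Q.sw_reassoc_counit₁ fun v w => sw3 Φi fun x y z => sw (Δ x) fun x₁ x₂ =>
          sw3 Φ fun X Y Z => sw3 Φi fun p q r =>
          J (Y * (x₂ * (q * β * S (w * r)))) (c * S (X * (x₁ * p)) * α)
            (Z * (y * β * S (v * z)))]
        simp only [one_mul]

end BalancedTwistInv

theorem sw_qR (hS : Function.Bijective Q.antipode) (F : H → H → M)
    (hF : IsLin2 k F := by refine ⟨?_, ?_⟩ <;> intros <;> fun_prop) :
    sw (Q.qR hS) F = sw3 Φ fun a b c => F a (Q.antipodeInv hS (α * c) * b) := by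
  obtain ⟨l1, l2⟩ := id hF
  refine (sw3_map_right _ Φ F).trans (sw3_congr fun a b c => ?_)
  simp

/-- `U = f⁻¹(S(q²) ⊗ S(q¹))`; the inverse of `S` in `q_R` cancels. -/
theorem sw_elemU (hS : Function.Bijective Q.antipode) (F : H → H → M)
    (hF : IsLin2 k F := by refine ⟨?_, ?_⟩ <;> intros <;> fun_prop) :
    sw (Q.elemU hS) F = sw Q.twistInv fun p q => sw3 Φ fun a b c =>
      F (p * (S b * α * c)) (q * S a) := by
  obtain ⟨l1, l2⟩ := id hF
  rw [elemU, sw_mul _ _ F]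
  refine sw_congr fun p q => ?_
  rw [sw_map S S _ fun a b => F (p * a) (q * b),
    sw_tensorComm _ fun a b => F (p * S a) (q * S b), sw_qR Q hS fun b a => F (p * S a) (q * S b)]
  simp only [antipode_mul, antipode_antipodeInv, mul_assoc]

section Balanced

variable {J : H → H → H → M} (hJ : IsLin3 k J) (hb : Q.IsBalanced J)

include hJ hb

/-- `J(Y(h₂b), S(X(h₁a)), …)` for `h = v¹k`: right multiplication of `v¹` by `k` amounts to right
multiplication of `v²βS(v³)` by `S(k)`. -/
theorem IsBalanced.sw_mul_antipode (a b c e : H) :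
    (sw3 Φi fun x y z => sw (Δ (x * e)) fun x₁ x₂ => sw3 Φ fun X Y Z =>
      J (Y * (x₂ * b)) (c * S (X * (x₁ * a)) * α) (Z * (y * β * S z))) =
    sw3 Φi fun x y z => sw (Δ x) fun x₁ x₂ => sw3 Φ fun X Y Z =>
      J (Y * (x₂ * b)) (c * S (X * (x₁ * a)) * α) (Z * (y * β * S z * S e)) := by
  obtain ⟨l1, l2, l3⟩ := id hJ
  rw [Q.sw_pR_mul e fun p q => sw (Δ p) fun x₁ x₂ => sw3 Φ fun X Y Z =>
    J (Y * (x₂ * b)) (c * S (X * (x₁ * a)) * α) (Z * q),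
    ← Q.sw_counit_left e fun e => sw3 Φi fun x y z => sw (Δ x) fun x₁ x₂ => sw3 Φ fun X Y Z =>
      J (Y * (x₂ * b)) (c * S (X * (x₁ * a)) * α) (Z * (y * β * S z * S e))]
  refine sw_congr fun e₁ e₂ => ?_
  rw [sw_sw3, ← sw3_smul]
  exact sw3_congr fun x y z => IsBalanced.sw_comul Q hJ hb a b c (y * β * S z * S e₂) e₁ x

/-- The components of `U` in the outer legs of a balanced trilinear map. -/
theorem IsBalanced.sw_elemU (hS : Function.Bijective Q.antipode)
    (hJ1 : ∀ b c e, J b c e = J 1 (S (S b) * c) e) :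
    (sw (Q.elemU hS) fun p q => J p (S β) q) =
      sw3 Φ fun X Y Z => J 1 (S (X * β * S Y) * α) (Z * β) := by
  obtain ⟨l1, l2, l3⟩ := id hJ
  have hJ' : IsLin3 k fun p m q => sw3 Φ fun a b c => J (p * (S b * α * c)) m (q * S a) :=
    ⟨by intros; fun_prop, by intros; fun_prop, by intros; fun_prop⟩
  -- The factor `S(q²) ⊗ S(q¹)` of `U` multiplies from the right and preserves balancedness.
  have hb' : Q.IsBalanced fun p m q => sw3 Φ fun a b c =>
      J (p * (S b * α * c)) m (q * S a) := by
    intro h p m q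
    rw [sw_sw3]
    refine sw3_congr fun a b c => ?_
    simp only [mul_assoc]
    exact hb h _ _ _
  calc _ = sw3 Φi fun x y z => sw (Δ x) fun x₁ x₂ => sw3 Φ fun X Y Z => sw3 Φi fun p q r =>
        sw3 Φ fun a b c =>
        J (Y * (x₂ * (q * β * S r)) * (S b * α * c)) (S β * S (X * (x₁ * p)) * α)
          (Z * (y * β * S z) * S a) :=
        (Q.sw_elemU hS fun p q => J p (S β) q).trans
          (IsBalanced.sw_twistInv Q hJ' hb' (S β))
    _ = sw3 Φ fun a b c => sw3 Φi fun p q r => sw3 Φi fun x y z => sw (Δ x) fun x₁ x₂ =>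
        sw3 Φ fun X Y Z =>
        J (Y * (x₂ * (q * β * S r * (S b * α * c)))) (S β * S (X * (x₁ * p)) * α)
          (Z * (y * β * S z * S a)) := by
        simp only [mul_assoc]
        rw [sw3_sw3 Φ Φi, sw3_congr fun p q r => sw3_sw3 Φ Φi _, sw3_sw3 Φi Φi]
        refine sw3_congr fun x y z => ?_
        rw [sw3_congr fun p q r => (sw3_sw _ _ _).trans (sw_congr fun x₁ x₂ => sw3_sw3 _ _ _),
          sw3_sw]
        refine sw_congr fun x₁ x₂ => ?_
        rw [sw3_sw3 Φi Φ]
    _ = sw3 Φ fun a b c => sw3 Φi fun p q r => sw3 Φi fun x y z => sw (Δ (x * a)) fun x₁ x₂ =>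
        sw3 Φ fun X Y Z =>
        J (Y * (x₂ * (q * β * S r * (S b * α * c)))) (S β * S (X * (x₁ * p)) * α)
          (Z * (y * β * S z)) :=
        sw3_congr fun a b c => sw3_congr fun p q r =>
          (IsBalanced.sw_mul_antipode Q hJ hb p _ (S β) a).symm
    _ = sw3 Φi fun x y z => sw (Δ x) fun x₁ x₂ => sw3 Φ fun X Y Z =>
        J (Y * x₂) (S β * S (X * x₁) * α) (Z * (y * β * S z)) := by
        have e := Q.sw_qR_pR fun u v => sw3 Φi fun x y z => sw (Δ x) fun x₁ x₂ =>
          sw3 Φ fun X Y Z =>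
          J (Y * (x₂ * v)) (S β * S (X * (x₁ * u)) * α) (Z * (y * β * S z))
        simp only [mul_one] at e
        rw [← e]
        refine sw3_congr fun a b c => ?_
        rw [sw_sw3]
        refine sw3_congr fun p q r => ?_
        rw [sw_sw3]
        refine sw3_congr fun x y z => ?_
        rw [Q.sw_comul_mul x a fun x₁ x₂ => sw3 Φ fun X Y Z =>
          J (Y * (x₂ * (q * β * S r * (S b * α * c)))) (S β * S (X * (x₁ * p)) * α)
          (Z * (y * β * S z)), sw_sw]
        simp only [mul_assoc]
    _ = sw3 Φi fun x y z => ε x • sw3 Φ fun X Y Z =>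
        J 1 (S (X * β * S Y) * α) (Z * (y * β * S z)) := by
        refine sw3_congr fun x y z => ?_
        rw [sw_sw3, ← sw3_smul]
        refine sw3_congr fun X Y Z => ?_
        rw [← Q.sw_beta x fun m => J 1 (S (X * m * S Y) * α) (Z * (y * β * S z))]
        refine sw_congr fun x₁ x₂ => ?_
        rw [hJ1]
        simp only [antipode_mul, mul_assoc]
    _ = _ := by
        rw [Q.sw_reassocInv_counit₁ fun y z => sw3 Φ fun X Y Z =>
          J 1 (S (X * β * S Y) * α) (Z * (y * β * S z))]
        simp only [one_mul, antipode_one, mul_one]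

end Balanced

/-! ### Left cointegrals -/

theorem kappa_pTilde_mul (w : H ⊗[k] H) (g : H) :
    Q.kappa (Q.pTilde * w) g = sw3 Φ fun X Y Z => sw w fun m n =>
      (S Z * m) ⊗ₜ[k] (S (X * β * S Y * n) * α * g) := by
  rw [kappa, sw_mul _ _ fun p q => p ⊗ₜ[k] (S q * α * g)]
  have h1 : IsLinearMap k fun v : H ⊗[k] H => sw v fun a b => sw w fun m n =>
    (a * m) ⊗ₜ[k] (S (b * n) * α * g) := by fun_prop
  rw [pTilde, h1.map_sw3]
  refine sw3_congr fun X Y Z => ?_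
  rw [sw_tmul (S Z) (X * β * S Y) fun a b => sw w fun m n => (a * m) ⊗ₜ[k] (S (b * n) * α * g)]

section Integral

variable {t : H} (ht : t ∈ Q.leftIntegrals) (hS : Function.Bijective Q.antipode)

local notation "S⁻" => Q.antipodeInv hS

include ht

/-- The element `U` against the Frobenius element: the sum of
`S(f²Γ¹₂)S²(U¹)S(β)Γ² ⊗ S⁻¹(f¹Γ¹₁)U²` is `1 ⊗ S⁻¹(t)`. -/
theorem sw_elemU_frobeniusElement :
    (sw (Q.elemU hS) fun p q => sw (Q.frobeniusElement t) fun a b =>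
      sw (Q.twist * Δ a) fun m n => (S n * S (S p) * S β * b) ⊗ₜ[k] (S⁻ m * q)) =
    1 ⊗ₜ[k] S⁻ t := by
  have hJ : IsLin3 k fun p c q => sw (Q.frobeniusElement t) fun a b =>
      sw (Q.twist * Δ a) fun m n => (S n * S (S p) * c * b) ⊗ₜ[k] (S⁻ m * q) :=
    ⟨by intros; fun_prop, by intros; fun_prop, by intros; fun_prop⟩
  -- Balancedness is `S(h)Γ¹ ⊗ Γ² = Γ¹ ⊗ hΓ²` together with `fΔ(S(h)) = (S ⊗ S)(Δ^cop(h))f`.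
  have hb : Q.IsBalanced fun p c q => sw (Q.frobeniusElement t) fun a b =>
      sw (Q.twist * Δ a) fun m n => (S n * S (S p) * c * b) ⊗ₜ[k] (S⁻ m * q) := by
    intro h p c q
    beta_reduce
    simp only [mul_assoc]
    rw [← Q.sw_frobeniusElement_antipode_mul t ht h fun a b =>
      sw (Q.twist * Δ a) fun m n => (S n * (S (S p) * (c * b))) ⊗ₜ[k] (S⁻ m * q), sw_sw]
    refine sw_congr fun a b => ?_
    rw [map_mul, ← mul_assoc, ← antipodeComulCop_mul_twist, mul_assoc,
      sw_mul _ _ fun m n => (S n * (S (S p) * (c * b))) ⊗ₜ[k] (S⁻ m * q)]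
    have h1 : IsLinearMap k fun v : H ⊗[k] H => sw v fun x y => sw (Q.twist * Δ a) fun m n =>
      (S (y * n) * (S (S p) * (c * b))) ⊗ₜ[k] (S⁻ (x * m) * q) := by fun_prop
    rw [antipodeComulCop_eq, h1.map_sw]
    refine sw_congr fun x y => ?_
    rw [sw_tmul (S y) (S x) fun x y => sw (Q.twist * Δ a) fun m n =>
      (S (y * n) * (S (S p) * (c * b))) ⊗ₜ[k] (S⁻ (x * m) * q)]
    simp only [antipode_mul, antipodeInv_mul, antipodeInv_antipode, mul_assoc]
  refine (IsBalanced.sw_elemU Q hJ hb hS fun b c e => by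
    simp only [antipode_one, mul_one, mul_assoc]).trans ?_
  have h1 : IsLinearMap k fun v : H ⊗[k] H => sw v fun x y => y ⊗ₜ[k] (S⁻ x * β) := by fun_prop
  -- What remains after removing `U` is `kappa_twist_frobeniusElement`.
  have e := congrArg (fun v : H ⊗[k] H => sw v fun x y => y ⊗ₜ[k] (S⁻ x * β))
    (Q.kappa_twist_frobeniusElement ht)
  beta_reduce at e
  rw [h1.map_smul, sw_tmul t 1 fun x y => y ⊗ₜ[k] (S⁻ x * β), antipodeInv_integral_mul Q ht hS β,
    TensorProduct.tmul_smul, smul_smul, counit_alpha_mul_counit_beta, one_smul] at e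
  rw [← e, h1.map_sw, sw3_sw]
  refine sw_congr fun a b => ?_
  rw [mul_assoc, kappa_pTilde_mul, h1.map_sw3]
  refine sw3_congr fun X Y Z => ?_
  rw [h1.map_sw]
  refine sw_congr fun m n => ?_
  rw [sw_tmul (S Z * m) (S (X * β * S Y * n) * α * b) fun x y => y ⊗ₜ[k] (S⁻ x * β)]
  simp only [antipode_mul, antipodeInv_mul, antipodeInv_antipode, antipode_one, mul_one,
    mul_assoc]

end Integral

/-- `x ↦ φ(V²x₂U²) V¹x₁U¹`, so that the coaction on the dual of `H` is
`ρ(φ) = ∑ eⁱ ⊗ coactionMap φ eᵢ`. -/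
def coactionMap (hS : Function.Bijective Q.antipode) (φ : Module.Dual k H) : H →ₗ[k] H :=
  (TensorProduct.rid k H).toLinearMap ∘ₗ TensorProduct.map LinearMap.id φ ∘ₗ
    LinearMap.mulRight k (Q.elemU hS) ∘ₗ LinearMap.mulLeft k (Q.elemV hS) ∘ₗ Q.comul.toLinearMap

theorem coactionMap_apply (hS : Function.Bijective Q.antipode) (φ : Module.Dual k H) (x : H) :
    Q.coactionMap hS φ x = sw (Q.elemV hS * Δ x * Q.elemU hS) fun p q => φ q • p := by
  have h1 : IsLinearMap k fun y : H ⊗[k] H =>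
    TensorProduct.rid k H (TensorProduct.map LinearMap.id φ y) := by fun_prop
  have e := h1.map_sw (Q.elemV hS * Δ x * Q.elemU hS) fun p q => p ⊗ₜ[k] q
  rw [sw_self] at e
  refine e.trans (sw_congr fun p q => ?_)
  simp

/-- The projection onto the coinvariants, evaluated at `h`:
`∑ᵢ eⁱ(S⁻¹(q¹) h S(βS(q² dᵢ)))` with `dᵢ = coactionMap φ eᵢ`. -/
theorem coinvariantProjection_dual (hS : Function.Bijective Q.antipode) (φ : Module.Dual k H)
    (h : H) :
    Q.coinvariantProjection hS (Q.dualLeftAction hS) Q.dualRightAction (Q.dualCoaction hS) φ h =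
      ∑ i, sw (Q.qR hS) fun a b => (Module.finBasis k H).coord i (Q.antipodeInv hS a * (h *
        S (β * S (b * Q.coactionMap hS φ (Module.finBasis k H i))))) := by
  have h0 : Q.dualCoaction hS φ = ∑ i, (Module.finBasis k H).coord i ⊗ₜ[k]
    Q.coactionMap hS φ (Module.finBasis k H i) := rfl
  rw [coinvariantProjection, LinearMap.comp_apply, LinearMap.comp_apply, h0, map_sum, map_sum,
    LinearMap.sum_apply]
  refine Finset.sum_congr rfl fun i _ => ?_
  set ψ := (Module.finBasis k H).coord i
  set d := Q.coactionMap hS φ (Module.finBasis k H i)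
  refine ext_tensor (f := fun z => TensorProduct.lift (Q.dualRightAction ∘ₗ
    LinearMap.mulLeft k Q.beta ∘ₗ Q.antipode).flip (TensorProduct.homTensorHomMap (RingHom.id k) _ H
      _ H (TensorProduct.map (Q.dualLeftAction hS) (LinearMap.mul k H) z) (ψ ⊗ₜ[k] d)) h)
    (g := fun z => sw z _) (Q.qR hS) (fun a b => ?_) ?_
  · rw [sw_tmul a b fun a b => ψ (Q.antipodeInv hS a * (h * S (β * S (b * d))))]
    simp [dualRightAction, dualLeftAction]
  · refine ⟨fun x y => ?_, fun c x => ?_⟩ <;> simp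

theorem sw_finset_sum {ι : Type*} (s : Finset ι) (z : H ⊗[k] H) (F : ι → H → H → M) :
    (sw z fun a b => ∑ i ∈ s, F i a b) = ∑ i ∈ s, sw z (F i) :=
  Finset.sum_comm

section Cointegral

variable {t : H} (ht : t ∈ Q.leftIntegrals) (hS : Function.Bijective Q.antipode)

local notation "S⁻" => Q.antipodeInv hS

theorem sw_elemV (F : H → H → M)
    (hF : IsLin2 k F := by refine ⟨?_, ?_⟩ <;> intros <;> fun_prop) :
    sw (Q.elemV hS) F = sw Q.twist fun a b => sw3 Φi fun x y z =>
      F (S⁻ (b * (y * β * S z))) (S⁻ (a * x)) := by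
  obtain ⟨l1, l2⟩ := id hF
  rw [elemV, sw_map _ _ _ F, sw_tensorComm _ fun a b => F (S⁻ a) (S⁻ b),
    sw_mul _ _ fun b a => F (S⁻ a) (S⁻ b)]
  exact sw_congr fun a b => Q.sw_pR fun x y => F (S⁻ (b * y)) (S⁻ (a * x))

/-- `VΔ(S⁻¹(g)) = S⁻¹(f²g₂p²) ⊗ S⁻¹(f¹g₁p¹)`. -/
theorem sw_elemV_mul_comul (g : H) (F : H → H → M)
    (hF : IsLin2 k F := by refine ⟨?_, ?_⟩ <;> intros <;> fun_prop) :
    sw (Q.elemV hS * Δ (S⁻ g)) F = sw3 Φi fun x y z => sw (Q.twist * Δ g) fun m n =>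
      F (S⁻ (n * (y * β * S z))) (S⁻ (m * x)) := by
  obtain ⟨l1, l2⟩ := id hF
  have h1 : ∀ x y : H, sw (Q.twist * Δ g) (fun m n => F (S⁻ (n * y)) (S⁻ (m * x))) =
      sw (Δ (S⁻ g)) fun b₁ b₂ => sw Q.twist fun m n => F (S⁻ (n * y) * b₁) (S⁻ (m * x) * b₂) := by
    intro x y
    conv_lhs => rw [← Q.antipode_antipodeInv hS g]
    rw [← antipodeComulCop_mul_twist, antipodeComulCop_eq, sw_mul_right]
    have h2 : IsLinearMap k fun v : H ⊗[k] H => sw v fun m n => F (S⁻ (n * y)) (S⁻ (m * x)) := by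
      fun_prop
    rw [h2.map_sw]
    refine sw_congr fun b₁ b₂ => ?_
    rw [sw_mul _ _ fun m n => F (S⁻ (n * y)) (S⁻ (m * x)),
      sw_tmul (S b₂) (S b₁) fun u v => sw Q.twist fun m n => F (S⁻ (v * n * y)) (S⁻ (u * m * x))]
    simp only [antipodeInv_mul, antipodeInv_antipode, mul_assoc]
  rw [sw_mul _ _ F, sw_elemV Q hS fun a b => sw (Δ (S⁻ g)) fun b₁ b₂ => F (a * b₁) (b * b₂), sw_sw3]
  refine sw3_congr fun x y z => ?_
  rw [h1, sw_sw]

/-- `S²` of the coaction map at `S⁻¹(g)`: the twist in `V` now stands next to `Δ(g)`, and all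
inverses of `S` are in the argument of `φ`. -/
theorem antipode_antipode_coactionMap (φ : Module.Dual k H) (g : H) :
    S (S (Q.coactionMap hS φ (S⁻ g))) = sw3 Φi fun x y z => sw (Q.elemU hS) fun u v =>
      sw (Q.twist * Δ g) fun m n =>
        φ (S⁻ x * (S⁻ m * v)) • (S (y * β * S z) * (S n * S (S u))) := by
  rw [coactionMap_apply, sw_mul _ _ fun p q => φ q • p, sw_elemV_mul_comul Q hS g fun a b =>
    sw (Q.elemU hS) fun u v => φ (b * v) • (a * u), map_sw3, map_sw3]
  refine sw3_congr fun x y z => ?_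
  rw [sw_sw, map_sw, map_sw]
  refine sw_congr fun m n => ?_
  rw [map_sw, map_sw]
  refine sw_congr fun u v => ?_
  simp only [map_smul, antipode_mul, antipode_antipodeInv, antipodeInv_mul, mul_assoc]

include ht

/-- With `D = coactionMap φ`: `S²(D(S⁻¹(Γ¹)))S(β)Γ² = φ(S⁻¹(t)) μ(x¹)S(x²βS(x³))`. -/
theorem sw_frobeniusElement_coactionMap {μ : H →ₐ[k] k} (hμ : ∀ h, t * h = μ h • t)
    (φ : Module.Dual k H) :
    (sw (Q.frobeniusElement t) fun a b => S (S (Q.coactionMap hS φ (S⁻ a))) * (S β * b)) =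
      φ (S⁻ t) • sw3 Φi fun x y z => μ x • S (y * β * S z) := by
  calc _ = sw3 Φi fun x y z => sw (sw (Q.elemU hS) fun p q => sw (Q.frobeniusElement t) fun a b =>
      sw (Q.twist * Δ a) fun m n => (S n * S (S p) * S β * b) ⊗ₜ[k] (S⁻ m * q)) fun u v =>
        φ (S⁻ x * v) • (S (y * β * S z) * u) := by
        rw [sw_congr fun a b => (congrArg (fun m => m * (S β * b))
          (Q.antipode_antipode_coactionMap hS φ a)).trans (sw3_mul_right _ _ _), sw_sw3]
        refine sw3_congr fun x y z => ?_
        have h1 : IsLinearMap k fun w : H ⊗[k] H => sw w fun u v =>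
          φ (S⁻ x * v) • (S (y * β * S z) * u) := by fun_prop
        rw [h1.map_sw, sw_congr fun a b => sw_mul_right _ _ _, sw_sw]
        refine sw_congr fun p q => ?_
        rw [h1.map_sw]
        refine sw_congr fun a b => ?_
        rw [h1.map_sw, sw_mul_right]
        refine sw_congr fun m n => ?_
        rw [sw_tmul _ _ fun u v => φ (S⁻ x * v) • (S (y * β * S z) * u), smul_mul_assoc]
        simp only [mul_assoc]
    _ = _ := by
        rw [sw_elemU_frobeniusElement Q ht hS, ← sw3_smul]
        refine sw3_congr fun x y z => ?_
        rw [sw_tmul _ _ fun u v => φ (S⁻ x * v) • (S (y * β * S z) * u), ← antipodeInv_mul, hμ,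
          map_smul, map_smul, mul_one, smul_eq_mul, mul_comm, mul_smul]

/-- For the projection `E` onto the coinvariants, `E(φ)(S⁻¹(Γ¹))Γ² = φ(S⁻¹(t))1`. This determines
`E(φ)`, since `Γ` is non-degenerate. -/
theorem sw_frobeniusElement_coinvariantProjection {μ : H →ₐ[k] k} (hμ : ∀ h, t * h = μ h • t)
    (φ : Module.Dual k H) :
    (sw (Q.frobeniusElement t) fun a b => Q.coinvariantProjection hS (Q.dualLeftAction hS)
      Q.dualRightAction (Q.dualCoaction hS) φ (S⁻ a) • b) = φ (S⁻ t) • (1 : H) := by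
  set D := Q.coactionMap hS φ with hD
  have h1 : ∀ p q a b : H, (∑ i, (Module.finBasis k H).coord i (S⁻ (a * p)) •
      (S (β * S (q * D (Module.finBasis k H i))) * b)) = S (β * S (q * D (S⁻ (a * p)))) * b := by
    intro p q a b
    conv_rhs => rw [← (Module.finBasis k H).sum_repr (S⁻ (a * p))]
    simp only [map_sum, map_smul, Finset.mul_sum, Finset.sum_mul, mul_smul_comm, smul_mul_assoc,
      Module.Basis.coord_apply]
  have h2 : ∀ p q a b : H, S (S q) * (S (S (D (S⁻ (a * p)))) * (S β * b)) =
      S (β * S (q * D (S⁻ (a * p)))) * b := by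
    intro p q a b
    simp only [antipode_mul, mul_assoc]
  calc _ = sw (Q.qR hS) fun p q => sw (Q.frobeniusElement t) fun a b =>
        S (S q) * (S (S (D (S⁻ (a * p)))) * (S β * b)) := by
        simp only [coinvariantProjection_dual, Finset.sum_smul]
        rw [sw_finset_sum, sw_congr fun p q => sw_congr fun a b => (h2 p q a b).trans
          (h1 p q a b).symm, sw_congr fun p q => sw_finset_sum _ _ _, sw_finset_sum]
        refine Finset.sum_congr rfl fun i _ => ?_
        have h3 : ∀ b : H, IsLinearMap k fun c : k => c • b := by intro b; fun_prop
        rw [sw_congr fun a b => (h3 b).map_sw _ _, sw_sw]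
        refine sw_congr fun p q => ?_
        rw [← Q.sw_frobeniusElement_antipode_mul t ht (S (β * S (q * D (Module.finBasis k H i))))
          fun a b => (Module.finBasis k H).coord i (S⁻ (a * p)) • b]
        simp only [antipodeInv_mul, antipodeInv_antipode, mul_assoc, hD]
    _ = sw (Q.qR hS) fun p q => sw (Δ p) fun p₁ p₂ => μ p₁ •
        (S (S q) * (φ (S⁻ t) • sw3 Φi fun x y z => μ x • S (y * β * S z)) * S p₂) := by
        refine sw_congr fun p q => ?_
        rw [Q.sw_frobeniusElement_mul hμ p fun a b =>
          S (S q) * (S (S (D (S⁻ a))) * (S β * b))]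
        refine sw_congr fun p₁ p₂ => ?_
        rw [← sw_frobeniusElement_coactionMap Q ht hS hμ φ, mul_sw, sw_mul_right]
        simp only [mul_assoc, hD]
    _ = φ (S⁻ t) • sw3 Φ fun a b c => sw (Δ a) fun a₁ a₂ => sw3 Φi fun x y z =>
        μ (a₁ * x) • S (a₂ * (y * β * S z) * (S b * α * c)) := by
        rw [sw_qR Q hS fun p q => sw (Δ p) fun p₁ p₂ => μ p₁ •
          (S (S q) * (φ (S⁻ t) • sw3 Φi fun x y z => μ x • S (y * β * S z)) * S p₂)]
        refine Eq.trans (sw3_congr fun a b c => ?_) (sw3_smul (φ (S⁻ t)) Φ _)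
        rw [← sw_smul]
        refine sw_congr fun a₁ a₂ => ?_
        rw [mul_smul_comm, smul_mul_assoc, smul_comm, mul_sw3, sw3_mul_right, ← sw3_smul]
        congr 1
        refine sw3_congr fun x y z => ?_
        rw [mul_smul_comm, smul_mul_assoc, smul_smul, map_mul μ]
        simp only [antipode_mul, antipode_antipodeInv, mul_assoc]
    _ = _ := by
        rw [Q.sw_qR_pR fun u v => μ u • S v, map_one, one_smul, antipode_one]

/-- For the form `λ` dual to the Frobenius element, `φ ↦ φ(S⁻¹(t)) λ` is the projection onto the
left cointegrals. -/
theorem coinvariantProjection_eq {μ : H →ₐ[k] k} (hμ : ∀ h, t * h = μ h • t)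
    {lam : Module.Dual k H}
    (hlam : ∀ h, (sw (Q.frobeniusElement t) fun a b => lam (h * b) • a) = S h)
    (φ : Module.Dual k H) :
    Q.coinvariantProjection hS (Q.dualLeftAction hS) Q.dualRightAction (Q.dualCoaction hS) φ =
      φ (S⁻ t) • lam := by
  ext h
  have e := congrArg (fun x => lam (h * x))
    (sw_frobeniusElement_coinvariantProjection Q ht hS hμ φ)
  beta_reduce at e
  rw [mul_smul_comm, mul_one, map_smul, mul_sw, map_sw] at e
  rw [LinearMap.smul_apply, ← e]
  -- Write the argument `h` as `S⁻¹(S(h))` and expand `S(h)` by `Γ`.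
  conv_lhs => rw [← Q.antipodeInv_antipode hS h, ← hlam h, map_sw, map_sw]
  refine sw_congr fun a b => ?_
  rw [mul_smul_comm, map_smul, map_smul, map_smul, smul_eq_mul, smul_eq_mul, mul_comm]

/-- The left cointegrals are the multiples of the form dual to the Frobenius element. -/
theorem mem_leftCointegrals_iff {μ : H →ₐ[k] k} (hμ : ∀ h, t * h = μ h • t)
    {lam : Module.Dual k H}
    (hlam : ∀ h, (sw (Q.frobeniusElement t) fun a b => lam (h * b) • a) = S h)
    (φ : Module.Dual k H) : φ ∈ Q.leftCointegrals hS ↔ φ = φ (S⁻ t) • lam := by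
  rw [leftCointegrals, LinearMap.mem_eqLocus, coinvariantProjection_eq Q ht hS hμ hlam,
    LinearMap.id_apply, eq_comm]

theorem leftCointegrals_eq_span (ht0 : t ≠ 0) {μ : H →ₐ[k] k} (hμ : ∀ h, t * h = μ h • t)
    {lam : Module.Dual k H}
    (hlam : ∀ h, (sw (Q.frobeniusElement t) fun a b => lam (h * b) • a) = S h) :
    Q.leftCointegrals hS = Submodule.span k {lam} := by
  ext φ
  rw [mem_leftCointegrals_iff Q ht hS hμ hlam, Submodule.mem_span_singleton]
  constructor
  · intro h
    exact ⟨_, h.symm⟩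
  · rintro ⟨c, rfl⟩
    rw [LinearMap.smul_apply, frobeniusForm_antipodeInv Q ht ht0 hS hlam, smul_eq_mul, mul_one]

end Cointegral

/-! ### Characters and the comparison of the two Frobenius elements -/

/-- A bilinear map with `G(h₁a, h₂b) = χ(h)G(a, b)`. The example that matters is a bilinear map of
`Δ(t)(a ⊗ b)` for an integral `t`, with `χ` the modular function. -/
def IsSemiInvariant (χ : H →ₐ[k] k) (G : H → H → M) : Prop :=
  ∀ h a b, (sw (Δ h) fun h₁ h₂ => G (h₁ * a) (h₂ * b)) = χ h • G a b

section Character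

variable {χ χ' : H →ₐ[k] k} (hχ : ∀ h : H, χ (Q.antipode h) = χ' h)

include hχ

/-- `χ(h₁)χ(S(h₂)) = ε(h)`; the factor `χ(β)` cancels. -/
theorem sw_character_right (h : H) (m : M) :
    (sw (Δ h) fun a b => (χ a * χ' b) • m) = ε h • m := by
  have h0 : χ β ≠ 0 := fun h0 => by
    simpa [h0] using Q.character_alpha_beta χ
  have h1 := Q.sw_beta h fun x => (χ β)⁻¹ • χ x • m
  simp only [map_mul, hχ, smul_smul, inv_mul_cancel₀ h0, one_smul] at h1
  rw [← h1]
  refine sw_congr fun a b => ?_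
  congr 1
  field_simp

/-- `χ(S(h₁))χ(h₂) = ε(h)`; the factor `χ(α)` cancels. -/
theorem sw_character_left (h : H) (m : M) :
    (sw (Δ h) fun a b => (χ' a * χ b) • m) = ε h • m := by
  have h0 : χ α ≠ 0 := fun h0 => by
    simpa [h0] using Q.character_alpha_beta χ
  have h1 := Q.sw_alpha h fun x => (χ α)⁻¹ • χ x • m
  simp only [map_mul, hχ, smul_smul, inv_mul_cancel₀ h0, one_smul] at h1
  rw [← h1]
  refine sw_congr fun a b => ?_
  congr 1
  field_simp

end Character

section SemiInvariant

variable (hS : Function.Bijective Q.antipode) {χ : H →ₐ[k] k} {G : H → H → M} (hG : IsLin2 k G)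

local notation "S⁻" => Q.antipodeInv hS

include hG

/-- `G(p¹h, p²) = χ(h₁)G(p¹, p²S(h₂))` for `p_R = p¹ ⊗ p²`. -/
theorem IsSemiInvariant.sw_pR_mul (hχ : Q.IsSemiInvariant χ G) (h : H) :
    (sw3 Φi fun x y z => G (x * h) (y * β * S z)) =
      sw (Δ h) fun h₁ h₂ => χ h₁ • sw3 Φi fun x y z => G x (y * β * S z * S h₂) := by
  obtain ⟨l1, l2⟩ := id hG
  rw [Q.sw_pR_mul h G]
  refine sw_congr fun h₁ h₂ => ?_
  rw [sw_sw3, ← sw3_smul]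
  exact sw3_congr fun x y z => hχ h₁ x _

/-- `G(p¹, p²h) = χ(h₂)G(p¹S⁻¹(h₁), p²)` for `p_L = p¹ ⊗ p² = X²S⁻¹(X¹β) ⊗ X³`. -/
theorem IsSemiInvariant.sw_pL_mul (hχ : Q.IsSemiInvariant χ G) (h : H) :
    (sw3 Φ fun x y z => G (y * S⁻ (x * β)) (z * h)) =
      sw (Δ h) fun h₁ h₂ => χ h₂ • sw3 Φ fun x y z => G (y * S⁻ (x * β) * S⁻ h₁) z := by
  obtain ⟨l1, l2⟩ := id hG
  calc _ = sw (Δ h) fun a b => sw (Δ a) fun a₁ a₂ => sw3 Φ fun x y z =>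
        G (y * a₂ * S⁻ (x * a₁ * β)) (z * b) := by
        rw [← Q.sw_counit_left h fun h => sw3 Φ fun x y z => G (y * S⁻ (x * β)) (z * h)]
        refine sw_congr fun a b => ?_
        rw [sw_sw3, ← sw3_smul]
        refine sw3_congr fun x y z => ?_
        rw [antipodeInv_mul, ← Q.sw_beta a fun m => G (y * (S⁻ m * S⁻ x)) (z * b)]
        simp only [antipodeInv_mul, antipodeInv_antipode, mul_assoc]
    _ = sw (Δ h) fun a b => sw (Δ b) fun b₁ b₂ => sw3 Φ fun x y z =>
        G (b₁ * y * S⁻ (a * x * β)) (b₂ * z) :=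
        (Q.sw_coassoc h fun x y z => G (y * S⁻ (x * β)) z).symm
    _ = _ := by
        refine sw_congr fun a b => ?_
        rw [sw_sw3, ← sw3_smul]
        refine sw3_congr fun x y z => ?_
        rw [← hχ]
        simp only [antipodeInv_mul, mul_assoc]

/-- On an invariant bilinear map `p_R` and `p_L = X²S⁻¹(X¹β) ⊗ X³` agree. -/
theorem IsSemiInvariant.sw_pR_eq_sw_pL (hχ : Q.IsSemiInvariant ε G) :
    (sw3 Φi fun x y z => G x (y * β * S z)) = sw3 Φ fun x y z => G (y * S⁻ (x * β)) z := by
  obtain ⟨l1, l2⟩ := id hG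
  have hl : ∀ m n : H, IsLin2 k fun a b => G (a * m) (b * n) := fun m n =>
    ⟨by intros; fun_prop, by intros; fun_prop⟩
  have hi : ∀ m n : H, Q.IsSemiInvariant ε fun a b => G (a * m) (b * n) := by
    intro m n h a b
    simp only [mul_assoc]
    exact hχ h _ _
  -- Multiplication by `h` can be moved between the legs, both for `p_R` and for `p_L`; by the
  -- pentagon identity the two sides agree up to factors `β`, which are removed by inserting
  -- `X¹βS(X²)αX³ = 1`.
  have e1 : ∀ m n h : H, (sw3 Φi fun x y z => G (x * h * m) (y * β * S z * n)) =
      sw3 Φi fun x y z => G (x * m) (y * β * S z * S h * n) := by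
    intro m n h
    rw [IsSemiInvariant.sw_pR_mul Q (hl m n) (hi m n) h]
    exact Q.sw_counit_left h fun h => sw3 Φi fun x y z => G (x * m) (y * β * S z * S h * n)
  have e2 : ∀ m n h : H, (sw3 Φ fun x y z => G (y * S⁻ (x * β) * m) (z * h * n)) =
      sw3 Φ fun x y z => G (y * S⁻ (x * β) * S⁻ h * m) (z * n) := by
    intro m n h
    rw [IsSemiInvariant.sw_pL_mul Q hS (hl m n) (hi m n) h]
    exact Q.sw_counit_right h fun h => sw3 Φ fun x y z => G (y * S⁻ (x * β) * S⁻ h * m) (z * n)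
  have e3 : ∀ m n : H, (sw3 Φ fun x y z => G (y * S⁻ (x * β) * m) (z * β * n)) =
      sw3 Φi fun x y z => G (x * S⁻ β * m) (y * β * S z * n) := by
    intro m n
    have e := Q.absorb_emb₃_eq_emb₁_inv (fun a b c d => G (b * S⁻ (a * β) * m) (c * β * S d * n))
      (hθ := ⟨by intros; fun_prop, by intros; fun_prop, by intros; fun_prop, by intros; fun_prop⟩)
      (fun h a b c d => by
        rw [← hχ]
        simp only [mul_assoc])
      (fun h a b c d => by
        rw [← Q.sw_beta h fun r => G (b * S⁻ (a * β) * m) (c * r * S d * n)]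
        simp only [antipode_mul, mul_assoc])
      (fun h a b c d => by
        beta_reduce
        rw [antipodeInv_mul, ← Q.sw_beta h fun r => G (b * (S⁻ r * S⁻ a) * m) (c * β * S d * n)]
        simp only [antipodeInv_mul, antipodeInv_antipode, mul_assoc])
    simpa only [antipode_one, mul_one, one_mul] using e
  calc _ = sw3 Φ fun a b c => sw3 Φi fun x y z =>
        G (x * (S⁻ c * S⁻ α * b) * (S⁻ β * S⁻ a)) (y * β * S z * 1) := by
        have e := Q.sw_zigzag fun m => sw3 Φi fun x y z => G (x * S⁻ m) (y * β * S z)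
        rw [antipodeInv_one] at e
        simp only [mul_one] at e ⊢
        rw [← e]
        simp only [antipodeInv_mul, antipodeInv_antipode, mul_assoc]
    _ = sw3 Φ fun a b c => sw3 Φ fun x y z =>
        G (y * S⁻ (x * β)) (z * a * β * S b * α * c) := by
        refine sw3_congr fun a b c => ?_
        rw [e1]
        have e4 := e3 (S⁻ a) (S b * α * c)
        have e5 := e2 1 (β * S b * α * c) a
        simp only [antipode_mul, antipode_antipodeInv, mul_assoc, mul_one] at e4 e5 ⊢
        rw [← e4, e5]
    _ = _ := by
        rw [sw3_sw3]
        refine sw3_congr fun x y z => ?_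
        have e := Q.sw_zigzag fun m => G (y * S⁻ (x * β)) (z * m)
        rw [mul_one] at e
        rw [← e]
        simp only [mul_assoc]

end SemiInvariant

/-- `(id ⊗ ν)(p_R)`. -/
def characterPR (ν : H →ₐ[k] k) : H := sw3 Φi fun x y z => ν (y * β * S z) • x

/-- `(id ⊗ ν)(f p_R)`, where `f` is the Drinfeld twist. -/
def characterTwist (ν : H →ₐ[k] k) : H := sw Q.twist fun m n => ν n • (m * Q.characterPR ν)

section CharacterTwist

variable (hS : Function.Bijective Q.antipode) {μ ν : H →ₐ[k] k}
  (hν : ∀ h : H, ν (Q.antipode h) = μ h) {G : H → H → M} (hG : IsLin2 k G)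
  (hμ : Q.IsSemiInvariant μ G)

local notation "S⁻" => Q.antipodeInv hS

include hν

/-- `(id ⊗ ν)(f p_R)` with `f` written out; `ν ∘ S = μ`. -/
theorem characterTwist_eq : Q.characterTwist ν = sw3 Φi fun x y z => sw (Δ x) fun x₁ x₂ =>
    sw Q.gamma fun g g' => sw (Δ (y * β * S z)) fun e₁ e₂ =>
      (μ x₁ * ν (g' * e₂)) • (S x₂ * (g * (e₁ * Q.characterPR ν))) := by
  have h1 : IsLinearMap k fun v : H ⊗[k] H => sw v fun m n => ν n • (m * Q.characterPR ν) := by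
    fun_prop
  rw [characterTwist, twist_eq, h1.map_sw3]
  refine sw3_congr fun x y z => ?_
  rw [antipodeComulCop_eq, mul_assoc, sw_mul_right, h1.map_sw]
  refine sw_congr fun x₁ x₂ => ?_
  rw [sw_mul _ _ fun m n => ν n • (m * Q.characterPR ν),
    sw_tmul (S x₂) (S x₁) fun a b => sw (Q.gamma * Δ (y * β * S z)) fun m n =>
      ν (b * n) • (a * m * Q.characterPR ν),
    sw_mul _ _ fun m n => ν (S x₁ * n) • (S x₂ * m * Q.characterPR ν)]
  refine sw_congr fun g g' => sw_congr fun e₁ e₂ => ?_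
  rw [map_mul, hν]
  simp only [mul_assoc]

include hG hμ

/-- `ν(γ²)G(p¹, p²γ¹) = ν(α)ν(x³)G(x¹, x²)` for `p_R = p¹ ⊗ p²` and `γ = γ¹ ⊗ γ²`. -/
theorem IsSemiInvariant.sw_gamma :
    (sw Q.gamma fun g g' => ν g' • sw3 Φi fun x y z => G x (y * β * S z * g)) =
      ν α • sw3 Φi fun x y z => ν z • G x y := by
  obtain ⟨l1, l2⟩ := id hG
  have e1 := Q.absorb_emb₄_inv_mul_emb₁ (fun a b c d => sw3 Φi fun x y z => sw (Δ d) fun d₁ d₂ =>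
      (ν α * ν (z * d₂)) • G a (b * β * S (x * c) * α * (y * d₁)))
    (hθ := ⟨by intros; fun_prop, by intros; fun_prop, by intros; fun_prop, by intros; fun_prop⟩)
    (fun h a b c d => by
      rw [← Q.sw_beta h fun m => sw3 Φi fun x y z => sw (Δ d) fun d₁ d₂ =>
        (ν α * ν (z * d₂)) • G a (b * m * S (x * c) * α * (y * d₁))]
      simp only [antipode_mul, mul_assoc])
  calc _ = sw3 Φ fun u v w => sw (Δ u) fun u₁ u₂ => sw3 Φi fun a b c => sw3 Φi fun x y z =>
        sw (Δ w) fun w₁ w₂ =>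
        (ν α * ν (z * w₂)) • G (u₁ * a) (u₂ * b * β * S (x * (v * c)) * α * (y * w₁)) := by
        have h1 : IsLinearMap k fun t : H ⊗[k] H => sw t fun g g' =>
          ν g' • sw3 Φi fun x y z => G x (y * β * S z * g) := by fun_prop
        rw [gamma_eq, h1.map_sw3, sw3_congr fun x y z => h1.map_sw3 _ _, sw3_sw3 Φi Φ]
        refine sw3_congr fun u v w => ?_
        rw [sw_sw3, sw3_congr fun a b c => sw_sw3 _ _ _, sw3_sw3 Φi Φi]
        refine sw3_congr fun x y z => ?_
        rw [h1.map_sw, sw3_congr fun a b c => sw_sw _ _ _, sw3_sw]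
        refine sw_congr fun w₁ w₂ => ?_
        rw [sw_tmul _ _ fun g g' => ν g' • sw3 Φi fun x y z => G x (y * β * S z * g), ← sw3_smul]
        refine sw3_congr fun a b c => ?_
        simp only [map_mul, hν]
        have e := hμ u a (b * β * S (x * (v * c)) * α * (y * w₁))
        rw [sw_smul, mul_assoc (μ u), mul_comm (μ u), mul_smul]
        simp only [antipode_mul, mul_assoc] at e ⊢
        rw [e]
    _ = sw3 Φi fun a b c => sw (Δ c) fun c₁ c₂ => sw3 Φ fun u v w => sw3 Φi fun x y z =>
        sw (Δ (c₂ * w)) fun w₁ w₂ =>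
        (ν α * ν (z * w₂)) • G a (b * u * β * S (x * (c₁ * v)) * α * (y * w₁)) := e1.symm
    _ = sw3 Φi fun a b c => sw3 Φ fun u v w => sw (Δ w) fun w₁ w₂ => sw3 Φi fun x y z =>
        (ν α * ν (c * z * w₂)) • G a (b * (u * (β * (S v * (S x * α * y * w₁))))) := by
        refine sw3_congr fun a b c => ?_
        rw [sw_sw3]
        refine sw3_congr fun u v w => ?_
        rw [sw_congr fun w₁ w₂ => (Q.sw_qL_mul c fun p q =>
          (ν α * ν (q * w₂)) • G a (b * (u * (β * (S v * (p * w₁)))))).symm, sw_sw]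
        refine sw_congr fun c₁ c₂ => ?_
        rw [sw3_congr fun x y z => Q.sw_comul_mul c₂ w fun w₁ w₂ =>
          (ν α * ν (z * w₂)) • G a (b * u * β * S (x * (c₁ * v)) * α * (y * w₁)), sw3_sw, sw_sw]
        refine sw_congr fun d₁ d₂ => ?_
        rw [sw3_sw]
        simp only [antipode_mul, mul_assoc]
    _ = _ := by
        rw [← sw3_smul]
        refine sw3_congr fun a b c => ?_
        have e := Q.sw_zigzag_comul fun p q => (ν α * ν (c * q)) • G a (b * p)
        rw [mul_one, mul_one, mul_smul] at e
        rw [← e, sw3_sw3]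
        refine sw3_congr fun u v w => ?_
        rw [sw3_sw]
        simp only [antipode_mul, mul_assoc]

end CharacterTwist

section Comparison

variable (hS : Function.Bijective Q.antipode) {μ ν : H →ₐ[k] k}
  (hν : ∀ h : H, ν (Q.antipode h) = μ h) {G : H → H → M} (hG : IsLin2 k G)
  (hμ : Q.IsSemiInvariant μ G)

local notation "S⁻" => Q.antipodeInv hS

include hν hG hμ

/-- Twisting by `ν` turns a `μ`-semi-invariant bilinear map into an invariant one. -/
theorem IsSemiInvariant.invariant (P : H) : Q.IsSemiInvariant ε fun a b =>
    sw (Δ b) fun b₁ b₂ => sw3 Φi fun x y z => (ν z * ν b₂) • G (x * a) (y * (b₁ * P)) := by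
  obtain ⟨l1, l2⟩ := id hG
  intro h a b
  calc _ = sw (Δ b) fun b₁ b₂ => sw (Δ h) fun h₁ h₂ => sw (Δ h₂) fun p q => sw3 Φi fun x y z =>
        (ν (z * q) * ν b₂) • G (x * h₁ * a) (y * p * (b₁ * P)) := by
        rw [sw_sw (Δ b)]
        refine sw_congr fun h₁ h₂ => ?_
        beta_reduce
        rw [Q.sw_comul_mul h₂ b fun b₁ b₂ => sw3 Φi fun x y z =>
          (ν z * ν b₂) • G (x * (h₁ * a)) (y * (b₁ * P)), sw_sw]
        refine sw_congr fun b₁ b₂ => sw_congr fun p q => sw3_congr fun x y z => ?_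
        simp only [mul_assoc, map_mul]
    _ = sw (Δ b) fun b₁ b₂ => sw (Δ h) fun h₁ h₂ => sw (Δ h₁) fun p q => sw3 Φi fun x y z =>
        (ν (h₂ * z) * ν b₂) • G (p * x * a) (q * y * (b₁ * P)) :=
        sw_congr fun b₁ b₂ => Q.sw_coassoc_inv h fun x y z =>
          (ν z * ν b₂) • G (x * a) (y * (b₁ * P))
    _ = _ := by
        rw [← sw_smul]
        refine sw_congr fun b₁ b₂ => ?_
        rw [← Q.sw_character_left hν]
        refine sw_congr fun h₁ h₂ => ?_
        rw [sw_sw3, ← sw3_smul]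
        refine sw3_congr fun x y z => ?_
        rw [sw_smul, smul_smul]
        simp only [mul_assoc]
        rw [hμ h₁, smul_smul, map_mul]
        congr 1
        ring

/-- The factor `(S ⊗ S)(Δ^cop(x¹))` of the twist is absorbed by `p_R` and `G`, and `γ` is evaluated
by `IsSemiInvariant.sw_gamma`; there remains `p_R` in an invariant bilinear map. -/
theorem IsSemiInvariant.sw_pR_mul_characterTwist_eq :
    (sw3 Φi fun x y z => G x (y * β * S z * Q.characterTwist ν)) =
      ν α • sw3 Φi fun x y z => sw (Δ (y * β * S z)) fun b₁ b₂ => sw3 Φi fun p q r =>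
        (ν r * ν b₂) • G (p * x) (q * (b₁ * Q.characterPR ν)) := by
  obtain ⟨l1, l2⟩ := id hG
  set P := Q.characterPR ν with hP
  have h1 : ∀ a b, IsLinearMap k fun w => G a (b * w) := by intros; fun_prop
  calc _ = sw3 Φi fun x y z => sw (Δ (y * β * S z)) fun e₁ e₂ => sw Q.gamma fun g g' =>
        (ν g' * ν e₂) • sw (Δ x) fun x₁ x₂ => μ x₁ • sw3 Φi fun p q r =>
          G p (q * β * S r * S x₂ * (g * (e₁ * P))) := by
        rw [characterTwist_eq Q hν]
        rw [sw3_congr fun p q r => (h1 _ _).map_sw3 _ _, sw3_sw3 Φi Φi]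
        refine sw3_congr fun x y z => ?_
        rw [sw_sw (Δ (y * β * S z))]
        simp only [(h1 _ _).map_sw, (h1 _ _).map_smul]
        rw [sw3_sw, sw_congr fun x₁ x₂ => (sw3_sw _ _ _).trans (sw_congr fun g g' => sw3_sw _ _ _),
          sw_sw]
        refine sw_congr fun g g' => ?_
        rw [sw_sw]
        refine sw_congr fun e₁ e₂ => ?_
        rw [← sw_smul]
        refine sw_congr fun x₁ x₂ => ?_
        rw [sw3_smul, smul_smul, map_mul, mul_comm (μ x₁)]
        simp only [mul_assoc, hP]
    _ = sw3 Φi fun x y z => sw (Δ (y * β * S z)) fun e₁ e₂ => ν e₂ • sw Q.gamma fun g g' =>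
        ν g' • sw3 Φi fun p q r => G (p * x) (q * β * S r * g * (e₁ * P)) := by
        refine sw3_congr fun x y z => sw_congr fun e₁ e₂ => ?_
        rw [← sw_smul]
        refine sw_congr fun g g' => ?_
        rw [mul_comm, mul_smul]
        simp only [mul_assoc]
        have e := IsSemiInvariant.sw_pR_mul Q (G := fun a b => G a (b * (g * (e₁ * P))))
          ⟨by intros; fun_prop, by intros; fun_prop⟩ (χ := μ)
          (fun h a b => by simp only [mul_assoc]; exact hμ h _ _) x
        simp only [mul_assoc] at e
        rw [e]
    _ = _ := by
        rw [← sw3_smul]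
        refine sw3_congr fun x y z => ?_
        rw [← sw_smul]
        refine sw_congr fun e₁ e₂ => ?_
        have e := IsSemiInvariant.sw_gamma Q hν (G := fun a b => G (a * x) (b * (e₁ * P)))
          ⟨by intros; fun_prop, by intros; fun_prop⟩
          (fun h a b => by simp only [mul_assoc]; exact hμ h _ _)
        rw [e, smul_comm, ← sw3_smul]
        congr 1
        refine sw3_congr fun p q r => ?_
        rw [smul_smul, mul_comm]

/-- On a `μ`-semi-invariant bilinear map, `p_R` followed by right multiplication of the second leg
by `(id ⊗ ν)(f p_R)` agrees with `p_L`. -/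
theorem IsSemiInvariant.sw_pR_mul_characterTwist :
    (sw3 Φi fun x y z => G x (y * β * S z * Q.characterTwist ν)) =
      sw3 Φ fun x y z => G (y * S⁻ (x * β)) z := by
  obtain ⟨l1, l2⟩ := id hG
  set P := Q.characterPR ν with hP
  -- In the invariant map obtained from `G`, `p_R` may be replaced by `p_L`.
  have e1 : (sw3 Φi fun x y z => sw (Δ (y * β * S z)) fun b₁ b₂ => sw3 Φi fun p q r =>
        (ν r * ν b₂) • G (p * x) (q * (b₁ * P))) =
      sw3 Φ fun x y z => sw (Δ z) fun b₁ b₂ => sw3 Φi fun p q r =>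
        (ν r * ν b₂) • G (p * (y * S⁻ (x * β))) (q * (b₁ * P)) :=
    IsSemiInvariant.sw_pR_eq_sw_pL Q hS ⟨by intros; fun_prop, by intros; fun_prop⟩
      (IsSemiInvariant.invariant Q hν hG hμ P)
  -- The pentagon identity turns the reassociators into `p_L` and characters of a copy of `Φ`.
  have e2 : (sw3 Φ fun x y z => sw (Δ z) fun b₁ b₂ => sw3 Φi fun p q r =>
        (ν r * ν b₂) • G (p * (y * S⁻ (x * β))) (q * (b₁ * P))) =
      sw3 Φ fun a b c => (μ b * ν c) • sw3 Φ fun x y z =>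
        G (y * S⁻ (x * β) * S⁻ a) (z * P) := by
    have e := Q.absorb_emb₂_mul_emb₃ (fun p q r s => ν s • G (q * S⁻ (p * β)) (r * P))
      (hθ := ⟨by intros; fun_prop, by intros; fun_prop, by intros; fun_prop, by intros; fun_prop⟩)
      (fun h a b c d => by
        beta_reduce
        rw [antipodeInv_mul, ← Q.sw_beta h fun m => ν d • G (b * (S⁻ m * S⁻ a)) (c * P)]
        simp only [antipodeInv_mul, antipodeInv_antipode, mul_assoc])
    refine Eq.trans ?_ (e.symm.trans ?_)
    · rw [sw3_sw3 Φi Φ]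
      refine sw3_congr fun x y z => ?_
      rw [sw3_sw]
      refine sw_congr fun b₁ b₂ => sw3_congr fun p q r => ?_
      simp only [map_mul, mul_assoc]
    · refine sw3_congr fun a b c => ?_
      rw [sw_sw3, ← sw3_smul]
      refine sw3_congr fun x y z => ?_
      rw [sw_smul, mul_comm, mul_smul, ← hμ]
      simp only [antipodeInv_mul, mul_assoc]
  -- The element `P = (id ⊗ ν)(p_R)` is moved to the first leg.
  have e3 : ∀ a : H, (sw3 Φ fun x y z => G (y * S⁻ (x * β) * S⁻ a) (z * P)) =
      sw3 Φi fun p q r => sw (Δ p) fun p₁ p₂ => (ν β * ν q * μ r * μ p₂) • sw3 Φ fun x y z =>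
        G (y * S⁻ (x * β) * S⁻ (a * p₁)) z := by
    intro a
    have h1 : IsLinearMap k fun P => sw3 Φ fun x y z =>
      G (y * S⁻ (x * β) * S⁻ a) (z * P) := by fun_prop
    rw [hP, characterPR, h1.map_sw3]
    refine sw3_congr fun p q r => ?_
    rw [h1.map_smul]
    have e := IsSemiInvariant.sw_pL_mul Q hS (G := fun u v => G (u * S⁻ a) v)
          ⟨by intros; fun_prop, by intros; fun_prop⟩ (χ := μ)
          (fun h a b => by simp only [mul_assoc]; exact hμ h _ _) p
    rw [e, ← sw_smul]
    refine sw_congr fun p₁ p₂ => ?_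
    rw [smul_smul, map_mul, map_mul, hν, mul_comm (ν q)]
    simp only [antipodeInv_mul, mul_assoc]
  -- The remaining scalars, functions of `Φ` and `Φ⁻¹`, cancel by the pentagon identity and
  -- `S(x¹)αx²βS(x³) = 1`.
  have e4 := Q.absorb_emb₁_inv (fun p q r s => (ν α * ν β * μ s) • (μ q * ν r) •
      sw3 Φ fun x y z => G (y * S⁻ (x * β) * S⁻ p) z)
    (hθ := ⟨by intros; fun_prop, by intros; fun_prop, by intros; fun_prop, by intros; fun_prop⟩)
    (fun h a b c d => by
      rw [← Q.sw_character_left hν]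
      refine sw_congr fun h₁ h₂ => ?_
      simp only [map_mul, smul_smul]
      congr 1
      ring)
    (fun h a b c d => by
      rw [← Q.sw_character_right hν]
      refine sw_congr fun h₁ h₂ => ?_
      simp only [map_mul, smul_smul]
      congr 1
      ring)
  rw [IsSemiInvariant.sw_pR_mul_characterTwist_eq Q hν hG hμ, e1, e2]
  have e5 := Q.sw_zigzag_inv fun m => ν m • sw3 Φ fun x y z => G (y * S⁻ (x * β)) z
  rw [map_one, one_smul] at e5
  rw [← e5, ← sw3_smul]
  refine Eq.trans ?_ (e4.symm.trans ?_)
  · refine sw3_congr fun a b c => ?_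
    rw [e3, ← sw3_smul, ← sw3_smul]
    refine sw3_congr fun p q r => ?_
    rw [← sw_smul, ← sw_smul]
    refine sw_congr fun p₁ p₂ => ?_
    simp only [map_mul, smul_smul]
    congr 1
    ring
  · refine sw3_congr fun a b c => ?_
    simp only [map_mul, smul_smul, antipodeInv_one, mul_one, hν]
    congr 1
    ring

end Comparison

/-! ### Right cointegrals -/

section Nondegenerate

variable {t : H} {lam : Module.Dual k H}
  (hlam : ∀ h : H, (sw (Q.frobeniusElement t) fun a b => lam (h * b) • a) = Q.antipode h)

include hlam

/-- The form dual to the Frobenius element is non-degenerate on the right as well. -/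
theorem eq_zero_of_frobeniusForm {y : H} (hy : ∀ h, lam (h * y) = 0) : y = 0 := by
  -- `h ↦ λ(h ·)` is injective, hence onto the dual of `H`.
  have h1 : Function.Injective ((LinearMap.mul k H).compr₂ lam) := by
    rw [injective_iff_map_eq_zero]
    intro h hh
    have e : ∀ b, lam (h * b) = 0 := fun b => LinearMap.congr_fun hh b
    refine Q.antipode_bijective.1 ?_
    rw [← hlam h, map_zero]
    exact sw_eq_zero_of (k := k) fun a b => by rw [e, zero_smul]
  have h2 := (LinearMap.injective_iff_surjective_of_finrank_eq_finrank
    (Subspace.dual_finrank_eq (K := k) (V := H)).symm).1 h1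
  refine (Module.forall_dual_apply_eq_zero_iff k y).1 fun ψ => ?_
  obtain ⟨h, rfl⟩ := h2 ψ
  exact hy h

end Nondegenerate

section Cop

variable (hS : Function.Bijective Q.antipode)

local notation "S⁻" => Q.antipodeInv hS

theorem sw_cop_comul (h : H) (F : H → H → M)
    (hF : IsLin2 k F := by refine ⟨?_, ?_⟩ <;> intros <;> fun_prop) :
    sw ((Q.cop hS).comul h) F = sw (Δ h) fun a b => F b a :=
  sw_tensorComm (Δ h) F hF

theorem sw3_tensorReverse (z : H ⊗[k] (H ⊗[k] H)) (F : H → H → H → M)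
    (hF : IsLin3 k F := by refine ⟨?_, ?_, ?_⟩ <;> intros <;> fun_prop) :
    sw3 (tensorReverse k H z) F = sw3 z fun a b c => F c b a := by
  obtain ⟨l1, l2, l3⟩ := id hF
  refine ext_tensor3 (f := fun z => sw3 (tensorReverse k H z) F) (g := fun z => sw3 z _) z
    (fun a b c => ?_) (isLinearMap_sw3_tensor (by fun_prop) l1)
    (isLinearMap_sw3_tensor (by fun_prop) fun b c => l3 c b)
  rw [tensorReverse_tmul, sw3_tmul _ _ _ F hF, sw3_tmul a b c fun a b c => F c b a]

theorem sw_cop_reassocInv (F : H → H → H → M)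
    (hF : IsLin3 k F := by refine ⟨?_, ?_, ?_⟩ <;> intros <;> fun_prop) :
    sw3 (Q.cop hS).reassocInv F = sw3 Φ fun a b c => F c b a := by
  have h : (Q.cop hS).reassocInv = tensorReverse k H Φ := by
    rw [reassocInv, cop, ← map_inv, inv_inv]
    rfl
  rw [h, sw3_tensorReverse _ F hF]

/-- The Frobenius element of `H^cop` in terms of `H`; `t` is an integral of both. -/
theorem sw_cop_frobeniusElement (t : H) (F : H → H → M)
    (hF : IsLin2 k F := by refine ⟨?_, ?_⟩ <;> intros <;> fun_prop) :
    sw ((Q.cop hS).frobeniusElement t) F = sw (Δ t) fun t₁ t₂ => sw3 Φ fun a b c =>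
      sw3 Φ fun p q r => F (S⁻ c * S⁻ α * b * (t₂ * r)) (a * (t₁ * (q * S⁻ β * S⁻ p))) := by
  obtain ⟨l1, l2⟩ := id hF
  refine ((Q.cop hS).sw_frobeniusElement t F).trans ((Q.sw_cop_comul hS t fun t₁ t₂ =>
    sw3 (Q.cop hS).reassocInv fun x y z => sw3 (Q.cop hS).reassocInv fun p q r =>
      F (S⁻ x * S⁻ α * y * (t₁ * p)) (z * (t₂ * (q * S⁻ β * S⁻ r)))).trans ?_)
  refine sw_congr fun t₁ t₂ => ?_
  rw [Q.sw_cop_reassocInv hS fun x y z => sw3 (Q.cop hS).reassocInv fun p q r =>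
      F (S⁻ x * S⁻ α * y * (t₂ * p)) (z * (t₁ * (q * S⁻ β * S⁻ r)))]
  refine sw3_congr fun a b c => ?_
  rw [Q.sw_cop_reassocInv hS fun p q r =>
      F (S⁻ c * S⁻ α * b * (t₂ * p)) (a * (t₁ * (q * S⁻ β * S⁻ r)))]

variable {t : H} (ht : t ∈ Q.leftIntegrals) {μ : H →ₐ[k] k} (hμ : ∀ h, t * h = μ h • t) {w : H}
  (hw : ∀ G : H → H → M, IsLin2 k G → Q.IsSemiInvariant μ G →
    (sw3 Q.reassocInv fun x y z => G x (y * Q.beta * Q.antipode z * w)) =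
      sw3 (Q.reassoc : H ⊗[k] (H ⊗[k] H)) fun x y z => G (y * Q.antipodeInv hS (x * Q.beta)) z)

include ht hμ hw

/-- The Frobenius elements of `H` and of `H^cop` differ by `w`, if `w` intertwines `p_R` and `p_L`
on semi-invariant bilinear maps. -/
theorem sw_cop_frobeniusElement_eq (F : H → H → M)
    (hF : IsLin2 k F := by refine ⟨?_, ?_⟩ <;> intros <;> fun_prop) :
    (sw ((Q.cop hS).frobeniusElement t) fun b a => F a b) =
      sw (Q.frobeniusElement t) fun a b => F a (b * w) := by
  obtain ⟨l1, l2⟩ := id hF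
  calc _ = sw (Δ t) fun t₁ t₂ => sw3 Φ fun a b c => sw3 Φ fun p q r =>
        F (a * t₁ * (q * S⁻ (p * β))) (S⁻ (S (b * t₂) * α * c) * r) := by
        rw [Q.sw_cop_frobeniusElement hS t fun b a => F a b]
        simp only [antipodeInv_mul, antipodeInv_antipode, mul_assoc]
    _ = sw3 Φ fun p q r => sw (Δ t) fun t₁ t₂ => sw3 Φi fun x y z =>
        F (S x * α * y * t₁ * (q * S⁻ (p * β))) (z * t₂ * r) := by
        rw [sw_congr fun t₁ t₂ => sw3_sw3 _ _ _, sw_sw3]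
        refine sw3_congr fun p q r => ?_
        rw [← Q.sw_qL_integral ht fun u v => F (u * (q * S⁻ (p * β))) (S⁻ v * r)]
        simp only [antipodeInv_antipode]
    _ = sw3 Φi fun x y z => sw3 Φ fun p q r => sw (Δ t) fun t₁ t₂ =>
        F (S x * α * y * (t₁ * (q * S⁻ (p * β)))) (z * (t₂ * r)) := by
        rw [sw3_congr fun p q r => sw_sw3 _ _ _, sw3_sw3]
        simp only [mul_assoc]
    _ = sw3 Φi fun x y z => sw3 Φi fun p q r => sw (Δ t) fun t₁ t₂ =>
        F (S x * α * y * (t₁ * p)) (z * (t₂ * (q * β * S r * w))) := by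
        refine sw3_congr fun x y z => ?_
        refine (hw (fun a b => sw (Δ t) fun t₁ t₂ => F (S x * α * y * (t₁ * a)) (z * (t₂ * b)))
          ⟨by intros; fun_prop, by intros; fun_prop⟩ fun h a b => ?_).symm
        rw [← Q.sw_integral_mul_right hμ h fun t₁ t₂ =>
          F (S x * α * y * (t₁ * a)) (z * (t₂ * b)), sw_sw]
        simp only [mul_assoc]
    _ = _ := by
        rw [Q.sw_frobeniusElement t fun a b => F a (b * w), sw_sw3]
        refine sw3_congr fun x y z => ?_
        rw [sw_sw3]
        simp only [mul_assoc]

end Cop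

section Compare

variable (hS : Function.Bijective Q.antipode) {t : H} (ht : t ∈ Q.leftIntegrals) (ht0 : t ≠ 0)
  {μ : H →ₐ[k] k} (hμ : ∀ h, t * h = μ h • t) {w : H}
  (hw : ∀ G : H → H → H, IsLin2 k G → Q.IsSemiInvariant μ G →
    (sw3 Q.reassocInv fun x y z => G x (y * Q.beta * Q.antipode z * w)) =
      sw3 (Q.reassoc : H ⊗[k] (H ⊗[k] H)) fun x y z => G (y * Q.antipodeInv hS (x * Q.beta)) z)
  {lam Lam : Module.Dual k H}
  (hlam : ∀ h : H, (sw (Q.frobeniusElement t) fun a b => lam (h * b) • a) = Q.antipode h)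
  (hLam : ∀ h : H, (sw ((Q.cop hS).frobeniusElement t) fun a b => Lam (h * b) • a) =
    Q.antipodeInv hS h)

include hLam in
/-- For the Frobenius element `Γ` of `H^cop` and its dual form `Λ`, also `Λ(S(Γ¹)h)Γ² = h`. -/
theorem sw_cop_frobeniusElement_antipode (h : H) :
    (sw ((Q.cop hS).frobeniusElement t) fun b a => Lam (S b * h) • a) = h := by
  rw [← sub_eq_zero]
  refine (Q.cop hS).eq_zero_of_frobeniusForm hLam fun g => ?_
  have e := congrArg (fun x => Lam (S x * h)) (hLam g)
  rw [antipode_antipodeInv] at e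
  rw [mul_sub, map_sub, ← e, map_sw, sw_mul_right, map_sw, mul_sw, map_sw, sub_eq_zero]
  refine sw_congr fun b a => ?_
  rw [mul_smul_comm, map_smul, map_smul, smul_mul_assoc, map_smul, smul_eq_mul, smul_eq_mul,
    mul_comm]

include ht ht0 hμ hw hlam hLam

/-- The two dual forms, composed with `S⁻¹`, differ by `S(w)`. -/
theorem frobeniusForm_comp_antipodeInv :
    lam ∘ₗ Q.antipodeInv hS = dualHitRight Lam (S w) := by
  -- Both functionals are mapped to `1` by `integralMap t`.
  refine Q.integralMap_injective ht ht0 ?_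
  rw [integralMap_eq_sw Q ht, integralMap_eq_sw Q ht]
  have e1 := hlam 1
  have e2 := Q.sw_cop_frobeniusElement_antipode hS hLam 1
  simp only [mul_one] at e2
  rw [sw_cop_frobeniusElement_eq Q hS ht hμ hw fun a b => Lam (S b) • a] at e2
  simp only [one_mul, antipode_one] at e1
  refine Eq.trans (sw_congr fun a b => ?_) (e1.trans (e2.symm.trans (sw_congr fun a b => ?_)))
  · rw [LinearMap.comp_apply, antipodeInv_antipode]
  · rw [antipode_mul]
    rfl

/-- By the previous lemma `S(w)y = 0` implies `λ(hS⁻¹(y)) = 0` for all `h`, so `y = 0`. -/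
theorem isUnit_antipode_of_intertwining : IsUnit (S w) := by
  have h1 : ∀ y, S w * y = 0 → y = 0 := by
    intro y hy
    refine (Q.antipodeInv_bijective hS).1 ?_
    rw [map_zero]
    refine Q.eq_zero_of_frobeniusForm hlam fun h => ?_
    have e := LinearMap.congr_fun (Q.frobeniusForm_comp_antipodeInv hS ht ht0 hμ hw hlam hLam)
      (y * S h)
    rw [LinearMap.comp_apply, antipodeInv_mul, antipodeInv_antipode] at e
    rw [e]
    change Lam (S w * (y * S h)) = 0
    rw [← mul_assoc, hy, zero_mul, map_zero]
  have h2 : Function.Injective (LinearMap.mulLeft k (S w)) := by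
    rw [injective_iff_map_eq_zero]
    exact h1
  obtain ⟨v, hv⟩ := LinearMap.injective_iff_surjective.1 h2 1
  have hv : S w * v = 1 := hv
  have hv' : v * S w = 1 := by
    rw [← sub_eq_zero]
    refine h1 _ ?_
    rw [mul_sub, ← mul_assoc, hv, one_mul, mul_one, sub_self]
  exact ⟨⟨S w, v, hv, hv'⟩, rfl⟩

end Compare

/-- The character `μ ∘ S⁻¹`. -/
def characterAntipodeInv (hS : Function.Bijective Q.antipode) (μ : H →ₐ[k] k) : H →ₐ[k] k :=
  AlgHom.ofLinearMap (μ.toLinearMap ∘ₗ Q.antipodeInv hS)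
    (by simp [antipodeInv_one]) (by intro a b; simp [antipodeInv_mul, mul_comm])

/-- The element that intertwines `p_R` and `p_L` is `S⁻¹(u)`. -/
theorem antipode_characterTwist (hS : Function.Bijective Q.antipode) (μ : H →ₐ[k] k) :
    S (Q.characterTwist (Q.characterAntipodeInv hS μ)) = Q.elemu hS μ := by
  have h1 : IsLinearMap k fun z : H ⊗[k] H => TensorProduct.lid k H
    (TensorProduct.map μ.toLinearMap (Q.antipode ∘ₗ Q.antipode) z) := by fun_prop
  have e := h1.map_sw (Q.elemV hS) fun p q => p ⊗ₜ[k] q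
  rw [sw_self] at e
  have e' : Q.elemu hS μ = sw (Q.elemV hS) fun p q => μ p • S (S q) := by
    refine e.trans (sw_congr fun p q => ?_)
    simp
  rw [e', Q.sw_elemV hS fun p q => μ p • S (S q), characterTwist, map_sw]
  refine sw_congr fun a b => ?_
  rw [map_smul, characterPR, mul_sw3, map_sw3, ← sw3_smul]
  refine sw3_congr fun x y z => ?_
  rw [mul_smul_comm, map_smul, smul_smul, ← map_mul, antipode_antipodeInv]
  rfl

end QuasiHopf

end QuasiHopfAlgebra

end

theorem mainTheorem9 {k : Type*} {H : Type*} [Field k] [Ring H] [Algebra k H]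
    [FiniteDimensional k H] (Q : QuasiHopfAlgebra k H) :
    ∃ hS : Function.Bijective Q.antipode,
      Module.finrank k Q.leftIntegrals = 1 ∧
      ∃ μ : H →ₐ[k] k, (∀ t ∈ Q.leftIntegrals, ∀ h : H, t * h = μ h • t) ∧
        ∃ u : Hˣ, (u : H) = Q.elemu hS μ ∧
          (∀ t ∈ Q.leftIntegrals, t ≠ 0 →
            ∀ lam ∈ Q.leftCointegrals hS, ∀ Lam ∈ Q.rightCointegrals hS,
              lam (Q.antipodeInv hS t) = 1 → Lam (Q.antipode t) = 1 →
                lam ∘ₗ Q.antipodeInv hS = QuasiHopfAlgebra.dualHitRight Lam (u : H)) ∧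
          Set.BijOn
            (fun lam : Module.Dual k H =>
              QuasiHopfAlgebra.dualHitRight (lam ∘ₗ Q.antipodeInv hS) ((u⁻¹ : Hˣ) : H))
            (Q.leftCointegrals hS : Set (Module.Dual k H))
            (Q.rightCointegrals hS : Set (Module.Dual k H)) ∧
          (Q.IsUnimodular →
            (Q.leftCointegrals hS).map (Q.antipodeInv hS).dualMap = Q.rightCointegrals hS) := by
  obtain ⟨t, ht, ht0⟩ := Q.exists_leftIntegral_ne_zero
  obtain ⟨μ, hμ⟩ := Q.exists_modularFunction
  have hS := Q.antipode_bijective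
  have hS' := Q.antipodeInv_bijective hS
  obtain ⟨lam, hlam⟩ := Q.exists_frobeniusForm ht ht0
  obtain ⟨Lam, hLam⟩ := (Q.cop hS).exists_frobeniusForm (t := t) ht ht0
  -- An integral of `H` is one of `H^cop`, so the description of left cointegrals applies to both.
  have hL := Q.leftCointegrals_eq_span ht hS ht0 (hμ t ht) hlam
  have hR : Q.rightCointegrals hS = Submodule.span k {Lam} :=
    (Q.cop hS).leftCointegrals_eq_span (t := t) ht hS' ht0 (hμ t ht) hLam
  have hlam1 : lam (Q.antipodeInv hS t) = 1 := Q.frobeniusForm_antipodeInv ht ht0 hS hlam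
  have hLam1 : Lam (Q.antipode t) = 1 := by
    have e := (Q.cop hS).frobeniusForm_antipodeInv (t := t) ht ht0 hS' hLam
    have e' : (Q.cop hS).antipodeInv hS' t = Q.antipode t := by
      apply hS'.1
      rw [Q.antipodeInv_antipode]
      exact (Q.cop hS).antipode_antipodeInv hS' t
    rwa [e'] at e
  have hν : ∀ h : H, Q.characterAntipodeInv hS μ (Q.antipode h) = μ h := fun h =>
    congrArg μ (Q.antipodeInv_antipode hS h)
  have hw := fun (G : H → H → H) hG hGμ =>
    QuasiHopfAlgebra.IsSemiInvariant.sw_pR_mul_characterTwist Q hS hν (G := G) hG hGμ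
  have hu := Q.isUnit_antipode_of_intertwining hS ht ht0 (hμ t ht) hw hlam hLam
  have key := Q.frobeniusForm_comp_antipodeInv hS ht ht0 (hμ t ht) hw hlam hLam
  rw [Q.antipode_characterTwist hS μ] at hu key
  obtain ⟨u, hu⟩ := hu
  rw [← hu] at key
  have key' : QuasiHopfAlgebra.dualHitRight (lam ∘ₗ Q.antipodeInv hS) ((u⁻¹ : Hˣ) : H) = Lam := by
    rw [key, QuasiHopfAlgebra.dualHitRight_mul, Units.mul_inv, QuasiHopfAlgebra.dualHitRight_one]
  have hLam0 : Lam ≠ 0 := by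
    rintro rfl
    simp at hLam1
  have hsmul : ∀ c : k, QuasiHopfAlgebra.dualHitRight ((c • lam) ∘ₗ Q.antipodeInv hS)
      ((u⁻¹ : Hˣ) : H) = c • Lam := by
    intro c
    rw [← key']
    rfl
  -- All assertions now concern multiples of `λ` and of `Λ`, with `λ ∘ S⁻¹ = Λ ↼ u`.
  refine ⟨hS, Q.finrank_leftIntegrals, μ, hμ, u, hu, ?_, ⟨?_, ?_, ?_⟩, ?_⟩
  · intro t' ht' ht'0 lam' hlam' Lam' hLam' h1 h2
    obtain ⟨c, rfl⟩ := Q.leftIntegral_eq_smul ht ht0 ht'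
    rw [hL, Submodule.mem_span_singleton] at hlam'
    rw [hR, Submodule.mem_span_singleton] at hLam'
    obtain ⟨a, rfl⟩ := hlam'
    obtain ⟨b, rfl⟩ := hLam'
    rw [map_smul, map_smul, LinearMap.smul_apply, hlam1, smul_eq_mul, smul_eq_mul, mul_one] at h1
    rw [map_smul, map_smul, LinearMap.smul_apply, hLam1, smul_eq_mul, smul_eq_mul, mul_one] at h2
    have hab : a = b := mul_left_cancel₀ (left_ne_zero_of_mul_eq_one h1) (h1.trans h2.symm)
    rw [hab, LinearMap.smul_comp, key]
    rfl
  · intro lam' hlam'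
    rw [SetLike.mem_coe, hL, Submodule.mem_span_singleton] at hlam'
    obtain ⟨c, rfl⟩ := hlam'
    rw [SetLike.mem_coe, hR, Submodule.mem_span_singleton]
    exact ⟨c, (hsmul c).symm⟩
  · intro lam₁ hlam₁ lam₂ hlam₂ h
    rw [SetLike.mem_coe, hL, Submodule.mem_span_singleton] at hlam₁ hlam₂
    obtain ⟨c, rfl⟩ := hlam₁
    obtain ⟨d, rfl⟩ := hlam₂
    beta_reduce at h
    rw [hsmul, hsmul] at h
    rw [smul_left_injective k hLam0 h]
  · intro Lam' hLam'
    rw [SetLike.mem_coe, hR, Submodule.mem_span_singleton] at hLam'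
    obtain ⟨c, rfl⟩ := hLam'
    refine ⟨c • lam, ?_, hsmul c⟩
    rw [SetLike.mem_coe, hL]
    exact Submodule.smul_mem _ _ (Submodule.mem_span_singleton_self lam)
  · rintro ⟨s, hs0, hsl, hsr⟩
    have hμε : μ = Q.counit := by
      ext h
      exact smul_left_injective k hs0 ((hμ s hsl h).symm.trans (hsr h))
    -- for a two-sided integral `p_R` and `p_L` agree on semi-invariant maps, without a twist
    have hw1 : ∀ G : H → H → H, Sweedler.IsLin2 k G → Q.IsSemiInvariant μ G →
        (Sweedler.sw3 Q.reassocInv fun x y z => G x (y * Q.beta * Q.antipode z * 1)) =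
          Sweedler.sw3 (Q.reassoc : H ⊗[k] (H ⊗[k] H)) fun x y z =>
            G (y * Q.antipodeInv hS (x * Q.beta)) z := by
      intro G hG hGμ
      rw [hμε] at hGμ
      simpa only [mul_one] using QuasiHopfAlgebra.IsSemiInvariant.sw_pR_eq_sw_pL Q hS hG hGμ
    have key1 := Q.frobeniusForm_comp_antipodeInv hS ht ht0 (hμ t ht) hw1 hlam hLam
    rw [Q.antipode_one, QuasiHopfAlgebra.dualHitRight_one] at key1
    rw [hL, hR, Submodule.map_span, Set.image_singleton, ← key1]
    rfl
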